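/- **Setting.** Let $a,b\in\mathbb Z$ and let $(\mathcal A,\cdot,[\,,\,],d)$ be a differential graded $(a,b)$-algebra over a field: $\mathcal A=\bigoplus_i\mathcal A_i$ is a graded vector space with a bilinear product of degree $a$, a bilinear bracket of degree $b$ and a linear map $d$ of degree $1$ such that, for homogeneous elements, $\alpha\cdot\beta=(-1)^{(|\alpha|+a)(|\beta|+a)}\beta\cdot\alpha$, $\ \alpha\cdot(\beta\cdot\gamma)=(\alpha\cdot\beta)\cdot\gamma$, $\ [\alpha,\beta]=-(-1)^{(|\alpha|+b)(|\beta|+b)}[\beta,\alpha]$, $(-1)^{(|\alpha|+b)(|\gamma|+b)}[[\alpha,\beta],\gamma]+(-1)^{(|\beta|+b)(|\alpha|+b)}[[\beta,\gamma],\alpha]+(-1)^{(|\gamma|+b)(|\beta|+b)}[[\gamma,\alpha],\beta]=0$, $[\alpha,\beta\cdot\gamma]=[\alpha,\beta]\cdot\gamma+(-1)^{(|\beta|+a)(|\alpha|+b)}\beta\cdot[\alpha,\gamma]$, $\ d\circ d=0$, $d(\alpha\cdot\beta)=d\alpha\cdot\beta+(-1)^{|\alpha|+a}\alpha\cdot d\beta$,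 $\ d[\alpha,\beta]=[d\alpha,\beta]+(-1)^{|\alpha|+b}[\alpha,d\beta]$. For a graded space $V$, $V[k]$ is $V$ with $V[k]_i=V_{i+k}$. On $\mathcal A[-a+1]$, where the degree is $dg(\alpha)=|\alpha|+a-1$ (written simply $\alpha$ in exponents), put $\mu(\alpha,\beta)=(-1)^{\alpha}\alpha\cdot\beta$ and $\ell(\alpha,\beta)=(-1)^{(b-a+1)\alpha}[\alpha,\beta]$. Below, $\varepsilon(\cdot)$ denotes the Koszul sign of a rearrangement of homogeneous elements. Let $\mathcal H=\bigoplus_{n\ge1}\big(\mathcal A[-a+1]^{\otimes n}/\sum_{p+q=n,\ p,q\ge1}\mathrm{Im}\,bat_{p,q}\big)$, where $bat_{p,q}(\alpha_1\otimes\dots\otimes\alpha_p,\alpha_{p+1}\otimes\dots\otimes\alpha_{p+q})=\sum_{\sigma\in Bat(p,q)}\varepsilon_\alpha(\sigma^{-1})\,\alpha_{\sigma^{-1}(1)}\otimes\dots\otimes\alpha_{\sigma^{-1}(p+q)}$ is the signed shuffle product; $Bat(p,q)$ is the set of $\sigma\in S_{p+q}$ that are increasing on $\{1,\dots,p\}$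 and on $\{p+1,\dots,p+q\}$, and $\varepsilon_\alpha(\sigma^{-1})$ is the Koszul sign of the rearrangement of $\alpha_1,\dots,\alpha_{p+q}$ into $\alpha_{\sigma^{-1}(1)},\dots,\alpha_{\sigma^{-1}(p+q)}$. The class of $\alpha_1\otimes\dots\otimes\alpha_n$ (a packet) is written $\alpha_1\underline\otimes\dots\underline\otimes\alpha_n$; its degree is $x=\alpha_1+\dots+\alpha_n$. Define $D$ and $\ell_2$ by $$D(\alpha_1\underline\otimes\dots\underline\otimes\alpha_n)=\sum_{k=1}^n(-1)^{\sum_{i<k}\alpha_i}\alpha_1\underline\otimes\dots\underline\otimes d(\alpha_k)\underline\otimes\dots\underline\otimes\alpha_n+\sum_{k=1}^{n-1}(-1)^{\sum_{i<k}\alpha_i}\alpha_1\underline\otimes\dots\underline\otimes\mu(\alpha_k,\alpha_{k+1})\underline\otimes\dots\underline\otimes\alpha_n$$ and, for $X=\alpha_1\underline\otimes\dots\underline\otimes\alpha_p$ and $Y=\alpha_{p+1}\underline\otimes\dots\underline\otimes\alpha_{p+q}$, $$\ell_2(X,Y)=\sum_{\substack{\sigma\in Bat(p,q),\ k:\\ \sigma^{-1}(k)\le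 p<\sigma^{-1}(k+1)}}\varepsilon_\alpha(\sigma^{-1})(-1)^{(b-a+1)\sum_{s<k}\alpha_{\sigma^{-1}(s)}}\alpha_{\sigma^{-1}(1)}\underline\otimes\dots\underline\otimes\ell(\alpha_{\sigma^{-1}(k)},\alpha_{\sigma^{-1}(k+1)})\underline\otimes\dots\underline\otimes\alpha_{\sigma^{-1}(p+q)}.$$ On $\mathcal H[a-b]$ the degree of $X$ is $x''=x-a+b$, and $x'=x''+1$; put $\ell_2''(X,Y)=(-1)^{x''}(-1)^{(a-b-1)x'}\ell_2(X,Y)$. On $S^+(\mathcal H[a-b])=\bigoplus_{n\ge1}S^n(\mathcal H[a-b])$ (graded symmetric powers), write $X_I$ for the product of the $X_i$, $i\in I$, in increasing order and $x_I''=\sum_{i\in I}x_i''$, and put $$\Delta(X_1\cdots X_n)=\sum_{I\sqcup J=\{1,\dots,n\},\ I,J\ne\emptyset}\varepsilon\begin{pmatrix}x_1''\dots x_n''\\x_I''\,x_J''\end{pmatrix}X_I\otimes X_J,$$ $$m(X_1\cdots X_n)=\sum_i\varepsilon\begin{pmatrix}x_1''\dots x_n''\\x_i''\,x_1''\dots\widehat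 i\dots x_n''\end{pmatrix}D(X_i)\,X_1\cdots\widehat i\cdots X_n,$$ $$\ell''(X_1\cdots X_n)=\sum_{i<j}\varepsilon\begin{pmatrix}x_1''\dots x_n''\\x_i''\,x_j''\,x_1''\dots\widehat{ij}\dots x_n''\end{pmatrix}\ell_2''(X_i,X_j)\,X_1\cdots\widehat{ij}\cdots X_n,$$ and, for packets $X_1,\dots,X_n$, with $I,J$ allowed to be empty and $U,V$ running over the cuts of the word $X_s$ into two nonempty words, $$\delta''(X_1\cdots X_n)=\sum_{\substack{1\le s\le n\\ I\sqcup J=\{1,\dots,n\}\setminus\{s\}}}\varepsilon\begin{pmatrix}x_1''\dots x_n''\\x_I''\,x_s''\,x_J''\end{pmatrix}\sum_{U\underline\otimes V=X_s}(-1)^{(a-b)(x_I''+u'')}\Big(X_I\,U\otimes V\,X_J+(-1)^{u''v''+a-b+1}X_I\,V\otimes U\,X_J\Big).$$ **Proposition.** These formulas determine unique well-defined linear maps $D$, $\ell_2$, $\Delta$, $m$, $\ell''$, $\delta''$. The maps $m$ and $\ell''$ are homogeneous of degree $1$ and are coderivations of $\Delta$, that is, $(f\otimes id+id\otimes f)\circ\Delta=\Delta\circ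 f$ for $f=m,\ell''$. They are also coderivations of $\delta''$, up to the sign $(-1)^{a-b}$: (i) $(m\otimes id+id\otimes m)\circ\delta''=(-1)^{a-b}\,\delta''\circ m$; (ii) $(\ell''\otimes id+id\otimes\ell'')\circ\delta''=(-1)^{a-b}\,\delta''\circ\ell''$. Consequently $Q=m+\ell''$ satisfies $(Q\otimes id+id\otimes Q)\circ\Delta=\Delta\circ Q$ and $(Q\otimes id+id\otimes Q)\circ\delta''=(-1)^{a-b}\,\delta''\circ Q$. Here $(id\otimes f)(x\otimes y)=(-1)^{x''}x\otimes f(y)$ for $x$ homogeneous of degree $x''$. -/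

import Mathlib

open scoped TensorProduct

namespace ABAlg

/-! Graded vector spaces over a field, and their shifts. -/

section Graded

variable {𝕜 : Type*} [Field 𝕜] {M : Type*} [AddCommGroup M] [Module 𝕜 M]

/-- The grading of the shifted space `M[k]`, with the convention `M[k]_i = M_{i+k}`. -/
def shift (𝒢 : ℤ → Submodule 𝕜 M) (k : ℤ) : ℤ → Submodule 𝕜 M := fun i => 𝒢 (i + k)

/-- The linear operator acting as `(-1)^i` on the elements of degree `i`. -/
structure Parity (𝒢 : ℤ → Submodule 𝕜 M) where
  op : M →ₗ[𝕜] M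
  op_apply : ∀ (i : ℤ) (x : M), x ∈ 𝒢 i → op x = i.negOnePow • x

/-- The parity operator of a graded vector space. -/
noncomputable def Parity.ofGrading (𝒢 : ℤ → Submodule 𝕜 M) [DirectSum.Decomposition 𝒢] :
    Parity 𝒢 where
  op := (DirectSum.toModule 𝕜 ℤ M fun i => ((i.negOnePow : ℤ) : 𝕜) • (𝒢 i).subtype) ∘ₗ
    (DirectSum.decomposeLinearEquiv 𝒢).toLinearMap
  op_apply i x hx := by
    lift x to 𝒢 i using hx
    simp only [LinearMap.comp_apply, LinearEquiv.coe_coe, DirectSum.decomposeLinearEquiv_apply,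
      DirectSum.decompose_coe]
    erw [DirectSum.toModule_lof]
    rw [LinearMap.smul_apply, Submodule.subtype_apply, Units.smul_def, Int.cast_smul_eq_zsmul]

/-- The parity operator of a shifted space. -/
def Parity.shift {𝒢 : ℤ → Submodule 𝕜 M} (P : Parity 𝒢) (k : ℤ) : Parity (ABAlg.shift 𝒢 k) where
  op := ((k.negOnePow : ℤ) : 𝕜) • P.op
  op_apply i x hx := by
    rw [LinearMap.smul_apply, P.op_apply (i + k) x hx, Int.cast_smul_eq_zsmul, ← Units.smul_def,
      smul_smul, Int.negOnePow_add, mul_comm, mul_assoc]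
    simp

end Graded

/-- The Koszul sign of the rearrangement of `x₀ x₁ … x₍ₙ₋₁₎`, of degrees `e`, into the order
given by the list: every inversion `… i … j …` with `j < i` contributes `(-1)^(e i * e j)`. -/
def koszul {n : ℕ} (e : Fin n → ℤ) : List (Fin n) → ℤˣ
  | [] => 1
  | i :: L => (((L.filter fun j => j < i).map fun j => e i * e j).sum).negOnePow * koszul e L

/-- The elements of `I`, in increasing order. -/
def increasing {n : ℕ} (I : Finset (Fin n)) : List (Fin n) :=
  (List.finRange n).filter fun i => i ∈ I

/-- The `(p,q)`-shuffles: permutations increasing on the first `p` and on the last `q` places. -/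
def Bat (p q : ℕ) : Finset (Equiv.Perm (Fin (p + q))) :=
  {σ | (∀ i j : Fin p, i < j → σ (Fin.castAdd q i) < σ (Fin.castAdd q j)) ∧
       (∀ i j : Fin q, i < j → σ (Fin.natAdd p i) < σ (Fin.natAdd p j))}

section Tensor

variable {𝕜 : Type*} [Field 𝕜] {V : Type*} [AddCommGroup V] [Module 𝕜 V]

/-- The tensor `v₁ ⊗ ⋯ ⊗ vₙ` of a list of vectors. -/
noncomputable def word (𝕜 : Type*) [Field 𝕜] {V : Type*} [AddCommGroup V] [Module 𝕜 V]
    (l : List V) : TensorAlgebra 𝕜 V :=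
  (l.map (TensorAlgebra.ι 𝕜)).prod

/-- The shuffle product of `α₁ ⊗ ⋯ ⊗ αₚ` and `α₍ₚ₊₁₎ ⊗ ⋯ ⊗ α₍ₚ₊q₎`, the letters having
degrees `e`. -/
noncomputable def bat (𝕜 : Type*) [Field 𝕜] {V : Type*} [AddCommGroup V] [Module 𝕜 V]
    (p q : ℕ) (e : Fin (p + q) → ℤ) (α : Fin (p + q) → V) : TensorAlgebra 𝕜 V :=
  ∑ σ ∈ Bat p q, koszul e (List.ofFn fun i => σ⁻¹ i) • word 𝕜 (List.ofFn fun i => α (σ⁻¹ i))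

/-- The span of the scalars and of all shuffle products of nonempty homogeneous words. -/
def shuffles (𝒱 : ℤ → Submodule 𝕜 V) : Submodule 𝕜 (TensorAlgebra 𝕜 V) :=
  Submodule.span 𝕜 ({1} ∪ {t | ∃ (p q : ℕ) (e : Fin (p + q) → ℤ) (α : Fin (p + q) → V),
    0 < p ∧ 0 < q ∧ (∀ i, α i ∈ 𝒱 (e i)) ∧ t = bat 𝕜 p q e α})

/-- The space `⨁_{n ≥ 1} V^{⊗n} / ∑_{p+q=n, p,q ≥ 1} Im bat_{p,q}`. It is obtained from the whole
tensor algebra `𝕜 ⊕ ⨁_{n ≥ 1} V^{⊗n}` by killing the scalars as well as the shuffles. -/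
abbrev Packets (𝒱 : ℤ → Submodule 𝕜 V) : Type _ := TensorAlgebra 𝕜 V ⧸ shuffles 𝒱

/-- The packet of a list of vectors, that is, the class of their tensor product
(the class of the empty list is `0`). -/
noncomputable def packet (𝒱 : ℤ → Submodule 𝕜 V) (l : List V) : Packets 𝒱 :=
  (shuffles 𝒱).mkQ (word 𝕜 l)

/-- The grading of `Packets 𝒱`: the degree of a packet is the sum of those of its letters. -/
def packetGrading (𝒱 : ℤ → Submodule 𝕜 V) (t : ℤ) : Submodule 𝕜 (Packets 𝒱) :=
  Submodule.span 𝕜 {X | ∃ (n : ℕ) (e : Fin n → ℤ) (α : Fin n → V),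
    (∀ i, α i ∈ 𝒱 (e i)) ∧ ∑ i, e i = t ∧ X = packet 𝒱 (List.ofFn α)}

/-- The span of the scalars and of all `u ⊗ (x ⊗ y - (-1)^(deg x * deg y) y ⊗ x) ⊗ v` with `x`, `y`
homogeneous and `u`, `v` words. -/
def commutators (𝒱 : ℤ → Submodule 𝕜 V) : Submodule 𝕜 (TensorAlgebra 𝕜 V) :=
  Submodule.span 𝕜 ({1} ∪ {t | ∃ (u v : List V) (i j : ℤ) (x y : V), x ∈ 𝒱 i ∧ y ∈ 𝒱 j ∧
    t = word 𝕜 (u ++ x :: y :: v) - (i * j).negOnePow • word 𝕜 (u ++ y :: x :: v)})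

/-- The space `S⁺(V) = ⨁_{n ≥ 1} Sⁿ(V)` of a graded vector space, obtained from the whole tensor
algebra by killing the scalars and the graded commutators. -/
abbrev SymPlus (𝒱 : ℤ → Submodule 𝕜 V) : Type _ := TensorAlgebra 𝕜 V ⧸ commutators 𝒱

/-- The product `x₁ ⋯ xₙ` in `S⁺(V)` (the class of the empty list is `0`). -/
noncomputable def symProd (𝒱 : ℤ → Submodule 𝕜 V) (l : List V) : SymPlus 𝒱 :=
  (commutators 𝒱).mkQ (word 𝕜 l)

/-- The grading of `S⁺(V)`. -/
def symGrading (𝒱 : ℤ → Submodule 𝕜 V) (t : ℤ) : Submodule 𝕜 (SymPlus 𝒱) :=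
  Submodule.span 𝕜 {X | ∃ (n : ℕ) (x : Fin n → ℤ) (α : Fin n → V),
    (∀ i, α i ∈ 𝒱 (x i)) ∧ ∑ i, x i = t ∧ X = symProd 𝒱 (List.ofFn α)}

/-- The algebra endomorphism of the tensor algebra induced by a linear map. -/
noncomputable def tmap (f : V →ₗ[𝕜] V) : TensorAlgebra 𝕜 V →ₐ[𝕜] TensorAlgebra 𝕜 V :=
  TensorAlgebra.lift 𝕜 (TensorAlgebra.ι 𝕜 ∘ₗ f)

theorem tmap_ι (f : V →ₗ[𝕜] V) (x : V) :
    tmap f (TensorAlgebra.ι 𝕜 x) = TensorAlgebra.ι 𝕜 (f x) := by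
  simp [tmap]

theorem map_word (f : V →ₗ[𝕜] V) (l : List V) :
    tmap f (word 𝕜 l) = word 𝕜 (l.map f) := by
  induction l with
  | nil => simp [word]
  | cons x l ih => simp only [word, List.map_cons, List.prod_cons, map_mul] at ih ⊢; rw [ih, tmap_ι]

theorem map_parity_word {𝒱 : ℤ → Submodule 𝕜 V} (P : Parity 𝒱) {n : ℕ} (e : Fin n → ℤ)
    (α : Fin n → V) (h : ∀ i, α i ∈ 𝒱 (e i)) :
    tmap P.op (word 𝕜 (List.ofFn α)) =
      (∑ i, e i).negOnePow • word 𝕜 (List.ofFn α) := by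
  induction n with
  | zero => simp [word]
  | succ n ih =>
    have := ih (fun i => e i.succ) (fun i => α i.succ) (fun i => h _)
    simp only [word, List.ofFn_succ, List.map_cons, List.prod_cons, map_mul] at this ⊢
    rw [this, tmap_ι, P.op_apply _ _ (h 0), Fin.sum_univ_succ,
      Int.negOnePow_add]
    simp only [Units.smul_def, map_zsmul, smul_mul_assoc, mul_smul_comm, smul_smul, Units.val_mul]
    rw [mul_comm]

theorem shuffles_le (𝒱 : ℤ → Submodule 𝕜 V) (P : Parity 𝒱) :
    shuffles 𝒱 ≤ (shuffles 𝒱).comap (tmap P.op).toLinearMap := by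
  refine Submodule.span_le.2 ?_
  rintro t (rfl | ⟨p, q, e, α, hp, hq, h, rfl⟩)
  · simp only [SetLike.mem_coe, Submodule.mem_comap, AlgHom.toLinearMap_apply, map_one]
    exact Submodule.subset_span (Or.inl rfl)
  · have key : tmap P.op (bat 𝕜 p q e α) = (∑ i, e i).negOnePow • bat 𝕜 p q e α := by
      simp only [bat, map_sum, Finset.smul_sum]
      refine Finset.sum_congr rfl fun σ _ => ?_
      have h2 := map_parity_word P (fun i => e (σ⁻¹ i)) (fun i => α (σ⁻¹ i)) (fun i => h _)
      rw [Equiv.sum_comp σ⁻¹ e] at h2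
      rw [Units.smul_def, map_zsmul, h2, smul_comm]
    simp only [SetLike.mem_coe, Submodule.mem_comap, AlgHom.toLinearMap_apply, key]
    rw [Units.smul_def]
    have hmem : bat 𝕜 p q e α ∈ shuffles 𝒱 :=
      Submodule.subset_span (Or.inr ⟨p, q, e, α, hp, hq, h, rfl⟩)
    exact zsmul_mem hmem _

/-- The parity operator of the space of packets. -/
noncomputable def Parity.packets {𝒱 : ℤ → Submodule 𝕜 V} (P : Parity 𝒱) :
    Parity (packetGrading 𝒱) where
  op := (shuffles 𝒱).mapQ (shuffles 𝒱) (tmap P.op).toLinearMap (shuffles_le 𝒱 P)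
  op_apply t x hx := by
    induction hx using Submodule.span_induction with
    | mem x hx =>
      obtain ⟨n, e, α, h, rfl, rfl⟩ := hx
      simp only [packet, Submodule.mkQ_apply, Submodule.mapQ_apply, AlgHom.toLinearMap_apply,
        map_parity_word P e α h]
      simp only [Units.smul_def, ← Submodule.mkQ_apply, map_zsmul]
    | zero => simp
    | add x y _ _ hx hy => rw [map_add, hx, hy, smul_add]
    | smul c x _ hx => rw [map_smul, hx, smul_comm]

theorem commutators_le (𝒱 : ℤ → Submodule 𝕜 V) (P : Parity 𝒱) :
    commutators 𝒱 ≤ (commutators 𝒱).comap (tmap P.op).toLinearMap := by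
  refine Submodule.span_le.2 ?_
  rintro t (rfl | ⟨u, v, i, j, x, y, hx, hy, rfl⟩)
  · simp only [SetLike.mem_coe, Submodule.mem_comap, AlgHom.toLinearMap_apply, map_one]
    exact Submodule.subset_span (Or.inl rfl)
  · simp only [SetLike.mem_coe, Submodule.mem_comap, AlgHom.toLinearMap_apply, map_sub,
      Units.smul_def, map_zsmul, map_word, List.map_append, List.map_cons]
    refine Submodule.subset_span (Or.inr ⟨u.map P.op, v.map P.op, i, j, P.op x, P.op y, ?_, ?_, ?_⟩)
    · rw [P.op_apply i x hx, Units.smul_def]; exact zsmul_mem hx _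
    · rw [P.op_apply j y hy, Units.smul_def]; exact zsmul_mem hy _
    · rw [Units.smul_def]

/-- The parity operator of `S⁺(V)`. -/
noncomputable def Parity.sym {𝒱 : ℤ → Submodule 𝕜 V} (P : Parity 𝒱) :
    Parity (symGrading 𝒱) where
  op := (commutators 𝒱).mapQ (commutators 𝒱) (tmap P.op).toLinearMap
    (commutators_le 𝒱 P)
  op_apply t x hx := by
    induction hx using Submodule.span_induction with
    | mem x hx =>
      obtain ⟨n, e, α, h, rfl, rfl⟩ := hx
      simp only [symProd, Submodule.mkQ_apply, Submodule.mapQ_apply, AlgHom.toLinearMap_apply,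
        map_parity_word P e α h]
      simp only [Units.smul_def, ← Submodule.mkQ_apply, map_zsmul]
    | zero => simp
    | add x y _ _ hx hy => rw [map_add, hx, hy, smul_add]
    | smul c x _ hx => rw [map_smul, hx, smul_comm]

end Tensor

section Coderivation

variable {𝕜 : Type*} [Field 𝕜] {C : Type*} [AddCommGroup C] [Module 𝕜 C]

/-- `f` is homogeneous of degree `k`. -/
def HasDegree (𝒢 : ℤ → Submodule 𝕜 C) (k : ℤ) (f : C →ₗ[𝕜] C) : Prop :=
  ∀ (t : ℤ) (x : C), x ∈ 𝒢 t → f x ∈ 𝒢 (t + k)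

/-- For `f` of degree `1`, the operator `f ⊗ id + id ⊗ f` on `C ⊗ C`, with the Koszul rule
`(id ⊗ f)(x ⊗ y) = (-1)^(deg x) x ⊗ f y`. -/
noncomputable def tensorAction {𝒢 : ℤ → Submodule 𝕜 C} (P : Parity 𝒢) (f : C →ₗ[𝕜] C) :
    C ⊗[𝕜] C →ₗ[𝕜] C ⊗[𝕜] C :=
  TensorProduct.map f LinearMap.id + TensorProduct.map P.op f

/-- `(f ⊗ id + id ⊗ f) ∘ κ = (-1)^k κ ∘ f`: `f`, of degree `1`, is a coderivation of the
(co)operation `κ`, of degree congruent to `k` modulo `2`. -/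
def IsCoderivation {𝒢 : ℤ → Submodule 𝕜 C} (P : Parity 𝒢) (k : ℤ) (κ : C →ₗ[𝕜] C ⊗[𝕜] C)
    (f : C →ₗ[𝕜] C) : Prop :=
  tensorAction P f ∘ₗ κ = k.negOnePow • (κ ∘ₗ f)

end Coderivation

variable {𝕜 : Type*} [Field 𝕜] {A : Type*} [AddCommGroup A] [Module 𝕜 A]

/-- Differential graded `(a,b)`-algebras: a product of degree `a`, a bracket of degree `b` and a
differential of degree `1` on a graded vector space, such that `A[-a]` is a graded commutative
associative algebra, `A[-b]` is a graded Lie algebra, the bracket acts by graded derivations of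
the product, and the differential is a graded derivation of both. -/
structure IsDGABAlgebra (𝒜 : ℤ → Submodule 𝕜 A) (a b : ℤ) (mul br : A →ₗ[𝕜] A →ₗ[𝕜] A)
    (d : A →ₗ[𝕜] A) : Prop where
  mul_mem : ∀ i j x y, x ∈ 𝒜 i → y ∈ 𝒜 j → mul x y ∈ 𝒜 (i + j + a)
  br_mem : ∀ i j x y, x ∈ 𝒜 i → y ∈ 𝒜 j → br x y ∈ 𝒜 (i + j + b)
  d_mem : ∀ i x, x ∈ 𝒜 i → d x ∈ 𝒜 (i + 1)
  mul_comm : ∀ i j x y, x ∈ 𝒜 i → y ∈ 𝒜 j →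
    mul x y = ((i + a) * (j + a)).negOnePow • mul y x
  mul_assoc : ∀ x y z, mul x (mul y z) = mul (mul x y) z
  br_antisymm : ∀ i j x y, x ∈ 𝒜 i → y ∈ 𝒜 j →
    br x y = -(((i + b) * (j + b)).negOnePow • br y x)
  jacobi : ∀ i j k x y z, x ∈ 𝒜 i → y ∈ 𝒜 j → z ∈ 𝒜 k →
    ((i + b) * (k + b)).negOnePow • br (br x y) z +
      ((j + b) * (i + b)).negOnePow • br (br y z) x +
      ((k + b) * (j + b)).negOnePow • br (br z x) y = 0
  leibniz : ∀ i j x y z, x ∈ 𝒜 i → y ∈ 𝒜 j →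
    br x (mul y z) = mul (br x y) z + ((j + a) * (i + b)).negOnePow • mul y (br x z)
  d_d : ∀ x, d (d x) = 0
  d_mul : ∀ i x y, x ∈ 𝒜 i → d (mul x y) = mul (d x) y + (i + a).negOnePow • mul x (d y)
  d_br : ∀ i x y, x ∈ 𝒜 i → d (br x y) = br (d x) y + (i + b).negOnePow • br x (d y)

/-- The grading `dg α = |α| + a - 1` of `A[-a+1]`. -/
abbrev gradA (𝒜 : ℤ → Submodule 𝕜 A) (a : ℤ) : ℤ → Submodule 𝕜 A := shift 𝒜 (-a + 1)

/-- The space `H` of packets of elements of `A[-a+1]`. -/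
abbrev H (𝒜 : ℤ → Submodule 𝕜 A) (a : ℤ) : Type _ := Packets (gradA 𝒜 a)

/-- The packet `α₁ ⊗ ⋯ ⊗ αₙ` in `H`. -/
noncomputable abbrev pk (𝒜 : ℤ → Submodule 𝕜 A) (a : ℤ) (l : List A) : H 𝒜 a :=
  packet (gradA 𝒜 a) l

/-- The grading `x'' = dg X - a + b` of `H[a-b]`. -/
abbrev gradH (𝒜 : ℤ → Submodule 𝕜 A) (a b : ℤ) : ℤ → Submodule 𝕜 (H 𝒜 a) :=
  shift (packetGrading (gradA 𝒜 a)) (a - b)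

/-- The space `S⁺(H[a-b])`. -/
abbrev S (𝒜 : ℤ → Submodule 𝕜 A) (a b : ℤ) : Type _ := SymPlus (gradH 𝒜 a b)

/-- The product `X₁ ⋯ Xₙ` in `S⁺(H[a-b])`. -/
noncomputable abbrev sp (𝒜 : ℤ → Submodule 𝕜 A) (a b : ℤ) (l : List (H 𝒜 a)) : S 𝒜 a b :=
  symProd (gradH 𝒜 a b) l

/-- The grading of `S⁺(H[a-b])` induced by that of `H[a-b]`. -/
abbrev gradS (𝒜 : ℤ → Submodule 𝕜 A) (a b : ℤ) : ℤ → Submodule 𝕜 (S 𝒜 a b) :=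
  symGrading (gradH 𝒜 a b)

/-- The parity operator of `S⁺(H[a-b])`. -/
noncomputable def parityS (𝒜 : ℤ → Submodule 𝕜 A) [DirectSum.Decomposition 𝒜] (a b : ℤ) :
    Parity (gradS 𝒜 a b) :=
  (((Parity.ofGrading 𝒜).shift (-a + 1)).packets.shift (a - b)).sym

/-- `μ(α, β) = (-1)^(dg α) α · β`, for `α` of degree `e` in `A[-a+1]`. -/
def mu (mul : A →ₗ[𝕜] A →ₗ[𝕜] A) (e : ℤ) (α β : A) : A := e.negOnePow • mul α β

/-- `ℓ(α, β) = (-1)^((b-a+1) dg α) [α, β]`, for `α` of degree `e` in `A[-a+1]`. -/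
def ell (a b : ℤ) (br : A →ₗ[𝕜] A →ₗ[𝕜] A) (e : ℤ) (α β : A) : A :=
  ((b - a + 1) * e).negOnePow • br α β

/-- `D : H → H` is the extension of `d` and `μ` to packets:
`D(α₁ ⊗ ⋯ ⊗ αₙ) = ∑_k ± α₁ ⊗ ⋯ ⊗ d(α_k) ⊗ ⋯ ⊗ αₙ + ∑_{k<n} ± α₁ ⊗ ⋯ ⊗ μ(α_k, α_{k+1}) ⊗ ⋯ ⊗ αₙ`,
both signs being `(-1)^(∑_{i<k} dg α_i)`. -/
def IsD (𝒜 : ℤ → Submodule 𝕜 A) (a : ℤ) (mul : A →ₗ[𝕜] A →ₗ[𝕜] A) (d : A →ₗ[𝕜] A)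
    (D : H 𝒜 a →ₗ[𝕜] H 𝒜 a) : Prop :=
  ∀ (n : ℕ) (e : Fin n → ℤ) (α : Fin n → A), (∀ i, α i ∈ gradA 𝒜 a (e i)) →
    D (pk 𝒜 a (List.ofFn α)) =
      (∑ k : Fin n, (∑ i with i < k, e i).negOnePow •
        pk 𝒜 a ((List.ofFn α).take k ++ d (α k) :: (List.ofFn α).drop (k + 1))) +
      ∑ kk : Fin n × Fin n with kk.1.val + 1 = kk.2.val, (∑ i with i < kk.1, e i).negOnePow •
        pk 𝒜 a ((List.ofFn α).take kk.1 ++ mu mul (e kk.1) (α kk.1) (α kk.2) ::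
          (List.ofFn α).drop (kk.1 + 2))

/-- `L : H ⊗ H → H` is the bracket `ℓ₂` extending `ℓ` to packets: for `X = α₁ ⊗ ⋯ ⊗ αₚ` and
`Y = α₍ₚ₊₁₎ ⊗ ⋯ ⊗ α₍ₚ₊q₎`, it is the sum over the `(p,q)`-shuffles `σ` and over the pairs of
consecutive places `k`, `k + 1` with `σ⁻¹(k) ≤ p < σ⁻¹(k+1)` of the shuffled words in which
`ℓ` is applied to the letters at the places `k`, `k + 1`. -/
def IsEllTwo (𝒜 : ℤ → Submodule 𝕜 A) (a b : ℤ) (br : A →ₗ[𝕜] A →ₗ[𝕜] A)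
    (L : H 𝒜 a →ₗ[𝕜] H 𝒜 a →ₗ[𝕜] H 𝒜 a) : Prop :=
  ∀ (p q : ℕ) (e : Fin (p + q) → ℤ) (α : Fin (p + q) → A), (∀ i, α i ∈ gradA 𝒜 a (e i)) →
    L (pk 𝒜 a (List.ofFn fun i : Fin p => α (Fin.castAdd q i)))
      (pk 𝒜 a (List.ofFn fun j : Fin q => α (Fin.natAdd p j))) =
    ∑ σ ∈ Bat p q, ∑ kk : Fin (p + q) × Fin (p + q) with
        kk.1.val + 1 = kk.2.val ∧ (σ⁻¹ kk.1).val < p ∧ p ≤ (σ⁻¹ kk.2).val,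
      (koszul e (List.ofFn fun i => σ⁻¹ i) *
        ((b - a + 1) * ∑ s with s < kk.1, e (σ⁻¹ s)).negOnePow) •
      pk 𝒜 a ((List.ofFn fun i => α (σ⁻¹ i)).take kk.1 ++
        ell a b br (e (σ⁻¹ kk.1)) (α (σ⁻¹ kk.1)) (α (σ⁻¹ kk.2)) ::
        (List.ofFn fun i => α (σ⁻¹ i)).drop (kk.1 + 2))

/-- For `X` of degree `x` in `H[a-b]`, hence of degree `x + 1` in `H[a-b-1]`:
`ℓ''₂(X, Y) = (-1)^x ℓ'₂(X, Y)`, where `ℓ'₂(X, Y) = (-1)^((a-b-1)(x+1)) ℓ₂(X, Y)`. -/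
def ellTwo'' {𝒜 : ℤ → Submodule 𝕜 A} {a : ℤ} (b : ℤ)
    (L : H 𝒜 a →ₗ[𝕜] H 𝒜 a →ₗ[𝕜] H 𝒜 a) (x : ℤ) (X Y : H 𝒜 a) : H 𝒜 a :=
  x.negOnePow • ((a - b - 1) * (x + 1)).negOnePow • L X Y

/-- `Δ(X₁ ⋯ Xₙ) = ∑ ε(x''; x''_I x''_J) X_I ⊗ X_J`, over the partitions of `{1, …, n}` into two
nonempty subsets `I` and `J`. -/
def IsDelta (𝒜 : ℤ → Submodule 𝕜 A) (a b : ℤ) (Δ : S 𝒜 a b →ₗ[𝕜] S 𝒜 a b ⊗[𝕜] S 𝒜 a b) : Prop :=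
  ∀ (n : ℕ) (x : Fin n → ℤ) (X : Fin n → H 𝒜 a), (∀ i, X i ∈ gradH 𝒜 a b (x i)) →
    Δ (sp 𝒜 a b (List.ofFn X)) =
      ∑ I : Finset (Fin n) with I.Nonempty ∧ Iᶜ.Nonempty,
        koszul x (increasing I ++ increasing Iᶜ) •
          (sp 𝒜 a b ((increasing I).map X) ⊗ₜ[𝕜] sp 𝒜 a b ((increasing Iᶜ).map X))

/-- `m(X₁ ⋯ Xₙ) = ∑_i ε(x''; x''_i x''_1 ⋯ î ⋯ x''_n) D(X_i) X₁ ⋯ î ⋯ Xₙ`. -/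
def IsM (𝒜 : ℤ → Submodule 𝕜 A) (a b : ℤ) (D : H 𝒜 a →ₗ[𝕜] H 𝒜 a)
    (m : S 𝒜 a b →ₗ[𝕜] S 𝒜 a b) : Prop :=
  ∀ (n : ℕ) (x : Fin n → ℤ) (X : Fin n → H 𝒜 a), (∀ i, X i ∈ gradH 𝒜 a b (x i)) →
    m (sp 𝒜 a b (List.ofFn X)) =
      ∑ i : Fin n, koszul x (i :: increasing {i}ᶜ) •
        sp 𝒜 a b (D (X i) :: (increasing {i}ᶜ).map X)

/-- `ℓ''(X₁ ⋯ Xₙ) = ∑_{i<j} ε(x''; x''_i x''_j x''_1 ⋯ îj ⋯ x''_n) ℓ''₂(X_i, X_j) X₁ ⋯ îj ⋯ Xₙ`. -/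
def IsEll'' (𝒜 : ℤ → Submodule 𝕜 A) (a b : ℤ) (L : H 𝒜 a →ₗ[𝕜] H 𝒜 a →ₗ[𝕜] H 𝒜 a)
    (l : S 𝒜 a b →ₗ[𝕜] S 𝒜 a b) : Prop :=
  ∀ (n : ℕ) (x : Fin n → ℤ) (X : Fin n → H 𝒜 a), (∀ i, X i ∈ gradH 𝒜 a b (x i)) →
    l (sp 𝒜 a b (List.ofFn X)) =
      ∑ ij : Fin n × Fin n with ij.1 < ij.2,
        koszul x (ij.1 :: ij.2 :: increasing {ij.1, ij.2}ᶜ) •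
          sp 𝒜 a b (ellTwo'' b L (x ij.1) (X ij.1) (X ij.2) :: (increasing {ij.1, ij.2}ᶜ).map X)

/-- The degree in `H[a-b]` of the packet of the letters of degrees `e` in `A[-a+1]`. -/
def deg'' (a b : ℤ) (e : List ℤ) : ℤ := e.sum - (a - b)

/-- The cobracket `δ''`. For packets `X_s = α_{s,1} ⊗ ⋯ ⊗ α_{s,N_s}` of homogeneous letters,
`δ''(X₁ ⋯ Xₙ)` is the sum over `s`, over the partitions `I ∪ J = {1, …, n} \ {s}` (`I` and `J` may
be empty) and over the cuts `X_s = U ⊗ V` into two nonempty words of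
`ε(x''; x''_I x''_s x''_J) (-1)^((a-b)(x''_I + u''))
  (X_I U ⊗ V X_J + (-1)^(u''v'' + a - b + 1) X_I V ⊗ U X_J)`. -/
def IsCobracket'' (𝒜 : ℤ → Submodule 𝕜 A) (a b : ℤ)
    (δ : S 𝒜 a b →ₗ[𝕜] S 𝒜 a b ⊗[𝕜] S 𝒜 a b) : Prop :=
  ∀ (n : ℕ) (N : Fin n → ℕ) (e : ∀ s, Fin (N s) → ℤ) (α : ∀ s, Fin (N s) → A),
    (∀ s i, α s i ∈ gradA 𝒜 a (e s i)) →
    let X : Fin n → H 𝒜 a := fun s => pk 𝒜 a (List.ofFn (α s))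
    let x : Fin n → ℤ := fun s => deg'' a b (List.ofFn (e s))
    δ (sp 𝒜 a b (List.ofFn X)) =
      ∑ s : Fin n, ∑ I : Finset (Fin n) with s ∉ I, ∑ j ∈ Finset.Ioo 0 (N s),
        let J : Finset (Fin n) := (insert s I)ᶜ
        let U := pk 𝒜 a ((List.ofFn (α s)).take j)
        let V := pk 𝒜 a ((List.ofFn (α s)).drop j)
        let u := deg'' a b ((List.ofFn (e s)).take j)
        let v := deg'' a b ((List.ofFn (e s)).drop j)
        (koszul x (increasing I ++ s :: increasing J) *
          ((a - b) * (∑ i ∈ I, x i + u)).negOnePow) •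
        (sp 𝒜 a b ((increasing I).map X ++ [U]) ⊗ₜ[𝕜] sp 𝒜 a b (V :: (increasing J).map X) +
          (u * v + (a - b) + 1).negOnePow •
            (sp 𝒜 a b ((increasing I).map X ++ [V]) ⊗ₜ[𝕜] sp 𝒜 a b (U :: (increasing J).map X)))

end ABAlg

/-! Put `k = a - b`. The proof moves from words to packets to symmetric powers. At each level the
operations are characterized by a recursion on the first letter or factor, and the identities follow
by induction.

Words in `A[-a+1]` carry the signed shuffle `sh`, the extension `shBr` of `ℓ` (of degree `1 - k`),
the operator `tensorD` extending `d` and `μ`, and the deconcatenation `cut`. Graded commutativity of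
the product makes `μ` antisymmetric in the shifted degrees. In `tensorD` of a shuffle, products of
letters of different words therefore cancel in pairs, so `tensorD` is a derivation of the shuffle
(`tensorD_sh`). The bracket `shBr` inherits the symmetry of `ℓ` and is a derivation of the shuffle
in its first, hence in each, argument (`shBr_symm`, `shBr_sh`). So both operations descend to
packets.

A cut of a shuffle is a shuffle of cuts (`cut_sh`), and a letter made by `d`, `μ` or `ℓ` lies on one
side of the cut (`cut_tensorD`, `cut_shBr`). Modulo shuffles few terms survive, because a shuffle
product only sees scalar parts (`mkQ_sh`). The cut of a shuffle of `X` and `Y` becomes `X ⊗ Y ± Y ⊗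
X` (`kap_sh`), so the antisymmetrized cut is a well-defined cobracket on packets. The cut of `ℓ₂(X,
Y)` becomes the action of `X` on the cut of `Y` minus, up to sign, that of `Y` on the cut of `X`
(`kap_shBr`). This one-cocycle condition survives antisymmetrization. After the shift by `k` the
bracket is symmetric of degree `1`, and the cobracket is compatible with it and with `D`
(`cobracket_betaMap`, `der_packetCobracket`).

The rest is formal, for any graded space `W` with such operations. On the symmetric algebra with
unit, `Δ` is the multiplicative coproduct and `m` is the derivation extending `D`. The operator
`ℓ''` satisfies `ℓ''(x t) = ad_x t ± x ℓ''(t)`, with `ad_x` the derivation extending the bracket by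
`x`, and `δ''` satisfies `δ''(x t) = δ(x) Δ(t) ± (x ⊗ 1 + 1 ⊗ x) δ''(t)`. The coderivation
identities follow by induction on the number of factors. The essential step is `IsSymBr.ad_cobr`,
which extends the cocycle condition to the whole symmetric algebra in one argument. The recursions
unfold to the sums of the statement, and killing the scalars gives `S⁺`. -/

namespace ABAlg

/-! ### Signs as scalars of the field. -/

section Sign

/-- The sign `(-1)^n` as a scalar. -/
def sg (𝕜 : Type*) [Field 𝕜] (n : ℤ) : 𝕜 := ((n.negOnePow : ℤ) : 𝕜)

variable {𝕜 : Type*} [Field 𝕜] {M : Type*} [AddCommGroup M] [Module 𝕜 M]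

theorem negOnePow_smul (𝕜 : Type*) [Field 𝕜] [Module 𝕜 M] (n : ℤ) (x : M) :
    n.negOnePow • x = sg 𝕜 n • x := by
  rw [sg, Int.cast_smul_eq_zsmul, Units.smul_def]

theorem sg_add (m n : ℤ) : sg 𝕜 (m + n) = sg 𝕜 m * sg 𝕜 n := by
  simp [sg, Int.negOnePow_add]

theorem sg_zero : sg 𝕜 0 = 1 := by simp [sg]

theorem sg_one : sg 𝕜 1 = -1 := by simp [sg]

/-- Most sign checks below compare coefficients and end here: the exponents differ by an even
integer, a question about the parities of the degrees. -/
theorem sg_congr {m n : ℤ} (h : Even (m - n)) : sg 𝕜 m = sg 𝕜 n := by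
  rw [sg, sg, (Int.negOnePow_eq_iff m n).2 h]

theorem sg_add_eq_zero {m n : ℤ} (h : Even (m - n + 1)) : sg 𝕜 m + sg 𝕜 n = 0 := by
  rw [sg_congr (m := m) (n := n + 1) (by
    rw [show m - (n + 1) = m - n + 1 - 2 by ring]; exact h.sub even_two), sg_add, sg_one]
  ring

theorem neg_sg (n : ℤ) : -sg 𝕜 n = sg 𝕜 (n + 1) := by
  simp [sg, Int.negOnePow_succ]

theorem sg_mul_self (n : ℤ) : sg 𝕜 n * sg 𝕜 n = 1 := by
  rw [← sg_add, ← sg_zero]; exact sg_congr (by simp)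

end Sign

/-! ### Gradings, sign operators, gradings of quotients. -/

section Internal

variable {𝕜 : Type*} [Field 𝕜] {M : Type*} [AddCommGroup M] [Module 𝕜 M]
  {N : Type*} [AddCommMonoid N] [Module 𝕜 N]

/-- The submodules `𝒢 i` form a grading. -/
class Internal (𝒢 : ℤ → Submodule 𝕜 M) : Prop where
  isInternal : DirectSum.IsInternal 𝒢

variable (𝒢 : ℤ → Submodule 𝕜 M)

theorem iSup_eq_top [h : Internal 𝒢] : ⨆ i, 𝒢 i = ⊤ :=
  h.isInternal.submodule_iSup_eq_top

/-- A vector of degree `i` that lies in the sum of the other degrees is both fixed and killed by `π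
i`. -/
theorem Internal.of_proj (π : ℤ → M →ₗ[𝕜] M) (h₁ : ∀ i, ∀ x ∈ 𝒢 i, π i x = x)
    (h₂ : ∀ i j, i ≠ j → ∀ x ∈ 𝒢 i, π j x = 0) (h : ⨆ i, 𝒢 i = ⊤) : Internal 𝒢 := by
  refine ⟨DirectSum.isInternal_submodule_of_iSupIndep_of_iSup_eq_top (fun i => ?_) h⟩
  refine Submodule.disjoint_def.2 fun x hx hx' => ?_
  have : ⨆ j, ⨆ (_ : j ≠ i), 𝒢 j ≤ LinearMap.ker (π i) :=
    iSup₂_le fun j hj y hy => h₂ j i hj y hy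
  rw [← h₁ i x hx]
  exact this hx'

/-- The linear map that is `B i` in degree `i`. -/
noncomputable def gradedLift [h : Internal 𝒢] (B : ℤ → M →ₗ[𝕜] N) : M →ₗ[𝕜] N :=
  (DirectSum.toModule 𝕜 ℤ N fun i => B i ∘ₗ (𝒢 i).subtype) ∘ₗ
    (LinearEquiv.ofBijective (DirectSum.coeLinearMap 𝒢) h.isInternal).symm.toLinearMap

variable {𝒢}

theorem gradedLift_apply [h : Internal 𝒢] (B : ℤ → M →ₗ[𝕜] N) {i : ℤ} {x : M} (hx : x ∈ 𝒢 i) :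
    gradedLift 𝒢 B x = B i x := by
  have : (LinearEquiv.ofBijective (DirectSum.coeLinearMap 𝒢) h.isInternal).symm x =
      DirectSum.lof 𝕜 ℤ (fun i => 𝒢 i) i ⟨x, hx⟩ := by
    exact (LinearEquiv.symm_apply_eq _).2 (DirectSum.coeLinearMap_lof (A := 𝒢) i ⟨x, hx⟩).symm
  rw [gradedLift, LinearMap.comp_apply, LinearEquiv.coe_coe, this, DirectSum.toModule_lof]
  rfl

/-- Two linear maps that agree on homogeneous elements are equal. -/
theorem hom_ext [Internal 𝒢] {f g : M →ₗ[𝕜] N} (h : ∀ i, ∀ x ∈ 𝒢 i, f x = g x) : f = g := by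
  refine LinearMap.ext fun x => ?_
  have : (⊤ : Submodule 𝕜 M) ≤ LinearMap.eqLocus f g := by
    rw [← iSup_eq_top 𝒢]; exact iSup_le fun i x hx => h i x hx
  exact this trivial

variable (𝒢) in
/-- The operator `x ↦ (-1)^(j * deg x) x`. -/
noncomputable def pw [Internal 𝒢] (j : ℤ) : M →ₗ[𝕜] M :=
  gradedLift 𝒢 fun i => sg 𝕜 (j * i) • LinearMap.id

theorem pw_apply [Internal 𝒢] (j : ℤ) {i : ℤ} {x : M} (hx : x ∈ 𝒢 i) :
    pw 𝒢 j x = sg 𝕜 (j * i) • x := by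
  rw [pw, gradedLift_apply _ hx]; rfl

theorem Internal.proj_apply [Internal 𝒢] (i : ℤ) {j : ℤ} {x : M} (hx : x ∈ 𝒢 j) :
    gradedLift 𝒢 (fun k => if k = i then LinearMap.id else 0) x = if j = i then x else 0 := by
  rw [gradedLift_apply _ hx]; split_ifs <;> rfl

instance [h : Internal 𝒢] (k : ℤ) : Internal (shift 𝒢 k) := by
  refine Internal.of_proj _ (fun i => gradedLift 𝒢 (fun l => if l = i + k then LinearMap.id else 0))
    (fun i x hx => ?_) (fun i j hij x hx => ?_) ?_
  · rw [Internal.proj_apply (𝒢 := 𝒢) _ (j := i + k) hx, if_pos rfl]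
  · rw [Internal.proj_apply (𝒢 := 𝒢) _ (j := i + k) hx, if_neg (by omega)]
  · rw [← iSup_eq_top 𝒢]
    exact le_antisymm (iSup_le fun i => le_iSup 𝒢 (i + k)) (iSup_le fun i =>
      le_of_eq_of_le (by simp only [shift, sub_add_cancel]) (le_iSup (shift 𝒢 k) (i - k)))

/-- The degree projections send each homogeneous generator to itself or to zero, so they preserve
the span and induce projections of the quotient. -/
theorem Internal.mkQ [Internal 𝒢] (s : Set M) (hs : ∀ x ∈ s, ∃ i, x ∈ 𝒢 i) :
    Internal fun i => (𝒢 i).map (Submodule.span 𝕜 s).mkQ := by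
  let π (i : ℤ) : M →ₗ[𝕜] M := gradedLift 𝒢 (fun k => if k = i then LinearMap.id else 0)
  have hπ (i : ℤ) : Submodule.span 𝕜 s ≤ (Submodule.span 𝕜 s).comap (π i) := by
    refine Submodule.span_le.2 fun x hx => ?_
    obtain ⟨j, hj⟩ := hs x hx
    simp only [SetLike.mem_coe, Submodule.mem_comap, π]
    rw [Internal.proj_apply i hj]
    split_ifs
    · exact Submodule.subset_span hx
    · exact Submodule.zero_mem _
  refine Internal.of_proj _ (fun i => Submodule.mapQ _ _ (π i) (hπ i)) ?_ ?_ ?_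
  · rintro i _ ⟨x, hx, rfl⟩
    simp only [Submodule.mkQ_apply, Submodule.mapQ_apply, π]
    rw [Internal.proj_apply i hx, if_pos rfl]
  · rintro i j hij _ ⟨x, hx, rfl⟩
    simp only [Submodule.mkQ_apply, Submodule.mapQ_apply, π]
    rw [Internal.proj_apply j hx, if_neg hij, Submodule.Quotient.mk_zero]
  · rw [← Submodule.map_iSup, iSup_eq_top, Submodule.map_top, Submodule.range_mkQ]

variable (𝒢) in
/-- Induction on tensors of homogeneous elements. -/
theorem tensor_induction {M' : Type*} [AddCommGroup M'] [Module 𝕜 M'] (𝒢' : ℤ → Submodule 𝕜 M')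
    [Internal 𝒢] [Internal 𝒢'] {p : M ⊗[𝕜] M' → Prop} (z : M ⊗[𝕜] M') (zero : p 0)
    (add : ∀ x y, p x → p y → p (x + y))
    (tmul : ∀ i, ∀ x ∈ 𝒢 i, ∀ j, ∀ y ∈ 𝒢' j, p (x ⊗ₜ y)) : p z := by
  induction z using TensorProduct.induction_on with
  | zero => exact zero
  | add x y hx hy => exact add x y hx hy
  | tmul x y =>
    have hx : x ∈ ⨆ i, 𝒢 i := iSup_eq_top 𝒢 ▸ trivial
    have hy : y ∈ ⨆ i, 𝒢' i := iSup_eq_top 𝒢' ▸ trivial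
    induction hx using Submodule.iSup_induction' with
    | zero => rwa [TensorProduct.zero_tmul]
    | add x x' _ _ hx hx' => rw [TensorProduct.add_tmul]; exact add _ _ hx hx'
    | mem i x hx =>
    induction hy using Submodule.iSup_induction' with
    | zero => rwa [TensorProduct.tmul_zero]
    | add y y' _ _ hy hy' => rw [TensorProduct.tmul_add]; exact add _ _ hy hy'
    | mem j y hy => exact tmul i x hx j y hy

instance (𝒢 : ℤ → Submodule 𝕜 M) [DirectSum.Decomposition 𝒢] : Internal 𝒢 :=
  ⟨DirectSum.Decomposition.isInternal 𝒢⟩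

end Internal

/-! ### The tensor algebra: grading and recursion on the first letter. -/

section TensorGrading

variable {𝕜 : Type*} [Field 𝕜] {V : Type*} [AddCommGroup V] [Module 𝕜 V]
  {M : Type*} [AddCommGroup M] [Module 𝕜 M] (𝒱 : ℤ → Submodule 𝕜 V)

/-- The grading of the tensor algebra of a graded space. -/
def tensorGrading (t : ℤ) : Submodule 𝕜 (TensorAlgebra 𝕜 V) :=
  Submodule.span 𝕜 {X | ∃ (n : ℕ) (e : Fin n → ℤ) (α : Fin n → V),
    (∀ i, α i ∈ 𝒱 (e i)) ∧ ∑ i, e i = t ∧ X = word 𝕜 (List.ofFn α)}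

theorem word_nil : word 𝕜 ([] : List V) = 1 := rfl

theorem word_cons (x : V) (l : List V) : word 𝕜 (x :: l) = TensorAlgebra.ι 𝕜 x * word 𝕜 l := by
  simp [word]

variable {𝒱}

theorem word_mem_tensorGrading {n : ℕ} {e : Fin n → ℤ} {α : Fin n → V} (h : ∀ i, α i ∈ 𝒱 (e i)) :
    word 𝕜 (List.ofFn α) ∈ tensorGrading 𝒱 (∑ i, e i) :=
  Submodule.subset_span ⟨n, e, α, h, rfl, rfl⟩

theorem one_mem_tensorGrading : (1 : TensorAlgebra 𝕜 V) ∈ tensorGrading 𝒱 0 :=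
  Submodule.subset_span ⟨0, fun _ => 0, fun _ => 0, by simp, by simp, by simp [word]⟩

theorem ι_mul_mem {i m : ℤ} {v : V} {s : TensorAlgebra 𝕜 V} (hv : v ∈ 𝒱 i)
    (hs : s ∈ tensorGrading 𝒱 m) : TensorAlgebra.ι 𝕜 v * s ∈ tensorGrading 𝒱 (i + m) := by
  induction hs using Submodule.span_induction with
  | mem x hx =>
    obtain ⟨n, e, α, h, rfl, rfl⟩ := hx
    refine Submodule.subset_span ⟨n + 1, Fin.cons i e, Fin.cons v α, ?_, ?_, ?_⟩
    · exact fun k => Fin.cases (by simpa using hv) (by simpa using h) k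
    · simp [Fin.sum_univ_succ]
    · simp [List.ofFn_succ, word_cons]
  | zero => simp
  | add x y _ _ hx hy => rw [mul_add]; exact add_mem hx hy
  | smul c x _ hx => rw [mul_smul_comm]; exact Submodule.smul_mem _ _ hx

/-- Induction on homogeneous tensors. -/
theorem tensorGrading_induction {p : ℤ → TensorAlgebra 𝕜 V → Prop}
    (zero : ∀ m, p m 0) (add : ∀ m s t, p m s → p m t → p m (s + t))
    (smul : ∀ m (c : 𝕜) s, p m s → p m (c • s)) (one : p 0 1)
    (mul : ∀ i v m s, v ∈ 𝒱 i → s ∈ tensorGrading 𝒱 m → p m s →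
      p (i + m) (TensorAlgebra.ι 𝕜 v * s)) {m : ℤ} {s : TensorAlgebra 𝕜 V}
    (hs : s ∈ tensorGrading 𝒱 m) : p m s := by
  induction hs using Submodule.span_induction with
  | mem x hx =>
    obtain ⟨n, e, α, h, rfl, rfl⟩ := hx
    induction n with
    | zero => simpa [word] using one
    | succ n ih =>
      have := mul (e 0) (α 0) _ _ (h 0) (word_mem_tensorGrading (fun i => h (Fin.succ i)))
        (ih (fun i => e i.succ) (fun i => α i.succ) (fun i => h _))
      rwa [List.ofFn_succ, word_cons, Fin.sum_univ_succ]
  | zero => exact zero _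
  | add x y _ _ hx hy => exact add _ _ _ hx hy
  | smul c x _ hx => exact smul _ _ _ hx

/-- To prove that two linear maps agree on homogeneous tensors. -/
theorem tensorGrading_hom_induction {f g : ℤ → TensorAlgebra 𝕜 V →ₗ[𝕜] M}
    (one : f 0 1 = g 0 1)
    (mul : ∀ i v m s, v ∈ 𝒱 i → s ∈ tensorGrading 𝒱 m → f m s = g m s →
      f (i + m) (TensorAlgebra.ι 𝕜 v * s) = g (i + m) (TensorAlgebra.ι 𝕜 v * s))
    {m : ℤ} {s : TensorAlgebra 𝕜 V} (hs : s ∈ tensorGrading 𝒱 m) : f m s = g m s := by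
  refine tensorGrading_induction (p := fun m s => f m s = g m s) (fun m => by simp)
    (fun m s t h₁ h₂ => by simp [h₁, h₂]) (fun m c s h => by simp [h]) one mul hs

/-- The recursor of the tensor algebra: the linear map with `f 1 = m₀` and
`f (v ⊗ t) = A v t + B v (f t)`. -/
noncomputable def tensorRec (A : V →ₗ[𝕜] TensorAlgebra 𝕜 V →ₗ[𝕜] M) (B : V →ₗ[𝕜] M →ₗ[𝕜] M)
    (m₀ : M) : TensorAlgebra 𝕜 V →ₗ[𝕜] M :=
  -- Words act on pairs, a letter `v` by `(t, y) ↦ (v ⊗ t, A v t + B v y)`. Applied to `(1, m₀)`,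
  -- the action carries the argument along with the value.
  LinearMap.snd 𝕜 (TensorAlgebra 𝕜 V) M ∘ₗ
    LinearMap.applyₗ ((1 : TensorAlgebra 𝕜 V), m₀) ∘ₗ
    (TensorAlgebra.lift 𝕜 (A := Module.End 𝕜 (TensorAlgebra 𝕜 V × M))
      (LinearMap.mk₂ 𝕜 (fun v p => (TensorAlgebra.ι 𝕜 v * p.1, A v p.1 + B v p.2))
        (fun v w p => by simp [add_mul]; abel)
        (fun c v p => by simp)
        (fun v p q => by simp [mul_add]; abel)
        (fun c v p => by simp))).toLinearMap

variable (A : V →ₗ[𝕜] TensorAlgebra 𝕜 V →ₗ[𝕜] M) (B : V →ₗ[𝕜] M →ₗ[𝕜] M) (m₀ : M)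

theorem tensorRec_one : tensorRec A B m₀ 1 = m₀ := by
  simp [tensorRec]

theorem tensorAlgebra_induction_left {p : TensorAlgebra 𝕜 V → Prop} (one : p 1)
    (add : ∀ s t, p s → p t → p (s + t)) (smul : ∀ (c : 𝕜) s, p s → p (c • s))
    (mul : ∀ v s, p s → p (TensorAlgebra.ι 𝕜 v * s)) (s : TensorAlgebra 𝕜 V) : p s := by
  -- Allowing an arbitrary right factor `r` makes the multiplicative step of the usual induction
  -- compatible with adding letters on the left.
  suffices ∀ r, p r → p (s * r) by simpa using this 1 one
  induction s using TensorAlgebra.induction with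
  | algebraMap c => intro r hr; rw [← Algebra.smul_def]; exact smul _ _ hr
  | ι v => exact fun r hr => mul v r hr
  | mul s t hs ht => intro r hr; rw [mul_assoc]; exact hs _ (ht _ hr)
  | add s t hs ht => intro r hr; rw [add_mul]; exact add _ _ (hs _ hr) (ht _ hr)

theorem tensorRec_ι_mul (v : V) (t : TensorAlgebra 𝕜 V) :
    tensorRec A B m₀ (TensorAlgebra.ι 𝕜 v * t) = A v t + B v (tensorRec A B m₀ t) := by
  set F := TensorAlgebra.lift 𝕜 (A := Module.End 𝕜 (TensorAlgebra 𝕜 V × M))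
      (LinearMap.mk₂ 𝕜 (fun v p => (TensorAlgebra.ι 𝕜 v * p.1, A v p.1 + B v p.2))
        (fun v w p => by simp [add_mul]; abel)
        (fun c v p => by simp)
        (fun v p q => by simp [mul_add]; abel)
        (fun c v p => by simp)) with hF
  have hf (t) : tensorRec A B m₀ t = (F t (1, m₀)).2 := rfl
  have hι (v p) : F (TensorAlgebra.ι 𝕜 v) p =
      (TensorAlgebra.ι 𝕜 v * p.1, A v p.1 + B v p.2) := by simp [hF]
  -- The first component reproduces the argument, so `A` receives the tail itself.
  have h1 (t) : (F t (1, m₀)).1 = t := by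
    induction t using tensorAlgebra_induction_left with
    | one => simp
    | add s t hs ht => simp [hs, ht]
    | smul c s hs => simp [hs]
    | mul v s hs => rw [map_mul, Module.End.mul_apply, hι, hs]
  rw [hf, map_mul, Module.End.mul_apply, hι, h1, hf]

theorem word_span (G : Set V) (hG : Submodule.span 𝕜 G = ⊤) :
    Submodule.span 𝕜 {t | ∃ l : List V, (∀ x ∈ l, x ∈ G) ∧ t = word 𝕜 l} = ⊤ := by
  refine Submodule.eq_top_iff'.2 fun t => ?_
  induction t using tensorAlgebra_induction_left with
  | one => exact Submodule.subset_span ⟨[], by simp, word_nil.symm⟩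
  | add s t hs ht => exact add_mem hs ht
  | smul c s hs => exact Submodule.smul_mem _ _ hs
  | mul v s hs =>
    have hv : v ∈ Submodule.span 𝕜 G := hG ▸ trivial
    induction hv using Submodule.span_induction with
    | zero => simp
    | add x y _ _ hx hy => rw [map_add, add_mul]; exact add_mem hx hy
    | smul c x _ hx => rw [map_smul, smul_mul_assoc]; exact Submodule.smul_mem _ _ hx
    | mem v hv =>
      induction hs using Submodule.span_induction with
      | zero => simp
      | add x y _ _ hx hy => rw [mul_add]; exact add_mem hx hy
      | smul c x _ hx => rw [mul_smul_comm]; exact Submodule.smul_mem _ _ hx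
      | mem s hs =>
        obtain ⟨l, hl, rfl⟩ := hs
        exact Submodule.subset_span ⟨v :: l, by simpa [hv] using hl, (word_cons _ _).symm⟩

theorem iSup_tensorGrading [Internal 𝒱] : ⨆ m, tensorGrading 𝒱 m = ⊤ := by
  have hG : Submodule.span 𝕜 (⋃ i, (𝒱 i : Set V)) = ⊤ := by
    rw [Submodule.span_iUnion]; simpa using iSup_eq_top 𝒱
  rw [← word_span _ hG, eq_comm]
  refine le_antisymm (Submodule.span_le.2 ?_) (le_top.trans_eq (word_span _ hG).symm)
  rintro _ ⟨l, hl, rfl⟩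
  suffices ∃ m, word 𝕜 l ∈ tensorGrading 𝒱 m from
    this.elim fun m hm => Submodule.mem_iSup_of_mem m hm
  induction l with
  | nil => exact ⟨0, one_mem_tensorGrading⟩
  | cons x l ih =>
    obtain ⟨m, hm⟩ := ih fun y hy => hl y (List.mem_cons_of_mem _ hy)
    obtain ⟨i, hi⟩ := Set.mem_iUnion.1 (hl x List.mem_cons_self)
    exact ⟨i + m, by rw [word_cons]; exact ι_mul_mem hi hm⟩

variable (𝒱) in
/-- The projections of the tensor algebra onto its homogeneous components. -/
noncomputable def tensorProj [Internal 𝒱] : TensorAlgebra 𝕜 V →ₗ[𝕜] (ℤ → TensorAlgebra 𝕜 V) :=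
  -- A letter of degree `i` shifts by `i` the family of homogeneous components of the tail.
  tensorRec 0 (gradedLift 𝒱 fun i => LinearMap.mk₂ 𝕜
    (fun v f t => TensorAlgebra.ι 𝕜 v * f (t - i))
    (fun v w f => by ext; simp [add_mul]) (fun c v f => by ext; simp)
    (fun v f g => by ext; simp [mul_add]) (fun c v f => by ext; simp)) (Pi.single 0 1)

theorem tensorProj_apply [Internal 𝒱] {m : ℤ} {s : TensorAlgebra 𝕜 V}
    (hs : s ∈ tensorGrading 𝒱 m) : tensorProj 𝒱 s = Pi.single m s := by
  refine tensorGrading_hom_induction (f := fun _ => tensorProj 𝒱)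
    (g := fun m => LinearMap.single 𝕜 (fun _ => TensorAlgebra 𝕜 V) m) ?_ ?_ hs
  · rw [tensorProj, tensorRec_one]; rfl
  · intro i v m s hv _ ih
    rw [tensorProj, tensorRec_ι_mul, ← tensorProj, ih, gradedLift_apply _ hv]
    ext t
    by_cases h : t = i + m
    · subst h; simp
    · have : t - i ≠ m := by omega
      simp [h, this]

instance [Internal 𝒱] : Internal (tensorGrading 𝒱) :=
  Internal.of_proj _ (fun i => LinearMap.proj i ∘ₗ tensorProj 𝒱)
    (fun i x hx => by simp [tensorProj_apply hx])
    (fun i j hij x hx => by simp [tensorProj_apply hx, hij.symm]) iSup_tensorGrading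

end TensorGrading

end ABAlg

namespace ABAlg

/-! ### Bilinear operations on words defined by recursion. -/

section Bilinear

universe u

variable {𝕜 : Type*} [Field 𝕜] {V : Type u} [AddCommGroup V] [Module 𝕜 V]
  {M : Type*} [AddCommGroup M] [Module 𝕜 M] {𝒱 : ℤ → Submodule 𝕜 V}

/-- The recursion defining a bilinear map on words in the letters `x a` of degrees `e a`. -/
noncomputable def wordRec {κ : Type*} (e : κ → ℤ) (x : κ → V)
    (f₀ g₀ : TensorAlgebra 𝕜 V →ₗ[𝕜] M) (B C : V →ₗ[𝕜] M →ₗ[𝕜] M)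
    (E : V →ₗ[𝕜] V →ₗ[𝕜] TensorAlgebra 𝕜 V →ₗ[𝕜] TensorAlgebra 𝕜 V →ₗ[𝕜] M) :
    List κ → List κ → M
  | [], Y => g₀ (word 𝕜 (Y.map x))
  | X, [] => f₀ (word 𝕜 (X.map x))
  -- In the second term `b` crosses all of `a :: X`; in the third it crosses only `X`, to land just
  -- after `a`.
  | a :: X, b :: Y => B (x a) (wordRec e x f₀ g₀ B C E X (b :: Y)) +
      sg 𝕜 (e b * (e a + (X.map e).sum)) • C (x b) (wordRec e x f₀ g₀ B C E (a :: X) Y) +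
      sg 𝕜 (e b * (X.map e).sum) • E (x a) (x b) (word 𝕜 (X.map x)) (word 𝕜 (Y.map x))
termination_by X Y => X.length + Y.length

/-- Bases of the homogeneous components are put together; the last clause records that a vector of
degree `i` only involves basis vectors of degree `i`. -/
theorem exists_homogeneous_basis (𝒱 : ℤ → Submodule 𝕜 V) [h : Internal 𝒱] :
    ∃ (κ : Type u) (e : κ → ℤ) (b : Module.Basis κ 𝕜 V), (∀ a, b a ∈ 𝒱 (e a)) ∧
      ∀ i, ∀ v ∈ 𝒱 i, v ∈ Submodule.span 𝕜 {w | ∃ a, e a = i ∧ b a = w} := by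
  let b (i : ℤ) := Module.Free.chooseBasis 𝕜 (𝒱 i)
  refine ⟨_, fun a => a.1, h.isInternal.collectedBasis b, fun a => by simp, fun i v hv => ?_⟩
  have := (b i).mem_span ⟨v, hv⟩
  have := Submodule.mem_map_of_mem (f := (𝒱 i).subtype) this
  rw [Submodule.map_span] at this
  refine Submodule.span_mono ?_ this
  rintro _ ⟨_, ⟨j, rfl⟩, rfl⟩
  exact ⟨⟨i, j⟩, rfl, by simp⟩

theorem basis_tensorAlgebra_apply {κ : Type*} (b : Module.Basis κ 𝕜 V) (l : List κ) :
    b.tensorAlgebra (FreeMonoid.ofList l) = word 𝕜 (l.map b) := by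
  rw [Module.Basis.tensorAlgebra, Module.Basis.map_apply]
  induction l with
  | nil => simp [word_nil, FreeAlgebra.basisFreeMonoid, ← MonoidAlgebra.one_def]
  | cons a l ih =>
    rw [List.map_cons, word_cons, ← ih]
    have h : (MonoidAlgebra.single (FreeMonoid.of a * FreeMonoid.ofList l) (1 : 𝕜)) =
        MonoidAlgebra.single (FreeMonoid.of a) 1 * MonoidAlgebra.single (FreeMonoid.ofList l) 1 := by
      simp [MonoidAlgebra.single_mul_single]
    have h' : FreeAlgebra.equivMonoidAlgebraFreeMonoid.symm
        (MonoidAlgebra.single (FreeMonoid.of a) (1 : 𝕜)) = FreeAlgebra.ι 𝕜 a := by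
      rw [AlgEquiv.symm_apply_eq]
      simp [FreeAlgebra.equivMonoidAlgebraFreeMonoid, MonoidAlgebra.of_apply]
    have e (w : FreeMonoid κ) : FreeAlgebra.basisFreeMonoid 𝕜 κ w =
        FreeAlgebra.equivMonoidAlgebraFreeMonoid.symm (MonoidAlgebra.single w 1) := by
      simp [FreeAlgebra.basisFreeMonoid]
    rw [FreeMonoid.ofList_cons, e, e, h, map_mul, h']
    exact (map_mul (TensorAlgebra.equivFreeAlgebra b).symm _ _).trans (by
      rw [TensorAlgebra.equivFreeAlgebra_symm_ι]; rfl)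

/-- The signs depend on degrees, so the recursion cannot be used as a definition on arbitrary
tensors. It is imposed on words in a homogeneous basis, whose letters have degrees, and extended
bilinearly. `h₀` reconciles the two initial conditions at `(1, 1)`. -/
theorem exists_bilinear_rec [Internal 𝒱] (f₀ g₀ : TensorAlgebra 𝕜 V →ₗ[𝕜] M)
    (h₀ : f₀ 1 = g₀ 1) (B C : V →ₗ[𝕜] M →ₗ[𝕜] M)
    (E : V →ₗ[𝕜] V →ₗ[𝕜] TensorAlgebra 𝕜 V →ₗ[𝕜] TensorAlgebra 𝕜 V →ₗ[𝕜] M) :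
    ∃ F : TensorAlgebra 𝕜 V →ₗ[𝕜] TensorAlgebra 𝕜 V →ₗ[𝕜] M,
      (∀ s, F s 1 = f₀ s) ∧ (∀ t, F 1 t = g₀ t) ∧
      ∀ i j m v w s t, v ∈ 𝒱 i → w ∈ 𝒱 j → s ∈ tensorGrading 𝒱 m →
        F (TensorAlgebra.ι 𝕜 v * s) (TensorAlgebra.ι 𝕜 w * t) =
          B v (F s (TensorAlgebra.ι 𝕜 w * t)) +
          sg 𝕜 (j * (i + m)) • C w (F (TensorAlgebra.ι 𝕜 v * s) t) +
          sg 𝕜 (j * m) • E v w s t := by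
  obtain ⟨κ, e, b, hb, hspan⟩ := exists_homogeneous_basis 𝒱
  let W := wordRec e b f₀ g₀ B C E
  let F : TensorAlgebra 𝕜 V →ₗ[𝕜] TensorAlgebra 𝕜 V →ₗ[𝕜] M :=
    b.tensorAlgebra.constr 𝕜 fun X => b.tensorAlgebra.constr 𝕜 fun Y => W X.toList Y.toList
  have hF (X Y : List κ) : F (word 𝕜 (X.map b)) (word 𝕜 (Y.map b)) = W X Y := by
    simp only [F, ← basis_tensorAlgebra_apply, Module.Basis.constr_basis, FreeMonoid.toList_ofList]
  have hW0 (Y : List κ) : W [] Y = g₀ (word 𝕜 (Y.map b)) := by simp only [W, wordRec]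
  have hW1 (X : List κ) : W X [] = f₀ (word 𝕜 (X.map b)) := by
    cases X with
    | nil => rw [hW0]; simp [word_nil, h₀]
    | cons a X => simp only [W, wordRec]
  have hT : Submodule.span 𝕜 (Set.range fun X : List κ => word 𝕜 (X.map b)) = ⊤ := by
    rw [← b.tensorAlgebra.span_eq]
    congr 1
    ext t
    constructor
    · rintro ⟨X, rfl⟩; exact ⟨_, basis_tensorAlgebra_apply b X⟩
    · rintro ⟨X, rfl⟩; exact ⟨X.toList, (basis_tensorAlgebra_apply b X.toList).symm⟩
  -- A homogeneous tensor is a combination of basis words of the same degree, so a single sign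
  -- serves for all of them.
  have hS (m : ℤ) (s : TensorAlgebra 𝕜 V) (hs : s ∈ tensorGrading 𝒱 m) :
      s ∈ Submodule.span 𝕜 {t | ∃ X : List κ, (X.map e).sum = m ∧ word 𝕜 (X.map b) = t} := by
    refine tensorGrading_induction (p := fun m s => s ∈ Submodule.span 𝕜
      {t | ∃ X : List κ, (X.map e).sum = m ∧ word 𝕜 (X.map b) = t}) (fun m => zero_mem _)
      (fun m s t => add_mem) (fun m c s => Submodule.smul_mem _ _)
      (Submodule.subset_span ⟨[], rfl, rfl⟩) (fun i v m s hv _ ih => ?_) hs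
    have hv := hspan i v hv
    refine Submodule.span_induction₂ (p := fun v s _ _ => TensorAlgebra.ι 𝕜 v * s ∈ _)
      ?_ ?_ ?_ ?_ ?_ ?_ ?_ hv ih
    · rintro _ _ ⟨a, rfl, rfl⟩ ⟨X, rfl, rfl⟩
      exact Submodule.subset_span ⟨a :: X, by simp, by simp [word_cons]⟩
    · simp
    · simp
    · intro x y z _ _ _ h₁ h₂; rw [map_add, add_mul]; exact add_mem h₁ h₂
    · intro x y z _ _ _ h₁ h₂; rw [mul_add]; exact add_mem h₁ h₂
    · intro c x y _ _ h; rw [map_smul, smul_mul_assoc]; exact Submodule.smul_mem _ _ h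
    · intro c x y _ _ h; rw [mul_smul_comm]; exact Submodule.smul_mem _ _ h
  refine ⟨F, fun s => ?_, fun t => ?_, fun i j m v w s t hv hw hs => ?_⟩
  · have : F.flip 1 = f₀ := b.tensorAlgebra.ext fun X => by
      have h := (hF X.toList []).trans (hW1 X.toList)
      rwa [← basis_tensorAlgebra_apply, FreeMonoid.ofList_toList] at h
    exact LinearMap.congr_fun this s
  · have : F 1 = g₀ := b.tensorAlgebra.ext fun X => by
      have h := (hF [] X.toList).trans (hW0 X.toList)
      rwa [← basis_tensorAlgebra_apply b X.toList, FreeMonoid.ofList_toList] at h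
    exact LinearMap.congr_fun this t
  · have ht : t ∈ Submodule.span 𝕜 (Set.range fun X : List κ => word 𝕜 (X.map b)) := hT ▸ trivial
    replace hs := hS m s hs
    replace hv := hspan i v hv
    replace hw := hspan j w hw
    -- Both sides are linear in `v`, `w`, `s` and `t`, which reduces the identity to basis letters
    -- and words.
    induction hv using Submodule.span_induction with
    | zero => simp
    | add x y _ _ hx hy => simp only [map_add, add_mul, LinearMap.add_apply, hx, hy, smul_add]; module
    | smul c x _ hx =>
      simp only [map_smul, smul_mul_assoc, LinearMap.smul_apply, hx]; module
    | mem v hv =>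
    induction hw using Submodule.span_induction with
    | zero => simp
    | add x y _ _ hx hy => simp only [map_add, add_mul, LinearMap.add_apply, hx, hy, smul_add]; module
    | smul c x _ hx =>
      simp only [map_smul, smul_mul_assoc, LinearMap.smul_apply, hx]; module
    | mem w hw =>
    induction hs using Submodule.span_induction with
    | zero => simp
    | add x y _ _ hx hy => simp only [map_add, mul_add, LinearMap.add_apply, hx, hy, smul_add]; module
    | smul c x _ hx =>
      simp only [map_smul, mul_smul_comm, LinearMap.smul_apply, hx]; module
    | mem s hs =>
    induction ht using Submodule.span_induction with
    | zero => simp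
    | add x y _ _ hx hy => simp only [map_add, mul_add, hx, hy, smul_add]; module
    | smul c x _ hx =>
      simp only [map_smul, mul_smul_comm, hx]; module
    | mem t ht =>
    obtain ⟨x, rfl, rfl⟩ := hv
    obtain ⟨y, rfl, rfl⟩ := hw
    obtain ⟨X, rfl, rfl⟩ := hs
    obtain ⟨Y, rfl⟩ := ht
    have h1 := hF (x :: X) (y :: Y)
    have h2 := hF X (y :: Y)
    have h3 := hF (x :: X) Y
    simp only [List.map_cons, word_cons] at h1 h2 h3
    rw [h1, h2, h3]
    simp only [W, wordRec]

end Bilinear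

end ABAlg

namespace ABAlg

/-! ### The signed shuffle product. -/

section Shuffle

universe u

variable {𝕜 : Type*} [Field 𝕜] {V : Type u} [AddCommGroup V] [Module 𝕜 V]
  {M : Type*} [AddCommGroup M] [Module 𝕜 M]

/-- Multiplication by a letter on the left. -/
noncomputable def cons : V →ₗ[𝕜] TensorAlgebra 𝕜 V →ₗ[𝕜] TensorAlgebra 𝕜 V :=
  LinearMap.mul 𝕜 (TensorAlgebra 𝕜 V) ∘ₗ TensorAlgebra.ι 𝕜

theorem cons_apply (v : V) (t : TensorAlgebra 𝕜 V) : cons v t = TensorAlgebra.ι 𝕜 v * t := rfl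

variable {𝒱 : ℤ → Submodule 𝕜 V}

theorem cons_mem {i m : ℤ} {v : V} {s : TensorAlgebra 𝕜 V} (hv : v ∈ 𝒱 i)
    (hs : s ∈ tensorGrading 𝒱 m) : cons v s ∈ tensorGrading 𝒱 (i + m) := ι_mul_mem hv hs

theorem word_cons' (x : V) (l : List V) : word 𝕜 (x :: l) = cons x (word 𝕜 l) :=
  word_cons x l

theorem tensorGrading_cons_induction {p : ℤ → TensorAlgebra 𝕜 V → Prop}
    (zero : ∀ m, p m 0) (add : ∀ m s t, p m s → p m t → p m (s + t))
    (smul : ∀ m (c : 𝕜) s, p m s → p m (c • s)) (one : p 0 1)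
    (mul : ∀ i v m s, v ∈ 𝒱 i → s ∈ tensorGrading 𝒱 m → p m s → p (i + m) (cons v s))
    {m : ℤ} {s : TensorAlgebra 𝕜 V} (hs : s ∈ tensorGrading 𝒱 m) : p m s :=
  tensorGrading_induction zero add smul one mul hs

variable (𝒱) [Internal 𝒱]

theorem exists_shuffle :
    ∃ F : TensorAlgebra 𝕜 V →ₗ[𝕜] TensorAlgebra 𝕜 V →ₗ[𝕜] TensorAlgebra 𝕜 V,
      (∀ s, F s 1 = s) ∧ (∀ t, F 1 t = t) ∧
      ∀ i j m v w s t, v ∈ 𝒱 i → w ∈ 𝒱 j → s ∈ tensorGrading 𝒱 m →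
        F (cons v s) (cons w t) = cons v (F s (cons w t)) +
          sg 𝕜 (j * (i + m)) • cons w (F (cons v s) t) := by
  obtain ⟨F, h₁, h₂, h₃⟩ := exists_bilinear_rec (𝒱 := 𝒱) LinearMap.id LinearMap.id rfl cons cons 0
  refine ⟨F, h₁, h₂, fun i j m v w s t hv hw hs => ?_⟩
  rw [cons_apply v s, cons_apply w t, h₃ i j m v w s t hv hw hs]
  simp

/-- The signed shuffle product. -/
noncomputable def sh : TensorAlgebra 𝕜 V →ₗ[𝕜] TensorAlgebra 𝕜 V →ₗ[𝕜] TensorAlgebra 𝕜 V :=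
  (exists_shuffle 𝒱).choose

@[simp] theorem sh_one (s : TensorAlgebra 𝕜 V) : sh 𝒱 s 1 = s := (exists_shuffle 𝒱).choose_spec.1 s

@[simp] theorem one_sh (t : TensorAlgebra 𝕜 V) : sh 𝒱 1 t = t :=
  (exists_shuffle 𝒱).choose_spec.2.1 t

variable {𝒱} {i j k m n p : ℤ} {u v w : V} {r s t : TensorAlgebra 𝕜 V}

theorem sh_cons (hv : v ∈ 𝒱 i) (hw : w ∈ 𝒱 j) (hs : s ∈ tensorGrading 𝒱 m) :
    sh 𝒱 (cons v s) (cons w t) = cons v (sh 𝒱 s (cons w t)) +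
      sg 𝕜 (j * (i + m)) • cons w (sh 𝒱 (cons v s) t) :=
  (exists_shuffle 𝒱).choose_spec.2.2 i j m v w s t hv hw hs

theorem sh_mem (hs : s ∈ tensorGrading 𝒱 m) (ht : t ∈ tensorGrading 𝒱 n) :
    sh 𝒱 s t ∈ tensorGrading 𝒱 (m + n) := by
  refine tensorGrading_cons_induction
    (p := fun m s => ∀ n t, t ∈ tensorGrading 𝒱 n → sh 𝒱 s t ∈ tensorGrading 𝒱 (m + n))
    ?_ ?_ ?_ ?_ ?_ hs n t ht
  · intros; simp
  · intro m s t h₁ h₂ n r hr; simpa using add_mem (h₁ n r hr) (h₂ n r hr)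
  · intro m c s h n r hr; simpa using Submodule.smul_mem _ c (h n r hr)
  · intro n t ht; simpa using ht
  · intro i v m s hv hs ihs n t ht
    refine tensorGrading_cons_induction
      (p := fun n t => sh 𝒱 (cons v s) t ∈ tensorGrading 𝒱 (i + m + n)) ?_ ?_ ?_ ?_ ?_ ht
    · intros; simp
    · intro m s t h₁ h₂; simpa using add_mem h₁ h₂
    · intro m c s h; simpa using Submodule.smul_mem _ c h
    · simpa using cons_mem hv hs
    · intro j w n t hw ht iht
      rw [sh_cons hv hw hs]
      refine add_mem ?_ (Submodule.smul_mem _ _ ?_)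
      · rw [add_assoc]; exact cons_mem hv (ihs _ _ (cons_mem hw ht))
      · rw [show i + m + (j + n) = j + (i + m + n) by ring]; exact cons_mem hw iht

/-- Exchanging the arguments exchanges the two terms of `sh_cons`, which are distinguished by the
word that supplies the first letter. -/
theorem sh_comm (hs : s ∈ tensorGrading 𝒱 m) (ht : t ∈ tensorGrading 𝒱 n) :
    sh 𝒱 s t = sg 𝕜 (m * n) • sh 𝒱 t s := by
  refine tensorGrading_cons_induction
    (p := fun m s => ∀ n t, t ∈ tensorGrading 𝒱 n → sh 𝒱 s t = sg 𝕜 (m * n) • sh 𝒱 t s)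
    ?_ ?_ ?_ ?_ ?_ hs n t ht
  · intros; simp
  · intro m s t h₁ h₂ n r hr
    simp only [map_add, LinearMap.add_apply, h₁ n r hr, h₂ n r hr, smul_add]
  · intro m c s h n r hr
    simp only [map_smul, LinearMap.smul_apply, h n r hr]; module
  · intro n t ht; simp [sg_zero]
  · intro i v m s hv hs ihs n t ht
    refine tensorGrading_cons_induction
      (p := fun n t => sh 𝒱 (cons v s) t = sg 𝕜 ((i + m) * n) • sh 𝒱 t (cons v s)) ?_ ?_ ?_ ?_ ?_ ht
    · intros; simp
    · intro m s t h₁ h₂; simp only [map_add, LinearMap.add_apply, h₁, h₂, smul_add]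
    · intro m c s h; simp only [map_smul, LinearMap.smul_apply, h]; module
    · simp [sg_zero]
    · intro j w n t hw ht iht
      rw [sh_cons hv hw hs, sh_cons hw hv ht, iht, ihs _ _ (cons_mem hw ht)]
      simp only [map_smul, smul_add, smul_smul]
      match_scalars <;> simp only [mul_one, ← sg_add] <;> refine sg_congr ?_ <;> clear * - <;> grind

theorem sh_assoc (hr : r ∈ tensorGrading 𝒱 m) (hs : s ∈ tensorGrading 𝒱 n)
    (ht : t ∈ tensorGrading 𝒱 p) : sh 𝒱 (sh 𝒱 r s) t = sh 𝒱 r (sh 𝒱 s t) := by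
  refine tensorGrading_cons_induction
    (p := fun m r => ∀ n s p t, s ∈ tensorGrading 𝒱 n → t ∈ tensorGrading 𝒱 p →
      sh 𝒱 (sh 𝒱 r s) t = sh 𝒱 r (sh 𝒱 s t)) ?_ ?_ ?_ ?_ ?_ hr n s p t hs ht
  · intros; simp
  · intro m r r' h₁ h₂ n s p t hs ht
    simp only [map_add, LinearMap.add_apply, h₁ n s p t hs ht, h₂ n s p t hs ht]
  · intro m c r h n s p t hs ht
    simp only [map_smul, LinearMap.smul_apply, h n s p t hs ht]
  · intros; simp
  intro i u m r hu hr ihr n s p t hs ht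
  refine tensorGrading_cons_induction
    (p := fun n s => ∀ p t, t ∈ tensorGrading 𝒱 p →
      sh 𝒱 (sh 𝒱 (cons u r) s) t = sh 𝒱 (cons u r) (sh 𝒱 s t)) ?_ ?_ ?_ ?_ ?_ hs p t ht
  · intros; simp
  · intro m s s' h₁ h₂ p t ht
    simp only [map_add, LinearMap.add_apply, h₁ p t ht, h₂ p t ht]
  · intro m c s h p t ht
    simp only [map_smul, LinearMap.smul_apply, h p t ht]
  · intros; simp
  intro j v n s hv hs ihs p t ht
  refine tensorGrading_cons_induction
    (p := fun p t => sh 𝒱 (sh 𝒱 (cons u r) (cons v s)) t = sh 𝒱 (cons u r) (sh 𝒱 (cons v s) t))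
    ?_ ?_ ?_ ?_ ?_ ht
  · intros; simp
  · intro p t t' h₁ h₂; simp only [map_add, h₁, h₂]
  · intro p c s h; simp only [map_smul, h]
  · simp
  intro k w p t hw ht iht
  have hvs := cons_mem hv hs
  have hur := cons_mem hu hr
  have hwt := cons_mem hw ht
  -- `e₁`, `e₂` and `iht` treat the shuffles that start with `u`, `v` and `w` respectively.
  have e₁ := ihr _ _ _ _ hvs hwt
  have e₂ := ihs _ _ hwt
  rw [sh_cons hv hw hs] at e₁ ⊢
  rw [sh_cons hu hv hr] at iht ⊢
  simp only [map_add, map_smul, LinearMap.add_apply, LinearMap.smul_apply]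
    at e₁ e₂ iht ⊢
  rw [sh_cons hu hw (sh_mem hr hvs), sh_cons hv hw (sh_mem hur hs), sh_cons hu hv hr,
    sh_cons hu hw hr, e₁, e₂]
  simp only [map_add, map_smul, smul_add, smul_smul, ← iht]
  match_scalars <;> simp only [mul_one, ← sg_add] <;> refine sg_congr ?_ <;> clear * - <;> grind

end Shuffle

end ABAlg

namespace ABAlg

/-! ### The bracket of words and its compatibility with the shuffle. -/

section Bracket

universe u

variable {𝕜 : Type*} [Field 𝕜] {V : Type u} [AddCommGroup V] [Module 𝕜 V]
  (𝒱 : ℤ → Submodule 𝕜 V) [Internal 𝒱] (c : ℤ) (ℓ : V →ₗ[𝕜] V →ₗ[𝕜] V)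

/-- Until the bracketed pair is met, `ℓ`, of degree `c`, crosses the letters that are passed, whence
`pw 𝒱 c`. Once the two heads are bracketed, the tails are merely shuffled. -/
theorem exists_shuffleBracket :
    ∃ F : TensorAlgebra 𝕜 V →ₗ[𝕜] TensorAlgebra 𝕜 V →ₗ[𝕜] TensorAlgebra 𝕜 V,
      (∀ s, F s 1 = 0) ∧ (∀ t, F 1 t = 0) ∧
      ∀ i j m v w s t, v ∈ 𝒱 i → w ∈ 𝒱 j → s ∈ tensorGrading 𝒱 m →
        F (cons v s) (cons w t) = sg 𝕜 (c * i) • cons v (F s (cons w t)) +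
          sg 𝕜 (j * (i + m) + c * j) • cons w (F (cons v s) t) +
          sg 𝕜 (j * m) • cons (ℓ v w) (sh 𝒱 s t) := by
  obtain ⟨F, h₁, h₂, h₃⟩ := exists_bilinear_rec (𝒱 := 𝒱) 0 0 rfl (cons ∘ₗ pw 𝒱 c) (cons ∘ₗ pw 𝒱 c)
    (LinearMap.mk₂ 𝕜 (fun v w => (sh 𝒱).compr₂ (cons (ℓ v w)))
      (fun _ _ _ => by ext; simp) (fun _ _ _ => by ext; simp)
      (fun _ _ _ => by ext; simp) (fun _ _ _ => by ext; simp))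
  refine ⟨F, h₁, h₂, fun i j m v w s t hv hw hs => ?_⟩
  rw [cons_apply v s, cons_apply w t, h₃ i j m v w s t hv hw hs, LinearMap.comp_apply,
    LinearMap.comp_apply, pw_apply c hv, pw_apply c hw, sg_add, mul_smul]
  simp

/-- The bracket of the shuffle algebra extending a bracket `ℓ` of letters, of degree `c`. -/
noncomputable def shBr :
    TensorAlgebra 𝕜 V →ₗ[𝕜] TensorAlgebra 𝕜 V →ₗ[𝕜] TensorAlgebra 𝕜 V :=
  (exists_shuffleBracket 𝒱 c ℓ).choose

@[simp] theorem shBr_one (s : TensorAlgebra 𝕜 V) : shBr 𝒱 c ℓ s 1 = 0 :=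
  (exists_shuffleBracket 𝒱 c ℓ).choose_spec.1 s

@[simp] theorem one_shBr (t : TensorAlgebra 𝕜 V) : shBr 𝒱 c ℓ 1 t = 0 :=
  (exists_shuffleBracket 𝒱 c ℓ).choose_spec.2.1 t

variable {𝒱} {i j k m n p : ℤ} {u v w : V} {r s t : TensorAlgebra 𝕜 V}

theorem shBr_cons (hv : v ∈ 𝒱 i) (hw : w ∈ 𝒱 j) (hs : s ∈ tensorGrading 𝒱 m) :
    shBr 𝒱 c ℓ (cons v s) (cons w t) = sg 𝕜 (c * i) • cons v (shBr 𝒱 c ℓ s (cons w t)) +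
      sg 𝕜 (j * (i + m) + c * j) • cons w (shBr 𝒱 c ℓ (cons v s) t) +
      sg 𝕜 (j * m) • cons (ℓ v w) (sh 𝒱 s t) :=
  (exists_shuffleBracket 𝒱 c ℓ).choose_spec.2.2 i j m v w s t hv hw hs

variable {c ℓ}

theorem shBr_mem (hℓ : ∀ i j, ∀ v ∈ 𝒱 i, ∀ w ∈ 𝒱 j, ℓ v w ∈ 𝒱 (i + j + c))
    (hs : s ∈ tensorGrading 𝒱 m) (ht : t ∈ tensorGrading 𝒱 n) :
    shBr 𝒱 c ℓ s t ∈ tensorGrading 𝒱 (m + n + c) := by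
  refine tensorGrading_cons_induction
    (p := fun m s => ∀ n t, t ∈ tensorGrading 𝒱 n → shBr 𝒱 c ℓ s t ∈ tensorGrading 𝒱 (m + n + c))
    ?_ ?_ ?_ ?_ ?_ hs n t ht
  · intros; simp
  · intro m s t h₁ h₂ n r hr; simpa using add_mem (h₁ n r hr) (h₂ n r hr)
  · intro m c s h n r hr; simpa using Submodule.smul_mem _ c (h n r hr)
  · intro n t ht; simp
  · intro i v m s hv hs ihs n t ht
    refine tensorGrading_cons_induction
      (p := fun n t => shBr 𝒱 c ℓ (cons v s) t ∈ tensorGrading 𝒱 (i + m + n + c))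
      ?_ ?_ ?_ ?_ ?_ ht
    · intros; simp
    · intro m s t h₁ h₂; simpa using add_mem h₁ h₂
    · intro m c s h; simpa using Submodule.smul_mem _ c h
    · simp
    · intro j w n t hw ht iht
      rw [shBr_cons c ℓ hv hw hs]
      refine add_mem (add_mem (Submodule.smul_mem _ _ ?_) (Submodule.smul_mem _ _ ?_))
        (Submodule.smul_mem _ _ ?_)
      · rw [show i + m + (j + n) + c = i + (m + (j + n) + c) by ring]
        exact cons_mem hv (ihs _ _ (cons_mem hw ht))
      · rw [show i + m + (j + n) + c = j + (i + m + n + c) by ring]; exact cons_mem hw iht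
      · rw [show i + m + (j + n) + c = i + j + c + (m + n) by ring]
        exact cons_mem (hℓ _ _ _ hv _ hw) (sh_mem hs ht)

/-- The terms that start with `v` and with `w` are exchanged; the term headed by `ℓ v w` is governed
by `hℓ` and `sh_comm`. -/
theorem shBr_symm
    (hℓ : ∀ i j, ∀ v ∈ 𝒱 i, ∀ w ∈ 𝒱 j, ℓ v w = sg 𝕜 (i * j + c + 1) • ℓ w v)
    (hs : s ∈ tensorGrading 𝒱 m) (ht : t ∈ tensorGrading 𝒱 n) :
    shBr 𝒱 c ℓ s t = sg 𝕜 (m * n + c + 1) • shBr 𝒱 c ℓ t s := by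
  refine tensorGrading_cons_induction
    (p := fun m s => ∀ n t, t ∈ tensorGrading 𝒱 n →
      shBr 𝒱 c ℓ s t = sg 𝕜 (m * n + c + 1) • shBr 𝒱 c ℓ t s)
    ?_ ?_ ?_ ?_ ?_ hs n t ht
  · intros; simp
  · intro m s t h₁ h₂ n r hr
    simp only [map_add, LinearMap.add_apply, h₁ n r hr, h₂ n r hr, smul_add]
  · intro m c s h n r hr
    simp only [map_smul, LinearMap.smul_apply, h n r hr]; module
  · intro n t ht; simp
  · intro i v m s hv hs ihs n t ht
    refine tensorGrading_cons_induction
      (p := fun n t => shBr 𝒱 c ℓ (cons v s) t =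
        sg 𝕜 ((i + m) * n + c + 1) • shBr 𝒱 c ℓ t (cons v s)) ?_ ?_ ?_ ?_ ?_ ht
    · intros; simp
    · intro m s t h₁ h₂; simp only [map_add, LinearMap.add_apply, h₁, h₂, smul_add]
    · intro m c s h; simp only [map_smul, LinearMap.smul_apply, h]; module
    · simp
    · intro j w n t hw ht iht
      rw [shBr_cons c ℓ hv hw hs, shBr_cons c ℓ hw hv ht, iht, ihs _ _ (cons_mem hw ht),
        hℓ i j v hv w hw, sh_comm hs ht]
      simp only [map_smul, LinearMap.smul_apply, smul_add, smul_smul]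
      match_scalars <;> simp only [mul_one, ← sg_add] <;> refine sg_congr ?_ <;>
        simp only [Int.even_sub, Int.even_add, Int.even_mul] <;> clear * - <;> grind

set_option maxHeartbeats 1000000 in
-- The letter that is joined to a letter of `t` comes either from `s` or from `r`, which gives the
-- two terms. The proof compares words by their first letter, which is `u`, `v`, `w`, `ℓ u w` or `ℓ
-- v w`.
theorem shBr_sh (hℓ : ∀ i j, ∀ v ∈ 𝒱 i, ∀ w ∈ 𝒱 j, ℓ v w ∈ 𝒱 (i + j + c))
    (hr : r ∈ tensorGrading 𝒱 m) (hs : s ∈ tensorGrading 𝒱 n)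
    (ht : t ∈ tensorGrading 𝒱 p) :
    shBr 𝒱 c ℓ (sh 𝒱 r s) t = sg 𝕜 (c * m) • sh 𝒱 r (shBr 𝒱 c ℓ s t) +
      sg 𝕜 (n * p) • sh 𝒱 (shBr 𝒱 c ℓ r t) s := by
  refine tensorGrading_cons_induction
    (p := fun m r => ∀ n s p t, s ∈ tensorGrading 𝒱 n → t ∈ tensorGrading 𝒱 p →
      shBr 𝒱 c ℓ (sh 𝒱 r s) t = sg 𝕜 (c * m) • sh 𝒱 r (shBr 𝒱 c ℓ s t) +
      sg 𝕜 (n * p) • sh 𝒱 (shBr 𝒱 c ℓ r t) s) ?_ ?_ ?_ ?_ ?_ hr n s p t hs ht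
  · intros; simp
  · intro m r r' h₁ h₂ n s p t hs ht
    simp only [map_add, LinearMap.add_apply, h₁ n s p t hs ht, h₂ n s p t hs ht]; module
  · intro m c r h n s p t hs ht
    simp only [map_smul, LinearMap.smul_apply, h n s p t hs ht]; module
  · intros; simp [sg_zero]
  intro i u m r hu hr ihr n s p t hs ht
  refine tensorGrading_cons_induction
    (p := fun n s => ∀ p t, t ∈ tensorGrading 𝒱 p →
      shBr 𝒱 c ℓ (sh 𝒱 (cons u r) s) t =
        sg 𝕜 (c * (i + m)) • sh 𝒱 (cons u r) (shBr 𝒱 c ℓ s t) +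
        sg 𝕜 (n * p) • sh 𝒱 (shBr 𝒱 c ℓ (cons u r) t) s) ?_ ?_ ?_ ?_ ?_ hs p t ht
  · intros; simp
  · intro m s s' h₁ h₂ p t ht
    simp only [map_add, LinearMap.add_apply, h₁ p t ht, h₂ p t ht]; module
  · intro m c s h p t ht
    simp only [map_smul, LinearMap.smul_apply, h p t ht]; module
  · intros; simp [sg_zero]
  intro j v n s hv hs ihs p t ht
  refine tensorGrading_cons_induction
    (p := fun p t => shBr 𝒱 c ℓ (sh 𝒱 (cons u r) (cons v s)) t =
        sg 𝕜 (c * (i + m)) • sh 𝒱 (cons u r) (shBr 𝒱 c ℓ (cons v s) t) +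
        sg 𝕜 ((j + n) * p) • sh 𝒱 (shBr 𝒱 c ℓ (cons u r) t) (cons v s))
    ?_ ?_ ?_ ?_ ?_ ht
  · intros; simp
  · intro p t t' h₁ h₂; simp only [map_add, h₁, h₂, LinearMap.add_apply]; module
  · intro p c s h; simp only [map_smul, h, LinearMap.smul_apply]; module
  · simp
  intro k w p t hw ht iht
  have hvs := cons_mem hv hs
  have hur := cons_mem hu hr
  have hwt := cons_mem hw ht
  have e₁ := ihr _ _ _ _ hvs hwt
  have e₂ := ihs _ _ hwt
  -- Behind `ℓ u w` the three remaining words appear in two different orders.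
  have e₃ : sh 𝒱 (sh 𝒱 r t) (cons v s) = sg 𝕜 (p * (j + n)) • sh 𝒱 (sh 𝒱 r (cons v s)) t := by
    rw [sh_assoc hr ht hvs, sh_assoc hr hvs ht, sh_comm ht hvs, map_smul]
  rw [shBr_cons c ℓ hv hw hs] at e₁ ⊢
  rw [shBr_cons c ℓ hu hw hr] at e₂ ⊢
  rw [sh_cons hu hv hr] at iht ⊢
  simp only [map_add, map_smul, LinearMap.add_apply, LinearMap.smul_apply, smul_add, smul_smul]
    at e₁ e₂ iht ⊢
  rw [shBr_cons c ℓ hu hw (sh_mem hr hvs), shBr_cons c ℓ hv hw (sh_mem hur hs),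
    sh_cons hu hv hr, sh_cons hu hw hr, sh_cons hu (hℓ _ _ _ hv _ hw) hr,
    sh_cons hu hv (shBr_mem hℓ hr hwt), sh_cons hw hv (shBr_mem hℓ hur ht),
    sh_cons (hℓ _ _ _ hu _ hw) hv (sh_mem hr ht), e₁, e₂,
    sh_assoc hur hs ht, e₃, eq_sub_of_add_eq iht]
  simp only [map_add, map_sub, map_smul, smul_add, smul_sub, smul_smul]
  match_scalars <;> simp only [mul_one, ← sg_add, neg_sg] <;>
    first | refine sg_congr ?_ | refine sg_add_eq_zero ?_
  all_goals clear * -; grind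

end Bracket

end ABAlg

namespace ABAlg

/-! ### The operator on words that extends `d` and `μ`. -/

section Differential

universe u

variable {𝕜 : Type*} [Field 𝕜] {V : Type u} [AddCommGroup V] [Module 𝕜 V]

/-- The map `v ↦ w ⊗ t ↦ μ(v, w) ⊗ t`. -/
noncomputable def headMul (μ : V →ₗ[𝕜] V →ₗ[𝕜] V) :
    V →ₗ[𝕜] TensorAlgebra 𝕜 V →ₗ[𝕜] TensorAlgebra 𝕜 V :=
  (tensorRec (M := V →ₗ[𝕜] TensorAlgebra 𝕜 V)
    (LinearMap.mk₂ 𝕜 (fun w t => (cons.flip t) ∘ₗ μ.flip w)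
      (fun _ _ _ => by ext; simp) (fun _ _ _ => by ext; simp)
      (fun _ _ _ => by ext; simp) (fun _ _ _ => by ext; simp)) 0 0).flip

@[simp] theorem headMul_one (μ : V →ₗ[𝕜] V →ₗ[𝕜] V) (v : V) : headMul μ v 1 = 0 := by
  simp [headMul, tensorRec_one]

@[simp] theorem headMul_cons (μ : V →ₗ[𝕜] V →ₗ[𝕜] V) (v w : V) (t : TensorAlgebra 𝕜 V) :
    headMul μ v (cons w t) = cons (μ v w) t := by
  simp [headMul, cons_apply w, tensorRec_ι_mul]

variable (𝒱 : ℤ → Submodule 𝕜 V) [Internal 𝒱] (d : V →ₗ[𝕜] V) (μ : V →ₗ[𝕜] V →ₗ[𝕜] V)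

/-- The coderivation of the tensor coalgebra extending `d` and `μ`. -/
noncomputable def tensorD : TensorAlgebra 𝕜 V →ₗ[𝕜] TensorAlgebra 𝕜 V :=
  tensorRec (cons ∘ₗ d + headMul μ) (cons ∘ₗ pw 𝒱 1) 0

@[simp] theorem tensorD_one : tensorD 𝒱 d μ 1 = 0 := by
  rw [tensorD, tensorRec_one]

variable {𝒱} {i j k m n p : ℤ} {u v w : V} {r s t : TensorAlgebra 𝕜 V}

theorem tensorD_cons (hv : v ∈ 𝒱 i) (t : TensorAlgebra 𝕜 V) :
    tensorD 𝒱 d μ (cons v t) =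
      cons (d v) t + headMul μ v t + sg 𝕜 i • cons v (tensorD 𝒱 d μ t) := by
  rw [cons_apply v, tensorD, tensorRec_ι_mul, LinearMap.comp_apply, pw_apply 1 hv]
  simp

variable {d μ}

omit [Internal 𝒱] in
theorem headMul_mem (hμ : ∀ i j, ∀ v ∈ 𝒱 i, ∀ w ∈ 𝒱 j, μ v w ∈ 𝒱 (i + j + 1))
    (hv : v ∈ 𝒱 i) (hs : s ∈ tensorGrading 𝒱 m) :
    headMul μ v s ∈ tensorGrading 𝒱 (i + m + 1) := by
  refine tensorGrading_cons_induction
    (p := fun m s => headMul μ v s ∈ tensorGrading 𝒱 (i + m + 1)) ?_ ?_ ?_ ?_ ?_ hs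
  · intros; simp
  · intro m s t h₁ h₂; simpa using add_mem h₁ h₂
  · intro m c s h; simpa using Submodule.smul_mem _ c h
  · simp
  · intro j w m s hw hs _
    rw [headMul_cons, show i + (j + m) + 1 = i + j + 1 + m by ring]
    exact cons_mem (hμ _ _ _ hv _ hw) hs

theorem tensorD_mem (hd : ∀ i, ∀ v ∈ 𝒱 i, d v ∈ 𝒱 (i + 1))
    (hμ : ∀ i j, ∀ v ∈ 𝒱 i, ∀ w ∈ 𝒱 j, μ v w ∈ 𝒱 (i + j + 1))
    (hs : s ∈ tensorGrading 𝒱 m) : tensorD 𝒱 d μ s ∈ tensorGrading 𝒱 (m + 1) := by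
  refine tensorGrading_cons_induction
    (p := fun m s => tensorD 𝒱 d μ s ∈ tensorGrading 𝒱 (m + 1)) ?_ ?_ ?_ ?_ ?_ hs
  · intros; simp
  · intro m s t h₁ h₂; simpa using add_mem h₁ h₂
  · intro m c s h; simpa using Submodule.smul_mem _ c h
  · simp
  · intro i v m s hv hs ih
    rw [tensorD_cons d μ hv]
    refine add_mem (add_mem ?_ (headMul_mem hμ hv hs)) (Submodule.smul_mem _ _ ?_)
    · rw [show i + m + 1 = i + 1 + m by ring]; exact cons_mem (hd _ _ hv) hs
    · rw [add_assoc]; exact cons_mem hv ih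

/-- On the left `v` is multiplied with the head of `s`, whereas `headMul μ v (sh 𝒱 s (cons w t))`
also multiplies it with `w` when `w` comes first. The subtracted term removes that product, and the
last term collects the words starting with `w`. -/
theorem sh_headMul_left (hμ : ∀ i j, ∀ v ∈ 𝒱 i, ∀ w ∈ 𝒱 j, μ v w ∈ 𝒱 (i + j + 1))
    (hv : v ∈ 𝒱 i) (hw : w ∈ 𝒱 j) (hs : s ∈ tensorGrading 𝒱 m) :
    sh 𝒱 (headMul μ v s) (cons w t) = headMul μ v (sh 𝒱 s (cons w t)) -
      sg 𝕜 (j * m) • cons (μ v w) (sh 𝒱 s t) +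
      sg 𝕜 (j * (i + m + 1)) • cons w (sh 𝒱 (headMul μ v s) t) := by
  refine tensorGrading_cons_induction
    (p := fun m s => sh 𝒱 (headMul μ v s) (cons w t) = headMul μ v (sh 𝒱 s (cons w t)) -
      sg 𝕜 (j * m) • cons (μ v w) (sh 𝒱 s t) +
      sg 𝕜 (j * (i + m + 1)) • cons w (sh 𝒱 (headMul μ v s) t)) ?_ ?_ ?_ ?_ ?_ hs
  · intros; simp
  · intro m s t h₁ h₂; simp only [map_add, LinearMap.add_apply, h₁, h₂]; module
  · intro m c s h; simp only [map_smul, LinearMap.smul_apply, h]; module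
  · simp [sg_zero]
  · intro k x m s hx hs _
    rw [headMul_cons, sh_cons (hμ _ _ _ hv _ hx) hw hs, sh_cons hx hw hs]
    simp only [map_add, map_smul, headMul_cons]
    rw [show i + (k + m) + 1 = i + k + 1 + m by ring]
    module

theorem sh_headMul_right (hμ : ∀ i j, ∀ v ∈ 𝒱 i, ∀ w ∈ 𝒱 j, μ v w ∈ 𝒱 (i + j + 1))
    (hv : v ∈ 𝒱 i) (hw : w ∈ 𝒱 j) (hs : s ∈ tensorGrading 𝒱 m) (ht : t ∈ tensorGrading 𝒱 n) :
    sh 𝒱 (cons v s) (headMul μ w t) = cons v (sh 𝒱 s (headMul μ w t)) +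
      sg 𝕜 ((j + 1) * (i + m)) • (headMul μ w (sh 𝒱 (cons v s) t) -
      cons (μ w v) (sh 𝒱 s t)) := by
  refine tensorGrading_cons_induction
    (p := fun _ t => sh 𝒱 (cons v s) (headMul μ w t) = cons v (sh 𝒱 s (headMul μ w t)) +
      sg 𝕜 ((j + 1) * (i + m)) • (headMul μ w (sh 𝒱 (cons v s) t) -
      cons (μ w v) (sh 𝒱 s t))) ?_ ?_ ?_ ?_ ?_ ht
  · intros; simp
  · intro m s t h₁ h₂; simp only [map_add, h₁, h₂]; module
  · intro m c s h; simp only [map_smul, h]; module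
  · simp
  · intro k x n t hx ht _
    rw [headMul_cons, sh_cons hv (hμ _ _ _ hw _ hx) hs, sh_cons hv hx hs]
    simp only [map_add, map_smul, headMul_cons, add_sub_cancel_left, smul_smul, ← sg_add]
    congr 2
    refine sg_congr ?_
    clear * -; grind

/-- Differentials of letters and products of letters of the same word occur on both sides. The left
side also has the products of a letter of `s` with an adjacent letter of `t`, in both orders; these
cancel because `μ` is graded antisymmetric (`hμc`). -/
theorem tensorD_sh (hd : ∀ i, ∀ v ∈ 𝒱 i, d v ∈ 𝒱 (i + 1))
    (hμ : ∀ i j, ∀ v ∈ 𝒱 i, ∀ w ∈ 𝒱 j, μ v w ∈ 𝒱 (i + j + 1))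
    (hμc : ∀ i j, ∀ v ∈ 𝒱 i, ∀ w ∈ 𝒱 j, μ v w = sg 𝕜 (i * j + 1) • μ w v)
    (hs : s ∈ tensorGrading 𝒱 m) (ht : t ∈ tensorGrading 𝒱 n) :
    tensorD 𝒱 d μ (sh 𝒱 s t) =
      sh 𝒱 (tensorD 𝒱 d μ s) t + sg 𝕜 m • sh 𝒱 s (tensorD 𝒱 d μ t) := by
  refine tensorGrading_cons_induction
    (p := fun m s => ∀ n t, t ∈ tensorGrading 𝒱 n → tensorD 𝒱 d μ (sh 𝒱 s t) =
      sh 𝒱 (tensorD 𝒱 d μ s) t + sg 𝕜 m • sh 𝒱 s (tensorD 𝒱 d μ t)) ?_ ?_ ?_ ?_ ?_ hs n t ht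
  · intros; simp
  · intro m s t h₁ h₂ n r hr
    simp only [map_add, LinearMap.add_apply, h₁ n r hr, h₂ n r hr]; module
  · intro m c s h n r hr
    simp only [map_smul, LinearMap.smul_apply, h n r hr]; module
  · intro n t ht; simp [sg_zero]
  intro i v m s hv hs ihs n t ht
  refine tensorGrading_cons_induction
    (p := fun n t => tensorD 𝒱 d μ (sh 𝒱 (cons v s) t) =
      sh 𝒱 (tensorD 𝒱 d μ (cons v s)) t + sg 𝕜 (i + m) • sh 𝒱 (cons v s) (tensorD 𝒱 d μ t))
      ?_ ?_ ?_ ?_ ?_ ht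
  · intros; simp
  · intro m s t h₁ h₂; simp only [map_add, h₁, h₂]; module
  · intro m c s h; simp only [map_smul, h]; module
  · simp
  intro j w n t hw ht iht
  have e₁ := ihs _ _ (cons_mem hw ht)
  rw [tensorD_cons d μ hw] at e₁
  rw [tensorD_cons d μ hv] at iht
  rw [sh_cons hv hw hs, map_add, map_smul, tensorD_cons d μ hv, tensorD_cons d μ hv,
    tensorD_cons d μ hw, tensorD_cons d μ hw, iht, e₁]
  simp only [map_add, map_smul, LinearMap.add_apply, LinearMap.smul_apply]
  rw [sh_cons (hd _ _ hv) hw hs, sh_cons hv (hd _ _ hw) hs,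
    sh_cons hv hw (tensorD_mem hd hμ hs), sh_cons hv hw hs,
    sh_headMul_left hμ hv hw hs, sh_headMul_right hμ hv hw hs ht, hμc _ _ w hw v hv]
  simp only [map_smul, LinearMap.smul_apply]
  match_scalars <;> simp only [mul_one, ← sg_add, neg_sg, mul_add] <;>
    first | refine sg_congr ?_ | refine (sg_add_eq_zero ?_).symm
  all_goals clear * -; grind

end Differential

end ABAlg

namespace ABAlg

/-! ### Deconcatenation and its compatibility with the operations on words. -/

section Cut

universe u

variable {𝕜 : Type*} [Field 𝕜] {V : Type u} [AddCommGroup V] [Module 𝕜 V]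

/-- The deconcatenation coproduct of the tensor algebra. -/
noncomputable def cut : TensorAlgebra 𝕜 V →ₗ[𝕜] TensorAlgebra 𝕜 V ⊗[𝕜] TensorAlgebra 𝕜 V :=
  tensorRec (LinearMap.mk₂ 𝕜 (fun v t => 1 ⊗ₜ cons v t)
      (fun _ _ _ => by simp [TensorProduct.tmul_add]) (fun _ _ _ => by simp)
      (fun _ _ _ => by simp [TensorProduct.tmul_add]) (fun _ _ _ => by simp))
    (LinearMap.rTensorHom _ ∘ₗ cons) (1 ⊗ₜ 1)

@[simp] theorem cut_one : cut (1 : TensorAlgebra 𝕜 V) = 1 ⊗ₜ[𝕜] 1 := by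
  rw [cut, tensorRec_one]

theorem cut_cons (v : V) (t : TensorAlgebra 𝕜 V) :
    cut (cons v t) = 1 ⊗ₜ[𝕜] cons v t + (cons v).rTensor _ (cut t) := by
  rw [cut, cons_apply v, tensorRec_ι_mul]; rfl

variable (𝒱 : ℤ → Submodule 𝕜 V) [Internal 𝒱]

/-- The components of `cross`. -/
noncomputable def crossAux
    (f g : TensorAlgebra 𝕜 V →ₗ[𝕜] TensorAlgebra 𝕜 V →ₗ[𝕜] TensorAlgebra 𝕜 V) (γ : ℤ) :
    TensorAlgebra 𝕜 V →ₗ[𝕜] TensorAlgebra 𝕜 V →ₗ[𝕜]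
      TensorAlgebra 𝕜 V ⊗[𝕜] TensorAlgebra 𝕜 V →ₗ[𝕜] TensorAlgebra 𝕜 V ⊗[𝕜] TensorAlgebra 𝕜 V :=
  gradedLift (tensorGrading 𝒱) fun n => sg 𝕜 (γ * n) •
    LinearMap.mk₂ 𝕜 (fun t₁ t₂ => TensorProduct.map (f.flip t₁ ∘ₗ pw (tensorGrading 𝒱) γ)
        (g.flip t₂ ∘ₗ pw (tensorGrading 𝒱) n))
      (fun _ _ _ => by simp [LinearMap.add_comp, TensorProduct.map_add_left])
      (fun _ _ _ => by simp [LinearMap.smul_comp, TensorProduct.map_smul_left])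
      (fun _ _ _ => by simp [LinearMap.add_comp, TensorProduct.map_add_right])
      (fun _ _ _ => by simp [LinearMap.smul_comp, TensorProduct.map_smul_right])

/-- The bilinear operation `(t₁ ⊗ t₂, s₁ ⊗ s₂) ↦ ± f(s₁, t₁) ⊗ g(s₂, t₂)`, for `g` of
degree `γ`. -/
noncomputable def cross (f g : TensorAlgebra 𝕜 V →ₗ[𝕜] TensorAlgebra 𝕜 V →ₗ[𝕜] TensorAlgebra 𝕜 V)
    (γ : ℤ) : TensorAlgebra 𝕜 V ⊗[𝕜] TensorAlgebra 𝕜 V →ₗ[𝕜]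
      TensorAlgebra 𝕜 V ⊗[𝕜] TensorAlgebra 𝕜 V →ₗ[𝕜] TensorAlgebra 𝕜 V ⊗[𝕜] TensorAlgebra 𝕜 V :=
  TensorProduct.lift (crossAux 𝒱 f g γ)

variable {𝒱} {i j k l m n p c : ℤ} {u v w : V} {r s t s' t' : TensorAlgebra 𝕜 V}

/-- The Koszul sign: `s'` crosses `t`, and `g`, of degree `γ`, crosses `s` and `t`. -/
theorem cross_tmul
    (f g : TensorAlgebra 𝕜 V →ₗ[𝕜] TensorAlgebra 𝕜 V →ₗ[𝕜] TensorAlgebra 𝕜 V) (γ : ℤ)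
    (hs : s ∈ tensorGrading 𝒱 m) (hs' : s' ∈ tensorGrading 𝒱 k) (ht : t ∈ tensorGrading 𝒱 n)
    (t' : TensorAlgebra 𝕜 V) :
    cross 𝒱 f g γ (t ⊗ₜ t') (s ⊗ₜ s') = sg 𝕜 (k * n + γ * (m + n)) • (f s t ⊗ₜ g s' t') := by
  rw [cross, TensorProduct.lift.tmul, crossAux, gradedLift_apply _ ht]
  simp only [LinearMap.smul_apply, LinearMap.mk₂_apply, TensorProduct.map_tmul,
    LinearMap.comp_apply, LinearMap.flip_apply, pw_apply _ hs, pw_apply _ hs', map_smul,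
    TensorProduct.smul_tmul_smul, smul_smul, ← sg_add]
  congr 1
  exact sg_congr (by clear * -; grind)

/-- Cutting preserves the total degree; stated with sign operators, this applies without writing out
the cuts. -/
theorem pw_cut (hs : s ∈ tensorGrading 𝒱 m) (j : ℤ) :
    TensorProduct.map (pw (tensorGrading 𝒱) j) (pw (tensorGrading 𝒱) j) (cut s) =
      sg 𝕜 (j * m) • cut s := by
  refine tensorGrading_cons_induction (p := fun m s =>
    TensorProduct.map (pw (tensorGrading 𝒱) j) (pw (tensorGrading 𝒱) j) (cut s) =
      sg 𝕜 (j * m) • cut s) ?_ ?_ ?_ ?_ ?_ hs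
  · intros; simp
  · intro m s t h₁ h₂; simp only [map_add, h₁, h₂]; module
  · intro m c s h; simp only [map_smul, h]; module
  · rw [cut_one, TensorProduct.map_tmul, pw_apply _ one_mem_tensorGrading]; simp [sg_zero]
  · intro i v m s hv hs ih
    have h (σ : TensorAlgebra 𝕜 V ⊗[𝕜] TensorAlgebra 𝕜 V) :
        TensorProduct.map (pw (tensorGrading 𝒱) j) (pw (tensorGrading 𝒱) j)
          ((cons v).rTensor _ σ) = sg 𝕜 (j * i) • (cons v).rTensor _
          (TensorProduct.map (pw (tensorGrading 𝒱) j) (pw (tensorGrading 𝒱) j) σ) := by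
      induction σ using tensor_induction (tensorGrading 𝒱) (tensorGrading 𝒱) with
      | zero => simp
      | add x y hx hy => simp only [map_add, hx, hy, smul_add]
      | tmul k x hx l y hy =>
        simp only [LinearMap.rTensor_tmul, TensorProduct.map_tmul, pw_apply _ hx, pw_apply _ hy,
          pw_apply _ (cons_mem hv hx), map_smul, TensorProduct.smul_tmul_smul, smul_smul, ← sg_add]
        congr 1
        exact sg_congr (by clear * -; grind)
    rw [cut_cons, map_add, h, ih, TensorProduct.map_tmul, pw_apply _ one_mem_tensorGrading,
      pw_apply _ (cons_mem hv hs)]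
    simp only [map_smul, smul_add, smul_smul, ← sg_add, TensorProduct.tmul_smul, mul_zero, sg_zero,
      one_smul, mul_add]

section

variable (g : TensorAlgebra 𝕜 V →ₗ[𝕜] TensorAlgebra 𝕜 V →ₗ[𝕜] TensorAlgebra 𝕜 V) (γ : ℤ)
  (σ τ : TensorAlgebra 𝕜 V ⊗[𝕜] TensorAlgebra 𝕜 V)

/-- This is `sh_cons` in the left factor; the operators `pw` supply the sign for moving `w` across
both parts of the first word. -/
theorem cross_sh_cons_cons (hv : v ∈ 𝒱 i) (hw : w ∈ 𝒱 j) :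
    cross 𝒱 (sh 𝒱) g γ ((cons w).rTensor _ τ) ((cons v).rTensor _ σ) =
      sg 𝕜 (γ * i) • (cons v).rTensor _ (cross 𝒱 (sh 𝒱) g γ ((cons w).rTensor _ τ) σ) +
      sg 𝕜 (j * i + γ * j) • (cons w).rTensor _ (cross 𝒱 (sh 𝒱) g γ τ ((cons v).rTensor _
        (TensorProduct.map (pw (tensorGrading 𝒱) j) (pw (tensorGrading 𝒱) j) σ))) := by
  induction σ using tensor_induction (tensorGrading 𝒱) (tensorGrading 𝒱) with
  | zero => simp
  | add x y hx hy => simp only [map_add, hx, hy]; module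
  | tmul m s hs m' s' hs' =>
  induction τ using tensor_induction (tensorGrading 𝒱) (tensorGrading 𝒱) with
  | zero => simp
  | add x y hx hy => simp only [map_add, LinearMap.add_apply, hx, hy]; module
  | tmul n t ht n' t' ht' =>
    simp only [LinearMap.rTensor_tmul, TensorProduct.map_tmul, pw_apply _ hs, pw_apply _ hs',
      map_smul, TensorProduct.smul_tmul_smul, smul_smul]
    rw [cross_tmul _ _ _ (cons_mem hv hs) hs' (cons_mem hw ht),
      cross_tmul _ _ _ (cons_mem hv hs) hs' ht, cross_tmul _ _ _ hs hs' (cons_mem hw ht),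
      sh_cons hv hw hs]
    simp only [TensorProduct.add_tmul, ← TensorProduct.smul_tmul', map_add, map_smul, LinearMap.rTensor_tmul]
    match_scalars <;> simp only [mul_one, ← sg_add] <;> refine sg_congr ?_ <;> clear * - <;> grind

theorem cross_sh_one_cons (hv : v ∈ 𝒱 i) :
    cross 𝒱 (sh 𝒱) g γ (1 ⊗ₜ t) ((cons v).rTensor _ σ) =
      sg 𝕜 (γ * i) • (cons v).rTensor _ (cross 𝒱 (sh 𝒱) g γ (1 ⊗ₜ t) σ) := by
  induction σ using tensor_induction (tensorGrading 𝒱) (tensorGrading 𝒱) with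
  | zero => simp
  | add x y hx hy => simp only [map_add, hx, hy]; module
  | tmul m s hs m' s' hs' =>
    rw [LinearMap.rTensor_tmul, cross_tmul _ _ _ (cons_mem hv hs) hs' one_mem_tensorGrading,
      cross_tmul _ _ _ hs hs' one_mem_tensorGrading, sh_one, sh_one]
    simp only [map_smul, LinearMap.rTensor_tmul, smul_smul, ← sg_add]
    congr 1
    exact sg_congr (by clear * -; grind)

theorem cross_sh_cons_one (hw : w ∈ 𝒱 j) (hs : s ∈ tensorGrading 𝒱 m) :
    cross 𝒱 (sh 𝒱) g γ ((cons w).rTensor _ τ) (1 ⊗ₜ s) =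
      sg 𝕜 (j * m + γ * j) • (cons w).rTensor _ (cross 𝒱 (sh 𝒱) g γ τ (1 ⊗ₜ s)) := by
  induction τ using tensor_induction (tensorGrading 𝒱) (tensorGrading 𝒱) with
  | zero => simp
  | add x y hx hy => simp only [map_add, LinearMap.add_apply, hx, hy]; module
  | tmul n t ht n' t' ht' =>
    rw [LinearMap.rTensor_tmul, cross_tmul _ _ _ one_mem_tensorGrading hs (cons_mem hw ht),
      cross_tmul _ _ _ one_mem_tensorGrading hs ht, one_sh, one_sh]
    simp only [map_smul, LinearMap.rTensor_tmul, smul_smul, ← sg_add]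
    congr 1
    exact sg_congr (by clear * -; grind)

/-- The left part is empty, or begins with `v`, or begins with `w`. The operation `g` in the right
factor is left general, to serve for both the shuffle and the bracket. -/
theorem cross_sh_cut (hv : v ∈ 𝒱 i) (hw : w ∈ 𝒱 j) (hs : s ∈ tensorGrading 𝒱 m) :
    cross 𝒱 (sh 𝒱) g γ (cut (cons w t)) (cut (cons v s)) = 1 ⊗ₜ g (cons v s) (cons w t) +
      sg 𝕜 (γ * i) • (cons v).rTensor _ (cross 𝒱 (sh 𝒱) g γ (cut (cons w t)) (cut s)) +
      sg 𝕜 (j * (i + m) + γ * j) •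
        (cons w).rTensor _ (cross 𝒱 (sh 𝒱) g γ (cut t) (cut (cons v s))) := by
  rw [cut_cons w, cut_cons v]
  simp only [map_add, LinearMap.add_apply]
  rw [cross_sh_cons_cons _ _ _ _ hv hw, cross_sh_one_cons _ _ _ hv, pw_cut hs,
    cross_sh_cons_one _ _ _ hw (cons_mem hv hs),
    cross_tmul _ _ _ one_mem_tensorGrading (cons_mem hv hs) one_mem_tensorGrading]
  simp only [map_smul, one_sh]
  match_scalars <;> simp only [mul_one, ← sg_add]
  · rw [← sg_zero]; exact sg_congr (by simp)
  all_goals exact sg_congr (by clear * -; grind)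

variable (ℓ : V →ₗ[𝕜] V →ₗ[𝕜] V)

theorem cross_shBr_cons_cons (hv : v ∈ 𝒱 i) (hw : w ∈ 𝒱 j) :
    cross 𝒱 (shBr 𝒱 c ℓ) g 0 ((cons w).rTensor _ τ) ((cons v).rTensor _ σ) =
      sg 𝕜 (c * i) • (cons v).rTensor _ (cross 𝒱 (shBr 𝒱 c ℓ) g 0 ((cons w).rTensor _ τ) σ) +
      sg 𝕜 (j * i + c * j) • (cons w).rTensor _ (cross 𝒱 (shBr 𝒱 c ℓ) g 0 τ ((cons v).rTensor _
        (TensorProduct.map (pw (tensorGrading 𝒱) j) (pw (tensorGrading 𝒱) j) σ))) +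
      (cons (ℓ v w)).rTensor _ (cross 𝒱 (sh 𝒱) g 0 τ
        (TensorProduct.map (pw (tensorGrading 𝒱) j) (pw (tensorGrading 𝒱) j) σ)) := by
  induction σ using tensor_induction (tensorGrading 𝒱) (tensorGrading 𝒱) with
  | zero => simp
  | add x y hx hy => simp only [map_add, hx, hy]; module
  | tmul m s hs m' s' hs' =>
  induction τ using tensor_induction (tensorGrading 𝒱) (tensorGrading 𝒱) with
  | zero => simp
  | add x y hx hy => simp only [map_add, LinearMap.add_apply, hx, hy]; module
  | tmul n t ht n' t' ht' =>
    simp only [LinearMap.rTensor_tmul, TensorProduct.map_tmul, pw_apply _ hs, pw_apply _ hs',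
      map_smul, TensorProduct.smul_tmul_smul, smul_smul]
    rw [cross_tmul _ _ _ (cons_mem hv hs) hs' (cons_mem hw ht), cross_tmul _ _ _ hs hs' ht,
      cross_tmul _ _ _ (cons_mem hv hs) hs' ht, cross_tmul _ _ _ hs hs' (cons_mem hw ht),
      shBr_cons c ℓ hv hw hs]
    simp only [TensorProduct.add_tmul, ← TensorProduct.smul_tmul', map_add, map_smul, LinearMap.rTensor_tmul]
    match_scalars <;> simp only [mul_one, ← sg_add] <;> refine sg_congr ?_ <;> clear * - <;> grind

theorem cross_shBr_one_left :
    cross 𝒱 (shBr 𝒱 c ℓ) g γ (1 ⊗ₜ t) σ = 0 := by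
  induction σ using tensor_induction (tensorGrading 𝒱) (tensorGrading 𝒱) with
  | zero => simp
  | add x y hx hy => simp only [map_add, hx, hy, add_zero]
  | tmul m s hs m' s' hs' => simp [cross_tmul _ _ _ hs hs' one_mem_tensorGrading]

theorem cross_shBr_one_right (hs : s ∈ tensorGrading 𝒱 m) :
    cross 𝒱 (shBr 𝒱 c ℓ) g γ τ (1 ⊗ₜ s) = 0 := by
  induction τ using tensor_induction (tensorGrading 𝒱) (tensorGrading 𝒱) with
  | zero => simp
  | add x y hx hy => simp only [map_add, LinearMap.add_apply, hx, hy, add_zero]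
  | tmul n t ht n' t' ht' => simp [cross_tmul _ _ _ one_mem_tensorGrading hs ht]

/-- A bracket is zero when one of its words is empty, so there is no term with empty left part;
instead the left part may begin with `ℓ v w`, and then only shuffles remain. -/
theorem cross_shBr_cut (hv : v ∈ 𝒱 i) (hw : w ∈ 𝒱 j) (hs : s ∈ tensorGrading 𝒱 m) :
    cross 𝒱 (shBr 𝒱 c ℓ) g 0 (cut (cons w t)) (cut (cons v s)) =
      sg 𝕜 (c * i) • (cons v).rTensor _ (cross 𝒱 (shBr 𝒱 c ℓ) g 0 (cut (cons w t)) (cut s)) +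
      sg 𝕜 (j * (i + m) + c * j) •
        (cons w).rTensor _ (cross 𝒱 (shBr 𝒱 c ℓ) g 0 (cut t) (cut (cons v s))) +
      sg 𝕜 (j * m) • (cons (ℓ v w)).rTensor _ (cross 𝒱 (sh 𝒱) g 0 (cut t) (cut s)) := by
  rw [cut_cons w, cut_cons v]
  simp only [map_add, LinearMap.add_apply]
  rw [cross_shBr_cons_cons _ _ _ _ hv hw, cross_shBr_one_left,
    cross_shBr_one_right _ _ _ _ (cons_mem hv hs), cross_shBr_one_left, cross_shBr_one_left,
    cross_shBr_one_right _ _ _ _ (cons_mem hv hs), pw_cut hs]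
  simp only [map_smul, map_zero]
  match_scalars <;> simp only [mul_one, ← sg_add] <;> refine sg_congr ?_ <;> clear * - <;> grind

end

/-- A prefix of a shuffle is a shuffle of a prefix of `s` with a prefix of `t`, and likewise for the
suffixes. -/
theorem cut_sh (hs : s ∈ tensorGrading 𝒱 m) (ht : t ∈ tensorGrading 𝒱 n) :
    cut (sh 𝒱 s t) = cross 𝒱 (sh 𝒱) (sh 𝒱) 0 (cut t) (cut s) := by
  refine tensorGrading_cons_induction
    (p := fun m s => ∀ n t, t ∈ tensorGrading 𝒱 n →
      cut (sh 𝒱 s t) = cross 𝒱 (sh 𝒱) (sh 𝒱) 0 (cut t) (cut s)) ?_ ?_ ?_ ?_ ?_ hs n t ht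
  · intros; simp
  · intro m s t h₁ h₂ n r hr
    simp only [map_add, LinearMap.add_apply, h₁ n r hr, h₂ n r hr]
  · intro m c s h n r hr
    simp only [map_smul, LinearMap.smul_apply, h n r hr]
  · intro n t _
    rw [one_sh, cut_one]
    generalize cut t = τ
    induction τ using tensor_induction (tensorGrading 𝒱) (tensorGrading 𝒱) with
    | zero => simp
    | add x y hx hy => simp only [map_add, LinearMap.add_apply, ← hx, ← hy]
    | tmul n t ht n' t' ht' =>
      simp [cross_tmul _ _ _ one_mem_tensorGrading one_mem_tensorGrading ht, sg_zero]
  intro i v m s hv hs ihs n t ht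
  refine tensorGrading_cons_induction
    (p := fun n t => cut (sh 𝒱 (cons v s) t) =
      cross 𝒱 (sh 𝒱) (sh 𝒱) 0 (cut t) (cut (cons v s))) ?_ ?_ ?_ ?_ ?_ ht
  · intros; simp
  · intro m s t h₁ h₂; simp only [map_add, LinearMap.add_apply, h₁, h₂]
  · intro m c s h; simp only [map_smul, LinearMap.smul_apply, h]
  · rw [sh_one, cut_one]
    generalize cut (cons v s) = σ
    induction σ using tensor_induction (tensorGrading 𝒱) (tensorGrading 𝒱) with
    | zero => simp
    | add x y hx hy => simp only [map_add, ← hx, ← hy]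
    | tmul n t ht n' t' ht' => simp [cross_tmul _ _ _ ht ht' one_mem_tensorGrading, sg_zero]
  intro j w n t hw ht iht
  rw [cross_sh_cut _ _ hv hw hs, ← iht, ← ihs _ _ (cons_mem hw ht), sh_cons hv hw hs]
  simp only [map_add, map_smul, cut_cons, TensorProduct.tmul_add, TensorProduct.tmul_smul, zero_mul,
    add_zero, sg_zero]
  module

/-- The letter created by `ℓ` is never cut: it lies in the prefix or in the suffix, and the other
part is a plain shuffle. -/
theorem cut_shBr {ℓ : V →ₗ[𝕜] V →ₗ[𝕜] V} (hs : s ∈ tensorGrading 𝒱 m)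
    (ht : t ∈ tensorGrading 𝒱 n) :
    cut (shBr 𝒱 c ℓ s t) = cross 𝒱 (shBr 𝒱 c ℓ) (sh 𝒱) 0 (cut t) (cut s) +
      cross 𝒱 (sh 𝒱) (shBr 𝒱 c ℓ) c (cut t) (cut s) := by
  refine tensorGrading_cons_induction
    (p := fun m s => ∀ n t, t ∈ tensorGrading 𝒱 n →
      cut (shBr 𝒱 c ℓ s t) = cross 𝒱 (shBr 𝒱 c ℓ) (sh 𝒱) 0 (cut t) (cut s) +
      cross 𝒱 (sh 𝒱) (shBr 𝒱 c ℓ) c (cut t) (cut s)) ?_ ?_ ?_ ?_ ?_ hs n t ht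
  · intros; simp
  · intro m s t h₁ h₂ n r hr
    simp only [map_add, LinearMap.add_apply, h₁ n r hr, h₂ n r hr]; abel
  · intro m c s h n r hr
    simp only [map_smul, LinearMap.smul_apply, h n r hr]; module
  · intro n t _
    rw [one_shBr, cut_one]
    generalize cut t = τ
    induction τ using tensor_induction (tensorGrading 𝒱) (tensorGrading 𝒱) with
    | zero => simp
    | add x y hx hy =>
      rw [map_zero] at hx hy
      rw [map_zero, map_add, map_add, LinearMap.add_apply, LinearMap.add_apply, add_add_add_comm,
        ← hx, ← hy, add_zero]
    | tmul n t ht n' t' ht' =>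
      simp [cross_tmul _ _ _ one_mem_tensorGrading one_mem_tensorGrading ht]
  intro i v m s hv hs ihs n t ht
  refine tensorGrading_cons_induction
    (p := fun n t => cut (shBr 𝒱 c ℓ (cons v s) t) =
      cross 𝒱 (shBr 𝒱 c ℓ) (sh 𝒱) 0 (cut t) (cut (cons v s)) +
      cross 𝒱 (sh 𝒱) (shBr 𝒱 c ℓ) c (cut t) (cut (cons v s))) ?_ ?_ ?_ ?_ ?_ ht
  · intros; simp
  · intro m s t h₁ h₂; simp only [map_add, LinearMap.add_apply, h₁, h₂]; abel
  · intro m c s h; simp only [map_smul, LinearMap.smul_apply, h]; module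
  · rw [shBr_one, cut_one]
    generalize cut (cons v s) = σ
    induction σ using tensor_induction (tensorGrading 𝒱) (tensorGrading 𝒱) with
    | zero => simp
    | add x y hx hy =>
      rw [map_zero] at hx hy
      rw [map_zero, map_add, map_add, add_add_add_comm, ← hx, ← hy, add_zero]
    | tmul n t ht n' t' ht' => simp [cross_tmul _ _ _ ht ht' one_mem_tensorGrading]
  intro j w n t hw ht iht
  have e₁ := ihs _ _ (cons_mem hw ht)
  rw [cross_sh_cut _ _ hv hw hs, cross_shBr_cut _ _ hv hw hs, ← cut_sh hs ht]
  rw [shBr_cons c ℓ hv hw hs]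
  simp only [map_add, map_smul, TensorProduct.tmul_add, TensorProduct.tmul_smul]
  rw [cut_cons v (shBr _ _ _ _ _), cut_cons w (shBr _ _ _ _ _), cut_cons (ℓ v w), iht, e₁]
  simp only [map_add, smul_add]
  abel

/-- Once `v` is multiplied into the next letter no cut separates them, which is reflected by
`headMul μ v 1 = 0`. -/
theorem cut_headMul (μ : V →ₗ[𝕜] V →ₗ[𝕜] V) (v : V) (t : TensorAlgebra 𝕜 V) :
    cut (headMul μ v t) = 1 ⊗ₜ headMul μ v t + (headMul μ v).rTensor _ (cut t) := by
  induction t using tensorAlgebra_induction_left with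
  | one => simp
  | add s t hs ht => simp only [map_add, TensorProduct.tmul_add, hs, ht]; abel
  | smul c s hs => simp only [map_smul, TensorProduct.tmul_smul, hs, smul_add]
  | mul w s _ =>
    rw [← cons_apply, headMul_cons, cut_cons, cut_cons, map_add, LinearMap.rTensor_tmul,
      headMul_one, TensorProduct.zero_tmul, zero_add, ← LinearMap.rTensor_comp_apply]
    congr 3
    ext; simp

/-- A letter made by `d` or `μ` lies on one side of the cut; when it lies in the suffix, the
operator has crossed the prefix, whence the sign operator. -/
theorem cut_tensorD (d : V →ₗ[𝕜] V) (μ : V →ₗ[𝕜] V →ₗ[𝕜] V) (hs : s ∈ tensorGrading 𝒱 m) :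
    cut (tensorD 𝒱 d μ s) = (tensorD 𝒱 d μ).rTensor _ (cut s) +
      TensorProduct.map (pw (tensorGrading 𝒱) 1) (tensorD 𝒱 d μ) (cut s) := by
  refine tensorGrading_cons_induction
    (p := fun m s => cut (tensorD 𝒱 d μ s) = (tensorD 𝒱 d μ).rTensor _ (cut s) +
      TensorProduct.map (pw (tensorGrading 𝒱) 1) (tensorD 𝒱 d μ) (cut s)) ?_ ?_ ?_ ?_ ?_ hs
  · intros; simp
  · intro m s t h₁ h₂; simp only [map_add, h₁, h₂]; abel
  · intro m c s h; simp only [map_smul, h, smul_add]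
  · simp
  · intro i v m s hv hs ih
    have h₁ : tensorD 𝒱 d μ ∘ₗ cons v =
        cons (d v) + headMul μ v + sg 𝕜 i • (cons v ∘ₗ tensorD 𝒱 d μ) :=
      LinearMap.ext fun t => tensorD_cons d μ hv t
    have h₂ : pw (tensorGrading 𝒱) 1 ∘ₗ cons v = sg 𝕜 i • (cons v ∘ₗ pw (tensorGrading 𝒱) 1) := by
      refine hom_ext (𝒢 := tensorGrading 𝒱) fun k x hx => ?_
      simp [pw_apply _ (cons_mem hv hx), pw_apply _ hx, sg_add, mul_smul]
    have h₃ : TensorProduct.map (pw (tensorGrading 𝒱) 1) (tensorD 𝒱 d μ)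
        ((cons v).rTensor _ (cut s)) = sg 𝕜 i • (cons v).rTensor _
          (TensorProduct.map (pw (tensorGrading 𝒱) 1) (tensorD 𝒱 d μ) (cut s)) := by
      rw [← LinearMap.comp_apply, LinearMap.map_comp_rTensor, h₂, TensorProduct.map_smul_left,
        ← LinearMap.rTensor_comp_map]
      rfl
    rw [cut_cons v s, map_add, ← LinearMap.rTensor_comp_apply, h₁, map_add, h₃,
      LinearMap.rTensor_tmul, tensorD_one, TensorProduct.zero_tmul, TensorProduct.map_tmul,
      pw_apply _ one_mem_tensorGrading, tensorD_cons d μ hv]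
    simp only [map_add, map_smul, cut_cons, cut_headMul, ih, LinearMap.rTensor_add,
      LinearMap.rTensor_smul, LinearMap.add_apply, LinearMap.smul_apply,
      LinearMap.rTensor_comp_apply, TensorProduct.tmul_add, TensorProduct.tmul_smul, mul_zero,
      sg_zero, one_smul]
    module

end Cut

end ABAlg

namespace ABAlg

/-! ### Shuffles as lists and as permutations. -/

section ShuffleLists

variable {ι : Type*}

/-- The list of the shuffles of two lists. -/
def shuf : List ι → List ι → List (List ι)
  | [], Y => [Y]
  | X, [] => [X]
  | x :: X, y :: Y => (shuf X (y :: Y)).map (x :: ·) ++ (shuf (x :: X) Y).map (y :: ·)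

theorem shuf_nil (X : List ι) : shuf X [] = [X] := by cases X <;> simp [shuf]

theorem nil_shuf (Y : List ι) : shuf [] Y = [Y] := by cases Y <;> simp [shuf]

theorem shuf_cons (x y : ι) (X Y : List ι) : shuf (x :: X) (y :: Y) =
    (shuf X (y :: Y)).map (x :: ·) ++ (shuf (x :: X) Y).map (y :: ·) := by simp [shuf]

theorem perm_of_mem_shuf {L X Y : List ι} (h : L ∈ shuf X Y) : L.Perm (X ++ Y) := by
  induction X generalizing L Y with
  | nil => rw [nil_shuf, List.mem_singleton] at h; simp [h]
  | cons x X ihX =>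
    induction Y generalizing L with
    | nil => rw [shuf_nil, List.mem_singleton] at h; simp [h]
    | cons y Y ihY =>
      rw [shuf_cons, List.mem_append, List.mem_map, List.mem_map] at h
      obtain ⟨L, h, rfl⟩ | ⟨L, h, rfl⟩ := h
      · exact (ihX h).cons x
      · exact ((ihY h).cons y).trans (List.perm_middle (l₁ := x :: X)).symm

/-- When `P` separates the letters of `X` from those of `Y`, a shuffle is a list whose two filtered
sublists are `X` and `Y`. This form can be compared with the monotonicity conditions of `Bat`. -/
theorem mem_shuf (P : ι → Bool) {L X Y : List ι} (hX : ∀ x ∈ X, P x = true)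
    (hY : ∀ y ∈ Y, P y = false) : L ∈ shuf X Y ↔ L.filter P = X ∧ L.filter (fun i => !P i) = Y := by
  induction L generalizing X Y with
  | nil =>
    cases X with
    | nil => cases Y <;> simp [nil_shuf]
    | cons x X =>
      cases Y with
      | nil => simp [shuf_nil]
      | cons y Y => simp [shuf_cons]
  | cons i L ih =>
    cases X with
    | nil =>
      rw [nil_shuf, List.mem_singleton]
      constructor
      · rintro rfl
        exact ⟨List.filter_eq_nil_iff.2 fun a ha => by simp [hY a ha],
          List.filter_eq_self.2 fun a ha => by simp [hY a ha]⟩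
      · rintro ⟨h₁, h₂⟩
        rw [← h₂, eq_comm, List.filter_eq_self]
        intro a ha
        have := List.filter_eq_nil_iff.1 h₁ a ha
        simpa using this
    | cons x X =>
      cases Y with
      | nil =>
        rw [shuf_nil, List.mem_singleton]
        constructor
        · intro h
          rw [h]
          exact ⟨List.filter_eq_self.2 fun a ha => by simp [hX a ha],
            List.filter_eq_nil_iff.2 fun a ha => by simp [hX a ha]⟩
        · rintro ⟨h₁, h₂⟩
          rw [← h₁, eq_comm, List.filter_eq_self]
          intro a ha
          have := List.filter_eq_nil_iff.1 h₂ a ha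
          simpa using this
      | cons y Y =>
        have hx := hX x (by simp)
        have hy := hY y (by simp)
        have ih₁ := ih (X := X) (Y := y :: Y) (fun a ha => hX a (by simp [ha])) hY
        have ih₂ := ih (X := x :: X) (Y := Y) hX (fun a ha => hY a (by simp [ha]))
        rw [shuf_cons, List.mem_append, List.mem_map, List.mem_map]
        simp only [List.cons.injEq, exists_eq_right_right]
        rw [ih₁, ih₂]
        rcases hi : P i with _ | _
        · simp only [List.filter_cons, hi]
          simp only [Bool.false_eq_true, if_false, Bool.not_false, if_true]
          constructor
          · rintro (⟨-, rfl⟩ | ⟨⟨h₁, h₂⟩, rfl⟩)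
            · simp [hx] at hi
            · exact ⟨h₁, by rw [h₂]⟩
          · rintro ⟨h₁, h₂⟩
            obtain ⟨h₃, h₄⟩ := List.cons.inj h₂
            exact Or.inr ⟨⟨h₁, h₄⟩, h₃.symm⟩
        · simp only [List.filter_cons, hi]
          simp only [Bool.false_eq_true, if_false, Bool.not_true, if_true]
          constructor
          · rintro (⟨⟨h₁, h₂⟩, rfl⟩ | ⟨-, rfl⟩)
            · exact ⟨by rw [h₁], h₂⟩
            · simp [hy] at hi
          · rintro ⟨h₁, h₂⟩
            obtain ⟨h₃, h₄⟩ := List.cons.inj h₁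
            exact Or.inl ⟨⟨h₄, h₂⟩, h₃.symm⟩

theorem nodup_shuf {X Y : List ι} (h : ∀ x ∈ X, x ∉ Y) : (shuf X Y).Nodup := by
  induction X generalizing Y with
  | nil => simp [nil_shuf]
  | cons x X ihX =>
    induction Y with
    | nil => simp [shuf_nil]
    | cons y Y ihY =>
      rw [shuf_cons]
      refine List.Nodup.append ((ihX fun a ha => h a (by simp [ha])).map
        (List.cons_injective)) ((ihY fun a ha hY => h a ha (by simp [hY])).map
        (List.cons_injective)) ?_
      intro L h₁ h₂
      obtain ⟨L₁, -, rfl⟩ := List.mem_map.1 h₁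
      obtain ⟨L₂, -, e⟩ := List.mem_map.1 h₂
      exact h x (by simp) (by rw [(List.cons.inj e).1.symm]; simp)

end ShuffleLists

section Bat

variable {p q : ℕ} {M : Type*} [AddCommMonoid M]

/-- The first `p` indices. -/
def firstIdx (p q : ℕ) : List (Fin (p + q)) := (List.finRange p).map (Fin.castAdd q)

/-- The last `q` indices. -/
def lastIdx (p q : ℕ) : List (Fin (p + q)) := (List.finRange q).map (Fin.natAdd p)

theorem pairwise_firstIdx : (firstIdx p q).Pairwise (· < ·) := by
  rw [firstIdx, List.pairwise_map]
  exact (List.pairwise_lt_finRange p).imp fun h => h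

theorem pairwise_lastIdx : (lastIdx p q).Pairwise (· < ·) := by
  rw [lastIdx, List.pairwise_map]
  exact (List.pairwise_lt_finRange q).imp fun h => by simpa using h

theorem mem_firstIdx {i : Fin (p + q)} : i ∈ firstIdx p q ↔ i.val < p := by
  simp only [firstIdx, List.mem_map, List.mem_finRange, true_and]
  exact ⟨by rintro ⟨a, rfl⟩; simp, fun h => ⟨⟨i, h⟩, rfl⟩⟩

theorem mem_lastIdx {i : Fin (p + q)} : i ∈ lastIdx p q ↔ p ≤ i.val := by
  simp only [lastIdx, List.mem_map, List.mem_finRange, true_and]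
  exact ⟨by rintro ⟨a, rfl⟩; simp, fun h => ⟨⟨i - p, by omega⟩, by ext; simp; omega⟩⟩

/-- The values of `σ⁻¹` list the indices in their new order, so `σ` is increasing on a block exactly
when the indices of that block are listed in increasing order. -/
theorem mem_Bat_iff {σ : Equiv.Perm (Fin (p + q))} : σ ∈ Bat p q ↔
    (List.ofFn fun i => σ⁻¹ i) ∈ shuf (firstIdx p q) (lastIdx p q) := by
  rw [mem_shuf (fun i => decide (i.val < p)) (fun x hx => by simpa using mem_firstIdx.1 hx)
    (fun x hx => by simpa using mem_lastIdx.1 hx)]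
  have hmem (i) : i ∈ (List.ofFn fun i => σ⁻¹ i) := by
    rw [List.mem_ofFn]; exact ⟨σ i, by simp⟩
  have hnd : (List.ofFn fun i => σ⁻¹ i).Nodup := List.nodup_ofFn.2 σ⁻¹.injective
  -- The filtered list has the elements of the sorted list `X`, without repetition, so it equals `X`
  -- as soon as it is sorted.
  have key (P : Fin (p + q) → Bool) (X : List (Fin (p + q))) (hX : X.Pairwise (· < ·))
      (hP : ∀ i, i ∈ X ↔ P i = true) : (List.ofFn fun i => σ⁻¹ i).filter P = X ↔
      ∀ i j, P i = true → P j = true → i < j → σ i < σ j := by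
    have hperm : ((List.ofFn fun i => σ⁻¹ i).filter P).Perm X := by
      refine (List.perm_ext_iff_of_nodup (hnd.filter _) (hX.imp fun h => h.ne)).2 fun i => ?_
      rw [List.mem_filter, hP]; exact ⟨And.right, fun h => ⟨hmem i, h⟩⟩
    have : (List.ofFn fun i => σ⁻¹ i).filter P = X ↔
        ((List.ofFn fun i => σ⁻¹ i).filter P).Pairwise (· < ·) :=
      ⟨fun h => h ▸ hX, fun h => hperm.eq_of_pairwise' (r := (· < ·)) h hX⟩
    rw [this, List.pairwise_filter, List.pairwise_ofFn]
    constructor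
    · intro h i j hi hj hij
      by_contra hlt
      have hlt : σ j < σ i := lt_of_le_of_ne (not_lt.1 hlt) fun h => hij.ne' (σ.injective h)
      have := h hlt (by simpa using hj) (by simpa using hi)
      rw [Equiv.Perm.inv_def, Equiv.symm_apply_apply, Equiv.symm_apply_apply] at this
      exact absurd this hij.asymm
    · intro h i j hij hi hj
      by_contra hlt
      have hlt : σ⁻¹ j < σ⁻¹ i :=
        lt_of_le_of_ne (not_lt.1 hlt) fun h => hij.ne' (σ⁻¹.injective h)
      have := h _ _ hj hi hlt
      rw [Equiv.Perm.inv_def, Equiv.apply_symm_apply, Equiv.apply_symm_apply] at this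
      exact absurd this hij.asymm
  rw [key _ _ pairwise_firstIdx (fun i => by simpa using mem_firstIdx),
    key _ _ pairwise_lastIdx (fun i => by simpa using mem_lastIdx), Bat, Finset.mem_filter]
  simp only [Finset.mem_univ, true_and]
  refine and_congr ⟨fun h i j hi hj hij => ?_, fun h i j hij => h _ _ (by simp) (by simp) (by simpa)⟩
    ⟨fun h i j hi hj hij => ?_, fun h i j hij => h _ _ (by simp) (by simp) (by simpa)⟩
  · obtain ⟨i, -, rfl⟩ := List.mem_map.1 (mem_firstIdx.2 (by simpa using hi))
    obtain ⟨j, -, rfl⟩ := List.mem_map.1 (mem_firstIdx.2 (by simpa using hj))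
    exact h i j hij
  · obtain ⟨i, -, rfl⟩ := List.mem_map.1 (mem_lastIdx.2 (by simpa using hi))
    obtain ⟨j, -, rfl⟩ := List.mem_map.1 (mem_lastIdx.2 (by simpa using hj))
    exact h i j (by simpa using hij)

/-- This replaces permutations by recursively defined shuffles; each of these has length `p + q` and
no repetition, so it comes from a permutation. -/
theorem sum_Bat (F : List (Fin (p + q)) → M) :
    ∑ σ ∈ Bat p q, F (List.ofFn fun i => σ⁻¹ i) =
      ((shuf (firstIdx p q) (lastIdx p q)).map F).sum := by
  classical
  have hnd : (shuf (firstIdx p q) (lastIdx p q)).Nodup := nodup_shuf fun x hx hx' => by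
    have := mem_firstIdx.1 hx; have := mem_lastIdx.1 hx'; omega
  rw [← List.sum_toFinset F hnd]
  refine Finset.sum_bij (fun σ _ => List.ofFn fun i => σ⁻¹ i)
    (fun σ hσ => List.mem_toFinset.2 (mem_Bat_iff.1 hσ)) (fun σ _ τ _ h => ?_) (fun L hL => ?_)
    (fun _ _ => rfl)
  · exact inv_injective (Equiv.ext fun i => congrFun (List.ofFn_injective h) i)
  · have hL := List.mem_toFinset.1 hL
    have hperm := perm_of_mem_shuf hL
    have hnd : (firstIdx p q ++ lastIdx p q).Nodup := by
      refine List.Nodup.append (pairwise_firstIdx.imp fun h => h.ne)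
        (pairwise_lastIdx.imp fun h => h.ne) fun x hx hx' => ?_
      have := mem_firstIdx.1 hx; have := mem_lastIdx.1 hx'; omega
    have hlen : L.length = p + q := by
      rw [hperm.length_eq]; simp [firstIdx, lastIdx]
    have hbij : Function.Bijective (fun i : Fin (p + q) => L.get (i.cast hlen.symm)) := by
      refine (Finite.injective_iff_bijective).1 fun i j h => ?_
      have := (List.nodup_iff_injective_get.1 (hperm.nodup_iff.2 hnd)) h
      simpa using this
    have hof : (List.ofFn fun i => (Equiv.ofBijective _ hbij)⁻¹⁻¹ i) = L := by
      simp only [inv_inv, Equiv.ofBijective_apply]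
      refine List.ext_get (by simp [hlen]) fun i h₁ h₂ => ?_
      simp
    exact ⟨(Equiv.ofBijective _ hbij)⁻¹, mem_Bat_iff.2 (by rw [hof]; exact hL), hof⟩

end Bat

end ABAlg

namespace ABAlg

/-! ### Sums over shuffles with Koszul signs, matched with the recursive operations. -/

section Koszul

variable {N : ℕ} {e : Fin N → ℤ}

theorem koszul_cons_of_lt {i : Fin N} {L : List (Fin N)} (h : ∀ j ∈ L, i < j) :
    koszul e (i :: L) = koszul e L := by
  rw [koszul, List.filter_eq_nil_iff.2 fun j hj => by simpa using (h j hj).le]; simp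

theorem koszul_of_pairwise {L : List (Fin N)} (h : L.Pairwise (· < ·)) : koszul e L = 1 := by
  induction L with
  | nil => rfl
  | cons i L ih =>
    rw [List.pairwise_cons] at h
    rw [koszul_cons_of_lt h.1, ih h.2]

/-- The letters smaller than `y` are exactly those of `X`, and these are the ones it crosses. -/
theorem koszul_cons_of_mem_shuf {y : Fin N} {X Y L : List (Fin N)} (hL : L ∈ shuf X Y)
    (hX : ∀ x ∈ X, x < y) (hY : ∀ x ∈ Y, y < x) :
    koszul e (y :: L) = (e y * (X.map e).sum).negOnePow * koszul e L := by
  rw [koszul]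
  congr 2
  rw [List.sum_map_mul_left, (((perm_of_mem_shuf hL).filter _).map e).sum_eq, List.filter_append,
    List.filter_eq_self.2 fun x hx => by simpa using hX x hx,
    List.filter_eq_nil_iff.2 fun j hj => by simpa using (hY j hj).le, List.append_nil]

end Koszul

section ShuffleSum

universe u

variable {𝕜 : Type*} [Field 𝕜] {V : Type u} [AddCommGroup V] [Module 𝕜 V]
  {𝒱 : ℤ → Submodule 𝕜 V} {N : ℕ} {e : Fin N → ℤ} {α : Fin N → V}

theorem word_map_mem {ι : Type*} {e : ι → ℤ} {α : ι → V} (hα : ∀ i, α i ∈ 𝒱 (e i)) (X : List ι) :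
    word 𝕜 (X.map α) ∈ tensorGrading 𝒱 (X.map e).sum := by
  induction X with
  | nil => exact one_mem_tensorGrading
  | cons x X ih =>
    rw [List.map_cons, List.map_cons, List.sum_cons, word_cons']
    exact cons_mem (hα x) ih

theorem list_sum_map {ι M M' : Type*} [AddCommMonoid M] [AddCommMonoid M'] [Module 𝕜 M]
    [Module 𝕜 M'] (f : M →ₗ[𝕜] M') (l : List ι) (g : ι → M) :
    f (l.map g).sum = (l.map fun i => f (g i)).sum := by
  rw [map_list_sum, List.map_map]; rfl

variable (𝕜 e α) in
/-- The sum of the words obtained by applying `ℓ` to two consecutive letters, the first in `P`,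
the second not in `P`. -/
noncomputable def brWord (P : Fin N → Prop) [DecidablePred P] (c : ℤ) (ℓ : V →ₗ[𝕜] V →ₗ[𝕜] V) :
    List (Fin N) → TensorAlgebra 𝕜 V
  | [] => 0
  | [_] => 0
  | i :: j :: L => (if P i ∧ ¬ P j then cons (ℓ (α i) (α j)) (word 𝕜 (L.map α)) else 0) +
      sg 𝕜 (c * e i) • cons (α i) (brWord P c ℓ (j :: L))

theorem brWord_of_forall (P : Fin N → Prop) [DecidablePred P] (c : ℤ) (ℓ : V →ₗ[𝕜] V →ₗ[𝕜] V)
    {L : List (Fin N)} (h : (∀ i ∈ L, P i) ∨ ∀ i ∈ L, ¬ P i) : brWord 𝕜 e α P c ℓ L = 0 := by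
  induction L with
  | nil => rfl
  | cons i L ih =>
    cases L with
    | nil => rfl
    | cons j L =>
      rw [brWord, ih, map_zero, smul_zero, add_zero, if_neg]
      · rcases h with h | h
        · exact fun h' => h'.2 (h j (by simp))
        · exact fun h' => h i (by simp) h'.1
      · exact h.imp (fun h i hi => h i (by simp [hi])) (fun h i hi => h i (by simp [hi]))

theorem brWord_cons_of_not (P : Fin N → Prop) [DecidablePred P] (c : ℤ) (ℓ : V →ₗ[𝕜] V →ₗ[𝕜] V)
    {i : Fin N} (hi : ¬ P i) (L : List (Fin N)) :
    brWord 𝕜 e α P c ℓ (i :: L) = sg 𝕜 (c * e i) • cons (α i) (brWord 𝕜 e α P c ℓ L) := by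
  cases L with
  | nil => simp [brWord]
  | cons j L => rw [brWord, if_neg fun h => hi h.1, zero_add]

theorem sum_consecutive {M : Type*} [AddCommMonoid M] {n : ℕ} (g : Fin (n + 2) × Fin (n + 2) → M) :
    ∑ kk : Fin (n + 2) × Fin (n + 2) with kk.1.val + 1 = kk.2.val, g kk = g (0, 1) +
      ∑ kk : Fin (n + 1) × Fin (n + 1) with kk.1.val + 1 = kk.2.val, g (kk.1.succ, kk.2.succ) := by
  simp only [Finset.sum_filter, Fintype.sum_prod_type]
  rw [Fin.sum_univ_succ, Fin.sum_univ_succ, Fin.sum_univ_succ (n := n)]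
  congr 1
  · simp [Fin.succ_ne_zero, Fin.val_succ]
  · refine Finset.sum_congr rfl fun k _ => ?_
    rw [Fin.sum_univ_succ]
    simp

theorem sum_lt_succ {n : ℕ} (e : Fin (n + 1) → ℤ) (k : Fin n) :
    ∑ i with i < k.succ, e i = e 0 + ∑ i with i < k, e i.succ := by
  simp only [Finset.sum_filter, Fin.sum_univ_succ, Fin.succ_pos, if_true, Fin.succ_lt_succ_iff]

theorem brWord_ofFn (P : Fin N → Prop) [DecidablePred P] (c : ℤ) (ℓ : V →ₗ[𝕜] V →ₗ[𝕜] V) {n : ℕ}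
    (f : Fin n → Fin N) : brWord 𝕜 e α P c ℓ (List.ofFn f) =
      ∑ kk : Fin n × Fin n with kk.1.val + 1 = kk.2.val ∧ P (f kk.1) ∧ ¬ P (f kk.2),
        (c * ∑ s with s < kk.1, e (f s)).negOnePow •
          word 𝕜 ((List.ofFn fun i => α (f i)).take kk.1 ++ ℓ (α (f kk.1)) (α (f kk.2)) ::
            (List.ofFn fun i => α (f i)).drop (kk.1 + 2)) := by
  rw [← Finset.filter_filter, Finset.sum_filter]
  induction n with
  | zero => simp [brWord]
  | succ n ih =>
    cases n with
    | zero =>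
      rw [Finset.sum_eq_zero]
      · simp [brWord]
      · rintro ⟨k, l⟩ h
        simp at h
    | succ n =>
      rw [sum_consecutive, List.ofFn_succ, List.ofFn_succ, brWord,
        ← List.ofFn_succ (f := fun i => f i.succ), ih, map_sum, Finset.smul_sum]
      congr 1
      · simp [word_cons', Function.comp_def, List.map_ofFn]
      · refine Finset.sum_congr rfl fun kk _ => ?_
        simp only [apply_ite (cons (α (f 0))), map_zero, smul_ite, smul_zero, Fin.val_succ,
          sum_lt_succ, List.ofFn_succ (f := fun i => α (f i)), List.take_succ_cons,
          List.drop_succ_cons, List.cons_append, word_cons', add_right_comm _ 1 2, mul_add,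
          Int.negOnePow_add, mul_smul, negOnePow_smul 𝕜, map_smul]

variable [Internal 𝒱]

/-- A shuffle starting with `x` has no inversion there, and in one starting with `y` this letter
crosses all of `x :: X`: these are the two terms of `sh_cons`. -/
theorem sum_shuf_word (hα : ∀ i, α i ∈ 𝒱 (e i)) {X Y : List (Fin N)} (hX : X.Pairwise (· < ·))
    (hY : Y.Pairwise (· < ·)) (hXY : ∀ x ∈ X, ∀ y ∈ Y, x < y) :
    ((shuf X Y).map fun L => koszul e L • word 𝕜 (L.map α)).sum =
      sh 𝒱 (word 𝕜 (X.map α)) (word 𝕜 (Y.map α)) := by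
  induction X generalizing Y with
  | nil => simp [nil_shuf, koszul_of_pairwise hY, word_nil]
  | cons x X ihX =>
    induction Y with
    | nil => simp [shuf_nil, koszul_of_pairwise hX, word_nil]
    | cons y Y ihY =>
      have hX' := List.pairwise_cons.1 hX
      have hY' := List.pairwise_cons.1 hY
      rw [shuf_cons, List.map_append, List.sum_append, List.map_map, List.map_map, List.map_cons,
        List.map_cons, word_cons', word_cons', sh_cons (hα x) (hα y) (word_map_mem hα X),
        ← word_cons', ← word_cons', ← List.map_cons (f := α), ← List.map_cons (f := α),
        ← ihX hX'.2 hY fun a ha => hXY a (by simp [ha]),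
        ← ihY hY'.2 fun a ha b hb => hXY a ha b (by simp [hb]), list_sum_map, list_sum_map,
        List.smul_sum, List.map_map]
      congr 2
      · refine List.map_congr_left fun L hL => ?_
        have hlt (j) (hj : j ∈ L) : x < j := by
          rcases List.mem_append.1 ((perm_of_mem_shuf hL).mem_iff.1 hj) with h | h
          · exact hX'.1 j h
          · exact hXY x (by simp) j h
        simp only [Function.comp_apply, koszul_cons_of_lt hlt, List.map_cons, word_cons']
        simp only [Units.smul_def, map_zsmul]
      · refine List.map_congr_left fun L hL => ?_
        have := koszul_cons_of_mem_shuf (e := e) hL (fun a ha => hXY a ha y (by simp)) hY'.1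
        simp only [Function.comp_apply, this, List.map_cons, word_cons', mul_smul,
          negOnePow_smul 𝕜, List.sum_cons]
        simp only [Units.smul_def, map_smul, map_zsmul]

theorem bat_eq_sh {p q : ℕ} {e : Fin (p + q) → ℤ} {α : Fin (p + q) → V}
    (hα : ∀ i, α i ∈ 𝒱 (e i)) :
    bat 𝕜 p q e α = sh 𝒱 (word 𝕜 (List.ofFn fun i : Fin p => α (Fin.castAdd q i)))
      (word 𝕜 (List.ofFn fun j : Fin q => α (Fin.natAdd p j))) := by
  have := sum_Bat (p := p) (q := q) fun L => koszul e L • word 𝕜 (L.map α)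
  rw [sum_shuf_word hα pairwise_firstIdx pairwise_lastIdx] at this
  · simpa only [bat, firstIdx, lastIdx, ← List.ofFn_eq_map, List.map_ofFn, Function.comp_def] using this
  · intro x hx y hy
    have := mem_firstIdx.1 hx; have := mem_lastIdx.1 hy
    exact Fin.lt_def.2 (by omega)

/-- The induction for the plain shuffle, with one more case: a bracket at the first place requires
`x` followed at once by `y`, and gives the third term of `shBr_cons`. -/
theorem sum_shuf_brWord (hα : ∀ i, α i ∈ 𝒱 (e i)) (P : Fin N → Prop) [DecidablePred P] (c : ℤ)
    (ℓ : V →ₗ[𝕜] V →ₗ[𝕜] V) {X Y : List (Fin N)} (hX : X.Pairwise (· < ·))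
    (hY : Y.Pairwise (· < ·)) (hXY : ∀ x ∈ X, ∀ y ∈ Y, x < y) (hP : ∀ x ∈ X, P x)
    (hP' : ∀ y ∈ Y, ¬ P y) :
    ((shuf X Y).map fun L => koszul e L • brWord 𝕜 e α P c ℓ L).sum =
      shBr 𝒱 c ℓ (word 𝕜 (X.map α)) (word 𝕜 (Y.map α)) := by
  induction X generalizing Y with
  | nil => simp [nil_shuf, word_nil, brWord_of_forall P c ℓ (Or.inr hP')]
  | cons x X ihX =>
    induction Y with
    | nil => simp [shuf_nil, word_nil, brWord_of_forall P c ℓ (Or.inl hP)]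
    | cons y Y ihY =>
      have hX' := List.pairwise_cons.1 hX
      have hY' := List.pairwise_cons.1 hY
      have hPy := hP' y (by simp)
      have hPx := hP x (by simp)
      have hlt {L} (hL : L ∈ shuf X (y :: Y)) (j) (hj : j ∈ L) : x < j := by
        rcases List.mem_append.1 ((perm_of_mem_shuf hL).mem_iff.1 hj) with h | h
        · exact hX'.1 j h
        · exact hXY x (by simp) j h
      -- Among the shuffles starting with `x`, the bracket is made further on, or at the first place
      -- if the next letter is `y`.
      have hhead : ((shuf X (y :: Y)).map fun L =>
          koszul e (x :: L) • brWord 𝕜 e α P c ℓ (x :: L)).sum =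
          sg 𝕜 (c * e x) • cons (α x) ((shuf X (y :: Y)).map fun L =>
            koszul e L • brWord 𝕜 e α P c ℓ L).sum +
          sg 𝕜 (e y * (X.map e).sum) • cons (ℓ (α x) (α y))
            ((shuf X Y).map fun L => koszul e L • word 𝕜 (L.map α)).sum := by
        have hno (L) (hL : x :: L ∈ (shuf X (y :: Y)).map (x :: ·))
            (h : ∀ j L', L = j :: L' → P j) :
            koszul e (x :: L) • brWord 𝕜 e α P c ℓ (x :: L) =
            sg 𝕜 (c * e x) • cons (α x) (koszul e L • brWord 𝕜 e α P c ℓ L) := by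
          obtain ⟨L₁, hL₁, e₁⟩ := List.mem_map.1 hL
          obtain rfl := (List.cons.inj e₁).2
          rw [koszul_cons_of_lt (hlt hL₁)]
          cases L₁ with
          | nil => simp [brWord]
          | cons j L =>
            rw [brWord, if_neg fun h' => h'.2 (h j L rfl), zero_add]
            simp only [Units.smul_def, map_smul, map_zsmul]
            rw [smul_comm (koszul e (j :: L) : ℤ)]
        have hyes (L) (hL : L ∈ shuf X Y) :
            koszul e (x :: y :: L) • brWord 𝕜 e α P c ℓ (x :: y :: L) =
            sg 𝕜 (c * e x) • cons (α x) (koszul e (y :: L) • brWord 𝕜 e α P c ℓ (y :: L)) +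
            sg 𝕜 (e y * (X.map e).sum) • cons (ℓ (α x) (α y))
              (koszul e L • word 𝕜 (L.map α)) := by
          have hlt' (j) (hj : j ∈ y :: L) : x < j := by
            rcases List.mem_cons.1 hj with rfl | hj
            · exact hXY x (by simp) _ (by simp)
            · rcases List.mem_append.1 ((perm_of_mem_shuf hL).mem_iff.1 hj) with h | h
              · exact hX'.1 j h
              · exact hXY x (by simp) j (by simp [h])
          rw [koszul_cons_of_lt hlt', brWord, if_pos ⟨hPx, hPy⟩,
            koszul_cons_of_mem_shuf (e := e) hL (fun a ha => hXY a (by simp [ha]) y (by simp))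
              hY'.1, mul_smul, negOnePow_smul 𝕜]
          simp only [Units.smul_def, map_smul, map_zsmul, mul_smul, negOnePow_smul 𝕜]
          simp only [← Int.cast_smul_eq_zsmul 𝕜]
          module
        cases X with
        | nil =>
          simp only [nil_shuf, List.map_cons, List.map_nil, List.sum_singleton]
          exact hyes Y (by simp [nil_shuf])
        | cons x' X =>
          rw [shuf_cons, List.map_append, List.map_append, List.sum_append, List.sum_append,
            map_add, smul_add, list_sum_map, list_sum_map, list_sum_map, List.smul_sum,
            List.smul_sum, List.smul_sum]
          simp only [List.map_map]
          rw [add_assoc, ← List.sum_map_add]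
          congr 2
          · refine List.map_congr_left fun L hL => hno _ ?_ ?_
            · refine List.mem_map.2 ⟨_, ?_, rfl⟩
              rw [shuf_cons]; exact List.mem_append_left _ (List.mem_map.2 ⟨L, hL, rfl⟩)
            · rintro j L' h
              rw [← (List.cons.inj h).1]; exact hP _ (by simp)
          · exact List.map_congr_left fun L hL => hyes L hL
      rw [shuf_cons, List.map_append, List.sum_append, List.map_map, List.map_map, List.map_cons,
        List.map_cons, word_cons', word_cons', shBr_cons c ℓ (hα x) (hα y) (word_map_mem hα X),
        ← word_cons', ← word_cons', ← List.map_cons (f := α), ← List.map_cons (f := α),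
        ← ihX hX'.2 hY (fun a ha => hXY a (by simp [ha])) (fun a ha => hP a (by simp [ha])) hP',
        ← ihY hY'.2 (fun a ha b hb => hXY a ha b (by simp [hb])) (fun a ha => hP' a (by simp [ha])),
        ← sum_shuf_word hα hX'.2 hY'.2 (fun a ha b hb => hXY a (by simp [ha]) b (by simp [hb])),
        show ((fun L => koszul e L • brWord 𝕜 e α P c ℓ L) ∘ fun x_1 => x :: x_1) =
          fun L => koszul e (x :: L) • brWord 𝕜 e α P c ℓ (x :: L) from rfl, hhead,
        add_right_comm]
      congr 2
      rw [list_sum_map, List.smul_sum, List.map_map]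
      congr 1
      refine List.map_congr_left fun L hL => ?_
      have := koszul_cons_of_mem_shuf (e := e) hL (fun a ha => hXY a ha y (by simp)) hY'.1
      simp only [Function.comp_apply, this, brWord_cons_of_not P c ℓ hPy, mul_smul,
        negOnePow_smul 𝕜, List.sum_cons, List.map_cons, sg_add]
      simp only [Units.smul_def, map_smul, map_zsmul, mul_smul]
      simp only [← Int.cast_smul_eq_zsmul 𝕜]
      module

end ShuffleSum

end ABAlg

namespace ABAlg

/-! ### The counit of the tensor coalgebra. -/

section Counit

universe u

variable {𝕜 : Type*} [Field 𝕜] {V : Type u} [AddCommGroup V] [Module 𝕜 V]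
  {𝒱 : ℤ → Submodule 𝕜 V} {i j k m n p c : ℤ} {v w : V} {r s t : TensorAlgebra 𝕜 V}

/-- The counit of the tensor coalgebra. -/
noncomputable def eps : TensorAlgebra 𝕜 V →ₗ[𝕜] 𝕜 :=
  (TensorAlgebra.algebraMapInv (R := 𝕜) (M := V)).toLinearMap

@[simp] theorem eps_one : eps (1 : TensorAlgebra 𝕜 V) = 1 := by simp [eps]

@[simp] theorem eps_cons (v : V) (t : TensorAlgebra 𝕜 V) : eps (cons v t) = 0 := by
  simp [eps, cons_apply, TensorAlgebra.algebraMapInv]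

theorem eps_headMul (μ : V →ₗ[𝕜] V →ₗ[𝕜] V) (v : V) (t : TensorAlgebra 𝕜 V) :
    eps (headMul μ v t) = 0 := by
  induction t using tensorAlgebra_induction_left with
  | one => simp
  | add s t hs ht => simp [hs, ht]
  | smul c s hs => simp [hs]
  | mul w s _ => rw [← cons_apply, headMul_cons, eps_cons]

/-- The counit vanishes outside degree zero, so signs depending on the degree of `s` are invisible
next to `eps s`. -/
theorem sg_smul_eps {M : Type*} [AddCommGroup M] [Module 𝕜 M] (hs : s ∈ tensorGrading 𝒱 m) (j : ℤ)
    (x : M) : sg 𝕜 (m * j) • eps s • x = eps s • x := by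
  refine tensorGrading_cons_induction
    (p := fun m s => sg 𝕜 (m * j) • eps s • x = eps s • x) ?_ ?_ ?_ ?_ ?_ hs
  · intros; simp
  · intro m s t h₁ h₂; rw [map_add, add_smul, smul_add, h₁, h₂]
  · intro m c s h; rw [map_smul, smul_assoc, smul_comm, h]
  · simp [sg_zero]
  · intros; simp

theorem lTensor_eps_cut (t : TensorAlgebra 𝕜 V) :
    TensorProduct.rid 𝕜 _ (eps.lTensor _ (cut t)) = t := by
  induction t using tensorAlgebra_induction_left with
  | one => simp
  | add s t hs ht => simp [hs, ht]
  | smul c s hs => simp [hs]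
  | mul v s hs =>
    rw [← cons_apply, cut_cons, map_add, LinearMap.lTensor_tmul, eps_cons, TensorProduct.tmul_zero,
      zero_add]
    conv_rhs => rw [← hs]
    generalize cut s = σ
    induction σ using TensorProduct.induction_on with
    | zero => simp
    | add x y hx hy => simp only [map_add, hx, hy]
    | tmul x y => simp

theorem rTensor_eps_cut (t : TensorAlgebra 𝕜 V) :
    TensorProduct.lid 𝕜 _ (eps.rTensor _ (cut t)) = t := by
  induction t using tensorAlgebra_induction_left with
  | one => simp
  | add s t hs ht => simp [hs, ht]
  | smul c s hs => simp [hs]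
  | mul v s hs =>
    have : eps ∘ₗ cons (𝕜 := 𝕜) v = 0 := by ext; simp
    rw [← cons_apply, cut_cons, map_add, ← LinearMap.rTensor_comp_apply, this]
    simp

variable [Internal 𝒱]

theorem eps_shBr (c : ℤ) (ℓ : V →ₗ[𝕜] V →ₗ[𝕜] V) (s t : TensorAlgebra 𝕜 V) :
    eps (shBr 𝒱 c ℓ s t) = 0 := by
  suffices (shBr 𝒱 c ℓ).compr₂ eps = 0 from LinearMap.congr_fun₂ this s t
  refine hom_ext (𝒢 := tensorGrading 𝒱) fun m s hs => hom_ext (𝒢 := tensorGrading 𝒱) fun n t ht => ?_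
  simp only [LinearMap.compr₂_apply, LinearMap.zero_apply]
  refine tensorGrading_cons_induction (p := fun m s => eps (shBr 𝒱 c ℓ s t) = 0)
    ?_ ?_ ?_ ?_ ?_ hs
  · intros; simp
  · intro m s t h₁ h₂; simp [h₁, h₂]
  · intro m c s h; simp [h]
  · simp
  · intro i v m s hv hs _
    refine tensorGrading_cons_induction
      (p := fun n t => eps (shBr 𝒱 c ℓ (cons v s) t) = 0) ?_ ?_ ?_ ?_ ?_ ht
    · intros; simp
    · intro m s t h₁ h₂; simp [h₁, h₂]
    · intro m c s h; simp [h]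
    · simp
    · intro j w n t hw ht _
      simp [shBr_cons c ℓ hv hw hs]

theorem eps_tensorD (d : V →ₗ[𝕜] V) (μ : V →ₗ[𝕜] V →ₗ[𝕜] V) (s : TensorAlgebra 𝕜 V) :
    eps (tensorD 𝒱 d μ s) = 0 := by
  suffices eps ∘ₗ tensorD 𝒱 d μ = 0 from LinearMap.congr_fun this s
  refine hom_ext (𝒢 := tensorGrading 𝒱) fun m s hs => ?_
  refine tensorGrading_cons_induction (p := fun m s => eps (tensorD 𝒱 d μ s) = 0)
    ?_ ?_ ?_ ?_ ?_ hs
  · intros; simp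
  · intro m s t h₁ h₂; simp [h₁, h₂]
  · intro m c s h; simp [h]
  · simp
  · intro i v m s hv hs _
    simp [tensorD_cons d μ hv, eps_headMul]

end Counit

/-! ### Packets: descent of the differential and of the bracket. -/

section Packets

universe u

variable {𝕜 : Type*} [Field 𝕜] {V : Type u} [AddCommGroup V] [Module 𝕜 V]
  {M : Type*} [AddCommGroup M] [Module 𝕜 M]
  {𝒱 : ℤ → Submodule 𝕜 V} {i j k m n p c : ℤ} {v w : V} {r s t : TensorAlgebra 𝕜 V}

/-- A bilinear map that kills two submodules induces one on the quotients. -/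
theorem exists_liftQ₂ {M₁ M₂ : Type*} [AddCommGroup M₁] [Module 𝕜 M₁] [AddCommGroup M₂]
    [Module 𝕜 M₂] (J₁ : Submodule 𝕜 M₁) (J₂ : Submodule 𝕜 M₂) (F : M₁ →ₗ[𝕜] M₂ →ₗ[𝕜] M)
    (h₁ : ∀ s ∈ J₁, ∀ t, F s t = 0) (h₂ : ∀ s, ∀ t ∈ J₂, F s t = 0) :
    ∃ G : M₁ ⧸ J₁ →ₗ[𝕜] M₂ ⧸ J₂ →ₗ[𝕜] M, ∀ s t, G (J₁.mkQ s) (J₂.mkQ t) = F s t := by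
  let G₁ : M₁ ⧸ J₁ →ₗ[𝕜] M₂ →ₗ[𝕜] M := J₁.liftQ F fun s hs => LinearMap.ext (h₁ s hs)
  refine ⟨(J₂.liftQ G₁.flip fun t ht => ?_).flip, fun s t => rfl⟩
  refine LinearMap.ext fun x => ?_
  obtain ⟨s, rfl⟩ := J₁.mkQ_surjective x
  exact h₂ s t ht

theorem span_homogeneous_words [Internal 𝒱] :
    Submodule.span 𝕜 {t | ∃ (n : ℕ) (e : Fin n → ℤ) (α : Fin n → V), (∀ i, α i ∈ 𝒱 (e i)) ∧
      t = word 𝕜 (List.ofFn α)} = ⊤ := by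
  rw [eq_top_iff, ← iSup_tensorGrading (𝒱 := 𝒱)]
  refine iSup_le fun m => Submodule.span_mono ?_
  rintro _ ⟨n, e, α, h, -, rfl⟩
  exact ⟨n, e, α, h, rfl⟩

theorem mkQ_one : (shuffles 𝒱).mkQ 1 = 0 :=
  (Submodule.Quotient.mk_eq_zero _).2 (Submodule.subset_span (Or.inl rfl))

theorem packetGrading_eq_map (t : ℤ) :
    packetGrading 𝒱 t = (tensorGrading 𝒱 t).map (shuffles 𝒱).mkQ := by
  rw [tensorGrading, Submodule.map_span, packetGrading]
  congr 1
  ext X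
  constructor
  · rintro ⟨n, e, α, h, h', rfl⟩; exact ⟨_, ⟨n, e, α, h, h', rfl⟩, rfl⟩
  · rintro ⟨_, ⟨n, e, α, h, h', rfl⟩, rfl⟩; exact ⟨n, e, α, h, h', rfl⟩

theorem mkQ_mem (hs : s ∈ tensorGrading 𝒱 m) : (shuffles 𝒱).mkQ s ∈ packetGrading 𝒱 m := by
  rw [packetGrading_eq_map]; exact ⟨s, hs, rfl⟩

variable [Internal 𝒱]

/-- The quotient kills the shuffles of words without scalar part, so only the scalar part of each
factor acts on the other. -/
theorem mkQ_sh (s t : TensorAlgebra 𝕜 V) : (shuffles 𝒱).mkQ (sh 𝒱 s t) =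
    eps s • (shuffles 𝒱).mkQ t + eps t • (shuffles 𝒱).mkQ s := by
  have hs : s ∈ (⊤ : Submodule 𝕜 _) := trivial
  rw [← span_homogeneous_words (𝒱 := 𝒱)] at hs
  induction hs using Submodule.span_induction with
  | zero => simp
  | add x y _ _ hx hy => simp only [map_add, LinearMap.add_apply, hx, hy]; module
  | smul c x _ hx => simp only [map_smul, LinearMap.smul_apply, hx, smul_eq_mul]; module
  | mem s hs =>
  obtain ⟨p, e, α, hα, rfl⟩ := hs
  have ht : t ∈ (⊤ : Submodule 𝕜 _) := trivial
  rw [← span_homogeneous_words (𝒱 := 𝒱)] at ht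
  induction ht using Submodule.span_induction with
  | zero => simp
  | add x y _ _ hx hy => simp only [map_add, hx, hy]; module
  | smul c x _ hx => simp only [map_smul, hx, smul_eq_mul]; module
  | mem s hs =>
  obtain ⟨q, e', α', hα', rfl⟩ := hs
  cases p with
  | zero => simp [word_nil, mkQ_one, -Submodule.mkQ_apply]
  | succ p =>
  cases q with
  | zero => simp [word_nil, mkQ_one, -Submodule.mkQ_apply]
  | succ q =>
  have hα'' (i) : Fin.append α α' i ∈ 𝒱 (Fin.append e e' i) := by
    refine Fin.addCases (fun i => ?_) (fun i => ?_) i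
    · simpa using hα i
    · simpa using hα' i
  have := bat_eq_sh hα''
  simp only [Fin.append_left, Fin.append_right] at this
  have h0 : (shuffles 𝒱).mkQ (bat 𝕜 (p + 1) (q + 1) (Fin.append e e') (Fin.append α α')) = 0 :=
    (Submodule.Quotient.mk_eq_zero _).2
      (Submodule.subset_span (Or.inr ⟨_, _, _, _, p.succ_pos, q.succ_pos, hα'', rfl⟩))
  rw [← this, h0]
  rw [List.ofFn_succ, List.ofFn_succ, word_cons', word_cons', eps_cons, eps_cons]
  simp

theorem shuffles_induction {p : TensorAlgebra 𝕜 V → Prop} (zero : p 0)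
    (add : ∀ s t, p s → p t → p (s + t)) (smul : ∀ (c : 𝕜) s, p s → p (c • s)) (one : p 1)
    (shuffle : ∀ m n s t, s ∈ tensorGrading 𝒱 m → t ∈ tensorGrading 𝒱 n → eps s = 0 → eps t = 0 →
      p (sh 𝒱 s t)) {s : TensorAlgebra 𝕜 V} (hs : s ∈ shuffles 𝒱) : p s := by
  induction hs using Submodule.span_induction with
  | zero => exact zero
  | add x y _ _ hx hy => exact add x y hx hy
  | smul c x _ hx => exact smul c x hx
  | mem s hs =>
    obtain rfl | ⟨p, q, e, α, hp, hq, hα, rfl⟩ := hs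
    · exact one
    · obtain ⟨p, rfl⟩ := Nat.exists_eq_succ_of_ne_zero hp.ne'
      obtain ⟨q, rfl⟩ := Nat.exists_eq_succ_of_ne_zero hq.ne'
      rw [bat_eq_sh hα]
      refine shuffle _ _ _ _ (word_mem_tensorGrading fun i => hα _)
        (word_mem_tensorGrading fun i => hα _) ?_ ?_
      · rw [List.ofFn_succ, word_cons', eps_cons]
      · rw [List.ofFn_succ, word_cons', eps_cons]

instance : Internal (packetGrading 𝒱) := by
  rw [funext (packetGrading_eq_map (𝒱 := 𝒱))]
  refine Internal.mkQ _ ?_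
  rintro _ (rfl | ⟨p, q, e, α, hp, hq, hα, rfl⟩)
  · exact ⟨0, one_mem_tensorGrading⟩
  · rw [bat_eq_sh hα]
    exact ⟨_, sh_mem (word_mem_tensorGrading fun i => hα _) (word_mem_tensorGrading fun i => hα _)⟩

/-- By `tensorD_sh`, a shuffle of tensors without scalar part is sent to a sum of such shuffles,
since `tensorD` never produces a scalar part. -/
theorem exists_packetD {d : V →ₗ[𝕜] V} {μ : V →ₗ[𝕜] V →ₗ[𝕜] V} (hd : ∀ i, ∀ v ∈ 𝒱 i, d v ∈ 𝒱 (i + 1))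
    (hμ : ∀ i j, ∀ v ∈ 𝒱 i, ∀ w ∈ 𝒱 j, μ v w ∈ 𝒱 (i + j + 1))
    (hμc : ∀ i j, ∀ v ∈ 𝒱 i, ∀ w ∈ 𝒱 j, μ v w = sg 𝕜 (i * j + 1) • μ w v) :
    ∃ D : Packets 𝒱 →ₗ[𝕜] Packets 𝒱,
      ∀ s, D ((shuffles 𝒱).mkQ s) = (shuffles 𝒱).mkQ (tensorD 𝒱 d μ s) := by
  refine ⟨(shuffles 𝒱).liftQ ((shuffles 𝒱).mkQ ∘ₗ tensorD 𝒱 d μ) fun s hs => ?_, fun s => rfl⟩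
  rw [LinearMap.mem_ker, LinearMap.comp_apply]
  refine shuffles_induction (p := fun s => (shuffles 𝒱).mkQ (tensorD 𝒱 d μ s) = 0)
    (by simp) (fun s t hs ht => by rw [map_add, map_add, hs, ht, add_zero])
    (fun c s hs => by rw [map_smul, map_smul, hs, smul_zero]) (by simp) ?_ hs
  intro m n s t hs ht hs' ht'
  rw [tensorD_sh hd hμ hμc hs ht, map_add, map_smul, mkQ_sh, mkQ_sh]
  simp only [eps_tensorD, hs', ht', zero_smul, add_zero, smul_zero]

/-- Bracketing with a shuffle gives a sum of shuffles, by `shBr_sh` in the first argument and,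
through `shBr_symm`, in the second. -/
theorem exists_packetBr {ℓ : V →ₗ[𝕜] V →ₗ[𝕜] V}
    (hℓ : ∀ i j, ∀ v ∈ 𝒱 i, ∀ w ∈ 𝒱 j, ℓ v w ∈ 𝒱 (i + j + c))
    (hℓc : ∀ i j, ∀ v ∈ 𝒱 i, ∀ w ∈ 𝒱 j, ℓ v w = sg 𝕜 (i * j + c + 1) • ℓ w v) :
    ∃ L : Packets 𝒱 →ₗ[𝕜] Packets 𝒱 →ₗ[𝕜] Packets 𝒱, ∀ s t,
      L ((shuffles 𝒱).mkQ s) ((shuffles 𝒱).mkQ t) = (shuffles 𝒱).mkQ (shBr 𝒱 c ℓ s t) := by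
  have h₁ : ∀ s ∈ shuffles 𝒱, ((shBr 𝒱 c ℓ).compr₂ (shuffles 𝒱).mkQ) s = 0 := by
    intro s hs
    refine hom_ext (𝒢 := tensorGrading 𝒱) fun n t ht => ?_
    rw [LinearMap.compr₂_apply, LinearMap.zero_apply]
    refine shuffles_induction (p := fun s => (shuffles 𝒱).mkQ (shBr 𝒱 c ℓ s t) = 0)
      (by simp) (fun s t hs ht => by rw [map_add, LinearMap.add_apply, map_add, hs, ht, add_zero])
      (fun c s hs => by rw [map_smul, LinearMap.smul_apply, map_smul, hs, smul_zero]) (by simp) ?_ hs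
    intro m n s r hs hr hs' hr'
    rw [shBr_sh hℓ hs hr ht, map_add, map_smul, map_smul, mkQ_sh, mkQ_sh]
    simp only [eps_shBr, hs', hr', zero_smul, add_zero, smul_zero]
  refine exists_liftQ₂ _ _ ((shBr 𝒱 c ℓ).compr₂ (shuffles 𝒱).mkQ)
    (fun s hs t => by rw [h₁ s hs]; rfl) fun s t ht => ?_
  suffices ((shBr 𝒱 c ℓ).compr₂ (shuffles 𝒱).mkQ).flip t = 0 from LinearMap.congr_fun this s
  refine hom_ext (𝒢 := tensorGrading 𝒱) fun m s hs => ?_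
  rw [LinearMap.flip_apply, LinearMap.compr₂_apply, LinearMap.zero_apply]
  refine shuffles_induction (p := fun t => (shuffles 𝒱).mkQ (shBr 𝒱 c ℓ s t) = 0)
    (by simp) (fun s t hs ht => by rw [map_add, map_add, hs, ht, add_zero])
    (fun c s hs => by rw [map_smul, map_smul, hs, smul_zero]) (by simp) ?_ ht
  intro n p t r ht hr ht' hr'
  rw [shBr_symm hℓc hs (sh_mem ht hr), shBr_sh hℓ ht hr hs, map_smul, map_add, map_smul, map_smul,
    mkQ_sh, mkQ_sh]
  simp only [eps_shBr, ht', hr', zero_smul, add_zero, smul_zero]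

end Packets

end ABAlg

namespace ABAlg

/-! ### Derivations of a tensor square and the Koszul braiding. -/

section Derivations

variable {𝕜 : Type*} [Field 𝕜] {M : Type*} [AddCommGroup M] [Module 𝕜 M]
  (𝒢 : ℤ → Submodule 𝕜 M) [Internal 𝒢]

/-- For `f` of degree `j`, the operator `f ⊗ id + id ⊗ f` with the Koszul sign rule. -/
noncomputable def der (j : ℤ) (f : M →ₗ[𝕜] M) : M ⊗[𝕜] M →ₗ[𝕜] M ⊗[𝕜] M :=
  f.rTensor M + TensorProduct.map (pw 𝒢 j) f

/-- The Koszul braiding. -/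
noncomputable def braid : M ⊗[𝕜] M →ₗ[𝕜] M ⊗[𝕜] M :=
  TensorProduct.lift (gradedLift 𝒢 fun i => (TensorProduct.mk 𝕜 M M).flip.compl₂ (pw 𝒢 i))

variable {𝒢} {i j k l m n : ℤ} {x y : M} {f g : M →ₗ[𝕜] M}

theorem der_tmul (f : M →ₗ[𝕜] M) (hx : x ∈ 𝒢 i) (y : M) :
    der 𝒢 j f (x ⊗ₜ y) = f x ⊗ₜ y + sg 𝕜 (j * i) • x ⊗ₜ f y := by
  simp [der, pw_apply _ hx, TensorProduct.smul_tmul']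

theorem braid_tmul (hx : x ∈ 𝒢 i) (hy : y ∈ 𝒢 j) :
    braid 𝒢 (x ⊗ₜ y) = sg 𝕜 (i * j) • y ⊗ₜ x := by
  rw [braid, TensorProduct.lift.tmul, gradedLift_apply _ hx]
  simp [pw_apply _ hy, TensorProduct.smul_tmul']

theorem pw_mem (hx : x ∈ 𝒢 i) (j : ℤ) : pw 𝒢 j x ∈ 𝒢 i := by
  rw [pw_apply _ hx]; exact Submodule.smul_mem _ _ hx

theorem braid_der (hf : HasDegree 𝒢 j f) (z : M ⊗[𝕜] M) :
    braid 𝒢 (der 𝒢 j f z) = der 𝒢 j f (braid 𝒢 z) := by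
  induction z using tensor_induction 𝒢 𝒢 with
  | zero => simp
  | add x y hx hy => simp only [map_add, hx, hy]
  | tmul m x hx n y hy =>
    rw [der_tmul f hx, braid_tmul hx hy, map_add, map_smul, map_smul, der_tmul f hy,
      braid_tmul (hf _ _ hx) hy, braid_tmul hx (hf _ _ hy)]
    match_scalars <;> simp only [mul_one, ← sg_add] <;> refine sg_congr ?_ <;> clear * - <;> grind

theorem pw_shift (k j : ℤ) : pw 𝒢 j = sg 𝕜 (j * k) • pw (shift 𝒢 k) j := by
  refine hom_ext (𝒢 := shift 𝒢 k) fun i x hx => ?_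
  rw [pw_apply (𝒢 := 𝒢) j (i := i + k) hx, LinearMap.smul_apply, pw_apply _ hx, smul_smul, ← sg_add,
    mul_add, add_comm]

theorem pw_pw (i j : ℤ) (x : M) : pw 𝒢 i (pw 𝒢 j x) = pw 𝒢 (i + j) x := by
  suffices pw 𝒢 i ∘ₗ pw 𝒢 j = pw 𝒢 (i + j) from LinearMap.congr_fun this x
  refine hom_ext (𝒢 := 𝒢) fun m x hx => ?_
  rw [LinearMap.comp_apply, pw_apply _ hx, map_smul, pw_apply _ hx, pw_apply _ hx, smul_smul,
    ← sg_add]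
  congr 1
  exact sg_congr (by clear * -; grind)

theorem pw_even (i : ℤ) (x : M) : pw 𝒢 (i + i) x = x := by
  suffices pw 𝒢 (i + i) = LinearMap.id from LinearMap.congr_fun this x
  refine hom_ext (𝒢 := 𝒢) fun m x hx => ?_
  rw [pw_apply _ hx, ← sg_congr (m := 0) (by clear * -; grind), sg_zero, one_smul]
  rfl

/-- Shifting the grading changes the sign in `id ⊗ f` by `(-1)^(k j)`, whereas `f ⊗ id` is
unchanged; the twist of the first factor turns this discrepancy into a global sign. -/
theorem rTensor_pw_der (k : ℤ) (hf : HasDegree (shift 𝒢 k) j f) (z : M ⊗[𝕜] M) :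
    (pw (shift 𝒢 k) k).rTensor M (der 𝒢 j f z) =
      sg 𝕜 (k * j) • der (shift 𝒢 k) j f ((pw (shift 𝒢 k) k).rTensor M z) := by
  induction z using tensor_induction (shift 𝒢 k) (shift 𝒢 k) with
  | zero => simp
  | add x y hx hy => simp only [map_add, hx, hy]; module
  | tmul m x hx n y hy =>
    rw [der_tmul (𝒢 := 𝒢) (i := m + k) f hx, LinearMap.rTensor_tmul, pw_apply _ hx,
      ← TensorProduct.smul_tmul', map_smul, der_tmul f hx, map_add, map_smul]
    simp only [LinearMap.rTensor_tmul, pw_apply _ hx, pw_apply _ (hf _ _ hx),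
      ← TensorProduct.smul_tmul']
    match_scalars <;> simp only [mul_one, ← sg_add] <;> refine sg_congr ?_ <;> clear * - <;> grind

theorem braid_pw (j : ℤ) (z : M ⊗[𝕜] M) :
    braid 𝒢 (TensorProduct.map (pw 𝒢 j) (pw 𝒢 j) z) =
      TensorProduct.map (pw 𝒢 j) (pw 𝒢 j) (braid 𝒢 z) := by
  induction z using tensor_induction 𝒢 𝒢 with
  | zero => simp
  | add x y hx hy => simp only [map_add, hx, hy]
  | tmul m x hx n y hy =>
    simp only [TensorProduct.map_tmul, braid_tmul hx hy, braid_tmul (pw_mem hx j) (pw_mem hy j),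
      map_smul]

end Derivations

/-! ### The cut of a word into two packets, and its antisymmetrization. -/

section Kappa

universe u

variable {𝕜 : Type*} [Field 𝕜] {V : Type u} [AddCommGroup V] [Module 𝕜 V]
  (𝒱 : ℤ → Submodule 𝕜 V)

/-- The projection of the tensor square onto the square of the space of packets. -/
noncomputable abbrev mkQ₂ : TensorAlgebra 𝕜 V ⊗[𝕜] TensorAlgebra 𝕜 V →ₗ[𝕜]
    Packets 𝒱 ⊗[𝕜] Packets 𝒱 :=
  TensorProduct.map (shuffles 𝒱).mkQ (shuffles 𝒱).mkQ

/-- The sum of the cuts of a word into two packets. -/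
noncomputable def kap : TensorAlgebra 𝕜 V →ₗ[𝕜] Packets 𝒱 ⊗[𝕜] Packets 𝒱 := mkQ₂ 𝒱 ∘ₗ cut

variable {𝒱} [Internal 𝒱] {i j k m n p c : ℤ} {v w : V} {r s t : TensorAlgebra 𝕜 V}

theorem pw_mkQ (j : ℤ) (s : TensorAlgebra 𝕜 V) : pw (packetGrading 𝒱) j ((shuffles 𝒱).mkQ s) =
    (shuffles 𝒱).mkQ (pw (tensorGrading 𝒱) j s) := by
  suffices pw (packetGrading 𝒱) j ∘ₗ (shuffles 𝒱).mkQ =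
      (shuffles 𝒱).mkQ ∘ₗ pw (tensorGrading 𝒱) j from LinearMap.congr_fun this s
  refine hom_ext (𝒢 := tensorGrading 𝒱) fun m s hs => ?_
  rw [LinearMap.comp_apply, LinearMap.comp_apply, pw_apply _ hs, pw_apply _ (mkQ_mem hs), map_smul]

/-- Applying `mkQ_sh` to both factors gives four terms, according to which word supplies the scalar
on the left and on the right. -/
theorem mkQ₂_cross_sh (hs : s ∈ tensorGrading 𝒱 m) (τ : TensorAlgebra 𝕜 V ⊗[𝕜] TensorAlgebra 𝕜 V) :
    mkQ₂ 𝒱 (cross 𝒱 (sh 𝒱) (sh 𝒱) 0 τ (cut s)) = eps s • mkQ₂ 𝒱 τ +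
      (shuffles 𝒱).mkQ (pw (tensorGrading 𝒱) m (TensorProduct.rid 𝕜 _ (eps.lTensor _ τ))) ⊗ₜ
        (shuffles 𝒱).mkQ s +
      (shuffles 𝒱).mkQ s ⊗ₜ (shuffles 𝒱).mkQ (TensorProduct.lid 𝕜 _ (eps.rTensor _ τ)) +
      (LinearMap.mul' 𝕜 𝕜 (TensorProduct.map eps eps τ)) • kap 𝒱 s := by
  induction τ using tensor_induction (tensorGrading 𝒱) (tensorGrading 𝒱) with
  | zero => simp
  | add x y hx hy =>
    simp only [map_add, LinearMap.add_apply, hx, hy, TensorProduct.add_tmul, TensorProduct.tmul_add]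
    module
  | tmul n t ht n' t' ht' =>
    have key (σ : TensorAlgebra 𝕜 V ⊗[𝕜] TensorAlgebra 𝕜 V) :
        mkQ₂ 𝒱 (cross 𝒱 (sh 𝒱) (sh 𝒱) 0 (t ⊗ₜ t') σ) =
        eps (TensorProduct.rid 𝕜 _ (eps.lTensor _ σ)) •
            ((shuffles 𝒱).mkQ t ⊗ₜ (shuffles 𝒱).mkQ t') +
          eps t' • (shuffles 𝒱).mkQ t ⊗ₜ
            (shuffles 𝒱).mkQ (pw (tensorGrading 𝒱) n (TensorProduct.lid 𝕜 _ (eps.rTensor _ σ))) +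
          eps t • (shuffles 𝒱).mkQ (TensorProduct.rid 𝕜 _ (eps.lTensor _ σ)) ⊗ₜ
            (shuffles 𝒱).mkQ t' + eps t • eps t' • mkQ₂ 𝒱 σ := by
      induction σ using tensor_induction (tensorGrading 𝒱) (tensorGrading 𝒱) with
      | zero => simp
      | add x y hx hy =>
        simp only [map_add, hx, hy, TensorProduct.add_tmul, TensorProduct.tmul_add]
        module
      | tmul k s hs k' s' hs' =>
        rw [cross_tmul _ _ _ hs hs' ht, map_smul, TensorProduct.map_tmul, mkQ_sh, mkQ_sh]
        have e₁ (x : Packets 𝒱 ⊗[𝕜] Packets 𝒱) := sg_smul_eps hs' n x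
        have e₂ (x : Packets 𝒱 ⊗[𝕜] Packets 𝒱) := sg_smul_eps ht k' x
        simp only [mul_comm n k'] at e₂
        simp only [zero_mul, add_zero, LinearMap.lTensor_tmul, LinearMap.rTensor_tmul,
          TensorProduct.rid_tmul, TensorProduct.lid_tmul, map_smul, pw_apply _ hs',
          TensorProduct.map_tmul, mul_comm n k', TensorProduct.add_tmul, TensorProduct.tmul_add,
          ← TensorProduct.smul_tmul', TensorProduct.tmul_smul, smul_add]
        rw [e₁, e₁, smul_comm (eps t') (eps t), e₂]
        module
    rw [key, lTensor_eps_cut, rTensor_eps_cut, kap, LinearMap.comp_apply, pw_apply _ hs]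
    simp only [LinearMap.lTensor_tmul, LinearMap.rTensor_tmul, TensorProduct.rid_tmul,
      TensorProduct.lid_tmul, map_smul, pw_apply _ ht, TensorProduct.map_tmul,
      LinearMap.mul'_apply, mul_comm n m, ← TensorProduct.smul_tmul', TensorProduct.tmul_smul]
    module

/-- Only the cuts that separate `s` from `t` survive. The result is symmetric for the Koszul
braiding, which is why antisymmetrization will kill it. -/
theorem kap_sh (hs : s ∈ tensorGrading 𝒱 m) (ht : t ∈ tensorGrading 𝒱 n) (hs' : eps s = 0)
    (ht' : eps t = 0) : kap 𝒱 (sh 𝒱 s t) = (shuffles 𝒱).mkQ s ⊗ₜ (shuffles 𝒱).mkQ t +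
      sg 𝕜 (m * n) • (shuffles 𝒱).mkQ t ⊗ₜ (shuffles 𝒱).mkQ s := by
  have h0 : LinearMap.mul' 𝕜 𝕜 (TensorProduct.map eps eps (cut t)) = 0 := by
    have h (τ : TensorAlgebra 𝕜 V ⊗[𝕜] TensorAlgebra 𝕜 V) :
        LinearMap.mul' 𝕜 𝕜 (TensorProduct.map eps eps τ) =
          eps (TensorProduct.rid 𝕜 _ (eps.lTensor _ τ)) := by
      induction τ using TensorProduct.induction_on with
      | zero => simp
      | add x y hx hy => simp only [map_add, hx, hy]
      | tmul x y => simp [mul_comm]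
    rw [h, lTensor_eps_cut, ht']
  rw [kap, LinearMap.comp_apply, cut_sh hs ht, mkQ₂_cross_sh hs, h0, lTensor_eps_cut,
    rTensor_eps_cut, hs', pw_apply _ ht]
  simp only [map_smul, ← TensorProduct.smul_tmul']
  module

theorem kap_tensorD {d : V →ₗ[𝕜] V} {μ : V →ₗ[𝕜] V →ₗ[𝕜] V} {D : Packets 𝒱 →ₗ[𝕜] Packets 𝒱}
    (hD : ∀ s, D ((shuffles 𝒱).mkQ s) = (shuffles 𝒱).mkQ (tensorD 𝒱 d μ s))
    (s : TensorAlgebra 𝕜 V) :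
    kap 𝒱 (tensorD 𝒱 d μ s) = der (packetGrading 𝒱) 1 D (kap 𝒱 s) := by
  suffices kap 𝒱 ∘ₗ tensorD 𝒱 d μ = der (packetGrading 𝒱) 1 D ∘ₗ kap 𝒱 from
    LinearMap.congr_fun this s
  refine hom_ext (𝒢 := tensorGrading 𝒱) fun m s hs => ?_
  simp only [LinearMap.comp_apply, kap]
  rw [cut_tensorD d μ hs]
  generalize cut s = σ
  induction σ using tensor_induction (tensorGrading 𝒱) (tensorGrading 𝒱) with
  | zero => simp
  | add x y hx hy => simp only [map_add] at hx hy ⊢; rw [← hx, ← hy]; abel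
  | tmul m s hs n t ht =>
    rw [TensorProduct.map_tmul, TensorProduct.map_tmul (shuffles 𝒱).mkQ, der_tmul D (mkQ_mem hs),
      hD, hD]
    simp [pw_apply _ hs, TensorProduct.smul_tmul']

section Bracket

variable {ℓ : V →ₗ[𝕜] V →ₗ[𝕜] V} {L : Packets 𝒱 →ₗ[𝕜] Packets 𝒱 →ₗ[𝕜] Packets 𝒱}
  (hL : ∀ s t, L ((shuffles 𝒱).mkQ s) ((shuffles 𝒱).mkQ t) = (shuffles 𝒱).mkQ (shBr 𝒱 c ℓ s t))

include hL in
-- The shuffle of the suffixes survives only if one of them is scalar, in which case the other word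
-- is cut and the uncut word is bracketed with its prefix.
theorem mkQ₂_cross_shBr_sh (s : TensorAlgebra 𝕜 V) (ht : t ∈ tensorGrading 𝒱 n) :
    mkQ₂ 𝒱 (cross 𝒱 (shBr 𝒱 c ℓ) (sh 𝒱) 0 (cut t) (cut s)) =
      (L ((shuffles 𝒱).mkQ s)).rTensor _ (kap 𝒱 t) +
      (L.flip ((shuffles 𝒱).mkQ t)).rTensor _
        ((pw (packetGrading 𝒱) n).lTensor _ (kap 𝒱 s)) := by
  -- The sign in the second term depends on the degree of `t`; `Ω` extends this term linearly, so
  -- that it can be evaluated on the contraction of an arbitrary `τ`.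
  let Ω : TensorAlgebra 𝕜 V →ₗ[𝕜] Packets 𝒱 ⊗[𝕜] Packets 𝒱 := gradedLift (tensorGrading 𝒱) fun n =>
    (LinearMap.rTensorHom (Packets 𝒱) ∘ₗ L.flip ∘ₗ (shuffles 𝒱).mkQ).flip
      ((pw (packetGrading 𝒱) n).lTensor _ (kap 𝒱 s))
  have hΩ {n t} (ht : t ∈ tensorGrading 𝒱 n) : Ω t = (L.flip ((shuffles 𝒱).mkQ t)).rTensor _
        ((pw (packetGrading 𝒱) n).lTensor _ (kap 𝒱 s)) := gradedLift_apply _ ht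
  suffices ∀ τ, mkQ₂ 𝒱 (cross 𝒱 (shBr 𝒱 c ℓ) (sh 𝒱) 0 τ (cut s)) =
      (L ((shuffles 𝒱).mkQ s)).rTensor _ (mkQ₂ 𝒱 τ) +
        Ω (TensorProduct.rid 𝕜 _ (eps.lTensor _ τ)) by
    rw [this, lTensor_eps_cut, hΩ ht]; rfl
  intro τ
  induction τ using tensor_induction (tensorGrading 𝒱) (tensorGrading 𝒱) with
  | zero => simp
  | add x y hx hy => simp only [map_add, LinearMap.add_apply, hx, hy]; abel
  | tmul n t ht n' t' ht' =>
    have key (σ : TensorAlgebra 𝕜 V ⊗[𝕜] TensorAlgebra 𝕜 V) :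
        mkQ₂ 𝒱 (cross 𝒱 (shBr 𝒱 c ℓ) (sh 𝒱) 0 (t ⊗ₜ t') σ) =
        L ((shuffles 𝒱).mkQ (TensorProduct.rid 𝕜 _ (eps.lTensor _ σ))) ((shuffles 𝒱).mkQ t) ⊗ₜ
          (shuffles 𝒱).mkQ t' +
        eps t' • (L.flip ((shuffles 𝒱).mkQ t)).rTensor _
          ((pw (packetGrading 𝒱) n).lTensor _ (mkQ₂ 𝒱 σ)) := by
      induction σ using tensor_induction (tensorGrading 𝒱) (tensorGrading 𝒱) with
      | zero => simp
      | add x y hx hy =>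
        simp only [map_add, LinearMap.add_apply, hx, hy, TensorProduct.add_tmul]
        module
      | tmul k s hs k' s' hs' =>
        rw [cross_tmul _ _ _ hs hs' ht, map_smul, TensorProduct.map_tmul, mkQ_sh, ← hL]
        have e₁ (x : Packets 𝒱 ⊗[𝕜] Packets 𝒱) := sg_smul_eps hs' n x
        simp only [zero_mul, add_zero, LinearMap.lTensor_tmul, LinearMap.rTensor_tmul,
          TensorProduct.rid_tmul, map_smul, pw_mkQ, pw_apply _ hs', LinearMap.smul_apply,
          TensorProduct.map_tmul, mul_comm n k', TensorProduct.tmul_add, LinearMap.flip_apply,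
          ← TensorProduct.smul_tmul', TensorProduct.tmul_smul, smul_add]
        rw [e₁, smul_comm (sg 𝕜 (k' * n))]
    rw [key, lTensor_eps_cut, LinearMap.lTensor_tmul, TensorProduct.rid_tmul, map_smul, hΩ ht]
    simp [kap]

include hL in
-- The mirror case: one of the prefixes is scalar, and the bracket acts on the suffixes.
theorem mkQ₂_cross_sh_shBr (hs : s ∈ tensorGrading 𝒱 m) (t : TensorAlgebra 𝕜 V) :
    mkQ₂ 𝒱 (cross 𝒱 (sh 𝒱) (shBr 𝒱 c ℓ) c (cut t) (cut s)) =
      TensorProduct.map (pw (packetGrading 𝒱) (m + c)) (L ((shuffles 𝒱).mkQ s)) (kap 𝒱 t) +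
      TensorProduct.map (pw (packetGrading 𝒱) c) (L.flip ((shuffles 𝒱).mkQ t)) (kap 𝒱 s) := by
  let Ω : TensorAlgebra 𝕜 V →ₗ[𝕜] Packets 𝒱 ⊗[𝕜] Packets 𝒱 :=
    (LinearMap.lTensorHom (Packets 𝒱) ∘ₗ L.flip ∘ₗ (shuffles 𝒱).mkQ).flip
      ((pw (packetGrading 𝒱) c).rTensor _ (kap 𝒱 s))
  have hΩ (t) : Ω t = TensorProduct.map (pw (packetGrading 𝒱) c) (L.flip ((shuffles 𝒱).mkQ t))
      (kap 𝒱 s) := by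
    simp only [Ω, LinearMap.flip_apply, LinearMap.comp_apply, LinearMap.coe_lTensorHom,
      ← LinearMap.lTensor_comp_rTensor]
  suffices ∀ τ, mkQ₂ 𝒱 (cross 𝒱 (sh 𝒱) (shBr 𝒱 c ℓ) c τ (cut s)) =
      TensorProduct.map (pw (packetGrading 𝒱) (m + c)) (L ((shuffles 𝒱).mkQ s)) (mkQ₂ 𝒱 τ) +
        Ω (TensorProduct.lid 𝕜 _ (eps.rTensor _ τ)) by
    rw [this, rTensor_eps_cut, hΩ]; rfl
  intro τ
  induction τ using tensor_induction (tensorGrading 𝒱) (tensorGrading 𝒱) with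
  | zero => simp
  | add x y hx hy => simp only [map_add, LinearMap.add_apply, hx, hy]; abel
  | tmul n t ht n' t' ht' =>
    have key (σ : TensorAlgebra 𝕜 V ⊗[𝕜] TensorAlgebra 𝕜 V) :
        mkQ₂ 𝒱 (cross 𝒱 (sh 𝒱) (shBr 𝒱 c ℓ) c (t ⊗ₜ t') σ) =
        sg 𝕜 (c * n) • (shuffles 𝒱).mkQ t ⊗ₜ L ((shuffles 𝒱).mkQ (pw (tensorGrading 𝒱) n
          (TensorProduct.lid 𝕜 _ (eps.rTensor _ σ)))) ((shuffles 𝒱).mkQ t') +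
        eps t • TensorProduct.map (pw (packetGrading 𝒱) c) (L.flip ((shuffles 𝒱).mkQ t'))
          (mkQ₂ 𝒱 σ) := by
      induction σ using tensor_induction (tensorGrading 𝒱) (tensorGrading 𝒱) with
      | zero => simp
      | add x y hx hy =>
        simp only [map_add, LinearMap.add_apply, hx, hy, TensorProduct.tmul_add]
        module
      | tmul k s hs k' s' hs' =>
        rw [cross_tmul _ _ _ hs hs' ht, map_smul, TensorProduct.map_tmul, mkQ_sh, ← hL]
        have e₁ (x : Packets 𝒱 ⊗[𝕜] Packets 𝒱) := sg_smul_eps hs c x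
        have e₂ (x : Packets 𝒱 ⊗[𝕜] Packets 𝒱) := sg_smul_eps ht (k' + c) x
        simp only [LinearMap.rTensor_tmul, TensorProduct.add_tmul,
          TensorProduct.lid_tmul, map_smul, pw_mkQ, pw_apply _ hs', pw_apply _ hs,
          LinearMap.smul_apply, TensorProduct.map_tmul, LinearMap.flip_apply,
          ← TensorProduct.smul_tmul', TensorProduct.tmul_smul, smul_add]
        rw [show k' * n + c * (k + n) = k * c + (k' * n + c * n) by ring, sg_add, mul_smul,
          smul_comm (sg 𝕜 (k * c)), e₁, sg_add (k' * n), mul_smul]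
        rw [← e₂ (sg 𝕜 (c * k) • _)]
        match_scalars <;> simp only [mul_one, ← sg_add, ← mul_assoc]
        all_goals
          rw [mul_right_comm, ← sg_add]
          congr 1
          exact sg_congr (by clear * -; grind)
    rw [key, rTensor_eps_cut, LinearMap.rTensor_tmul, TensorProduct.lid_tmul, map_smul, hΩ,
      pw_apply _ hs]
    simp only [kap, LinearMap.comp_apply, TensorProduct.map_tmul, pw_mkQ, pw_apply _ ht, map_smul,
      LinearMap.smul_apply, TensorProduct.tmul_smul, ← TensorProduct.smul_tmul']
    congr 1
    rw [smul_smul, ← sg_add]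
    congr 1
    exact sg_congr (by clear * -; grind)

include hL in
theorem packetBr_symm
    (hℓ : ∀ i j, ∀ v ∈ 𝒱 i, ∀ w ∈ 𝒱 j, ℓ v w = sg 𝕜 (i * j + c + 1) • ℓ w v) {x y : Packets 𝒱}
    (hx : x ∈ packetGrading 𝒱 m) (hy : y ∈ packetGrading 𝒱 n) :
    L x y = sg 𝕜 (m * n + c + 1) • L y x := by
  rw [packetGrading_eq_map] at hx hy
  obtain ⟨s, hs, rfl⟩ := hx
  obtain ⟨t, ht, rfl⟩ := hy
  rw [hL, hL, shBr_symm hℓ hs ht, map_smul]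

include hL in
theorem packetBr_mem (hℓ : ∀ i j, ∀ v ∈ 𝒱 i, ∀ w ∈ 𝒱 j, ℓ v w ∈ 𝒱 (i + j + c)) {x y : Packets 𝒱}
    (hx : x ∈ packetGrading 𝒱 m) (hy : y ∈ packetGrading 𝒱 n) :
    L x y ∈ packetGrading 𝒱 (m + n + c) := by
  rw [packetGrading_eq_map] at hx hy
  obtain ⟨s, hs, rfl⟩ := hx
  obtain ⟨t, ht, rfl⟩ := hy
  rw [hL]
  exact mkQ_mem (shBr_mem hℓ hs ht)

omit hL in
theorem pw_kap (hs : s ∈ tensorGrading 𝒱 m) (j : ℤ) :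
    TensorProduct.map (pw (packetGrading 𝒱) j) (pw (packetGrading 𝒱) j) (kap 𝒱 s) =
      sg 𝕜 (j * m) • kap 𝒱 s := by
  have h : pw (packetGrading 𝒱) j ∘ₗ (shuffles 𝒱).mkQ = (shuffles 𝒱).mkQ ∘ₗ pw (tensorGrading 𝒱) j :=
    LinearMap.ext fun s => pw_mkQ j s
  rw [kap, LinearMap.comp_apply, ← map_smul, ← pw_cut hs, ← LinearMap.comp_apply,
    ← TensorProduct.map_comp, h, TensorProduct.map_comp]
  rfl

include hL in
-- Four terms survive. Those that bracket `s` with the prefix or the suffix of `t` form the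
-- derivation by `s` of the cut of `t`; the other two form the derivation by `t` of the cut of `s`.
-- This is the cocycle condition before antisymmetrization.
theorem kap_shBr (hℓ : ∀ i j, ∀ v ∈ 𝒱 i, ∀ w ∈ 𝒱 j, ℓ v w = sg 𝕜 (i * j + c + 1) • ℓ w v)
    (hs : s ∈ tensorGrading 𝒱 m) (ht : t ∈ tensorGrading 𝒱 n) :
    kap 𝒱 (shBr 𝒱 c ℓ s t) =
      der (packetGrading 𝒱) (m + c) (L ((shuffles 𝒱).mkQ s)) (kap 𝒱 t) -
      sg 𝕜 (m * n + c) •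
        der (packetGrading 𝒱) (n + c) (L ((shuffles 𝒱).mkQ t)) (kap 𝒱 s) := by
  -- In two of the terms `t` acts from the right; the symmetry of the bracket makes it act from the
  -- left.
  have hflip : L.flip ((shuffles 𝒱).mkQ t) =
      sg 𝕜 (c + 1) • (L ((shuffles 𝒱).mkQ t) ∘ₗ pw (packetGrading 𝒱) n) := by
    refine hom_ext (𝒢 := packetGrading 𝒱) fun i x hx => ?_
    rw [LinearMap.flip_apply, packetBr_symm hL hℓ hx (mkQ_mem ht), LinearMap.smul_apply,
      LinearMap.comp_apply, pw_apply _ hx, map_smul, smul_smul, ← sg_add]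
    congr 1
    exact sg_congr (by clear * -; grind)
  have hpw : pw (packetGrading 𝒱) (n + c) ∘ₗ pw (packetGrading 𝒱) n = pw (packetGrading 𝒱) c := by
    refine LinearMap.ext fun x => ?_
    rw [LinearMap.comp_apply, pw_pw, show n + c + n = n + n + c by ring, ← pw_pw, pw_even]
  have e₁ : TensorProduct.map (pw (packetGrading 𝒱) (n + c)) (L ((shuffles 𝒱).mkQ t)) (kap 𝒱 s) =
      sg 𝕜 (n * m) • TensorProduct.map (pw (packetGrading 𝒱) c)
        (L ((shuffles 𝒱).mkQ t) ∘ₗ pw (packetGrading 𝒱) n) (kap 𝒱 s) := by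
    rw [← hpw, TensorProduct.map_comp, LinearMap.comp_apply, pw_kap hs, map_smul, smul_smul,
      sg_mul_self, one_smul]
  have e₂ : ((L ((shuffles 𝒱).mkQ t)) ∘ₗ pw (packetGrading 𝒱) n).rTensor _
      ((pw (packetGrading 𝒱) n).lTensor _ (kap 𝒱 s)) =
        sg 𝕜 (n * m) • (L ((shuffles 𝒱).mkQ t)).rTensor _ (kap 𝒱 s) := by
    rw [← map_smul, ← pw_kap hs, LinearMap.rTensor_comp_apply, ← LinearMap.comp_apply
      (f := LinearMap.rTensor _ (pw (packetGrading 𝒱) n)), LinearMap.rTensor_comp_lTensor]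
  rw [show kap 𝒱 (shBr 𝒱 c ℓ s t) = mkQ₂ 𝒱 (cut (shBr 𝒱 c ℓ s t)) from rfl, cut_shBr hs ht, map_add,
    mkQ₂_cross_shBr_sh hL s ht,
    mkQ₂_cross_sh_shBr hL hs t, hflip, LinearMap.rTensor_smul, TensorProduct.map_smul_right,
    LinearMap.smul_apply, LinearMap.smul_apply, e₂, der, der, LinearMap.add_apply,
    LinearMap.add_apply, e₁]
  match_scalars <;> simp only [mul_one, ← sg_add, neg_sg] <;> first | rfl | refine sg_congr ?_ <;>
    clear * - <;> grind

end Bracket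

variable (𝒱) in
/-- The antisymmetrized cut of a word into two packets, for the degrees shifted by `k`. -/
noncomputable def kapAnti (k : ℤ) : TensorAlgebra 𝕜 V →ₗ[𝕜] Packets 𝒱 ⊗[𝕜] Packets 𝒱 :=
  (LinearMap.id - sg 𝕜 k • braid (shift (packetGrading 𝒱) k)) ∘ₗ
    (pw (shift (packetGrading 𝒱) k) k).rTensor _ ∘ₗ kap 𝒱

omit [Internal 𝒱] in
theorem mkQ_mem_shift (hs : s ∈ tensorGrading 𝒱 m) (k : ℤ) :
    (shuffles 𝒱).mkQ s ∈ shift (packetGrading 𝒱) k (m - k) := by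
  rw [shift, sub_add_cancel]; exact mkQ_mem hs

variable (𝒱) in
-- By `kap_sh` the cut of a shuffle is symmetric for the original degrees. The twist by `pw` adapts
-- this to the shifted degrees, so subtracting the signed braiding gives zero.
theorem exists_packetCobracket (k : ℤ) : ∃ δ : Packets 𝒱 →ₗ[𝕜] Packets 𝒱 ⊗[𝕜] Packets 𝒱,
    ∀ s, δ ((shuffles 𝒱).mkQ s) = kapAnti 𝒱 k s := by
  refine ⟨(shuffles 𝒱).liftQ (kapAnti 𝒱 k) fun s hs => ?_, fun s => rfl⟩
  rw [LinearMap.mem_ker]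
  refine shuffles_induction (p := fun s => kapAnti 𝒱 k s = 0)
    (by simp) (fun s t hs ht => by rw [map_add, hs, ht, add_zero])
    (fun c s hs => by rw [map_smul, hs, smul_zero]) ?_ ?_ hs
  · rw [kapAnti, LinearMap.comp_apply, LinearMap.comp_apply, kap, LinearMap.comp_apply, cut_one,
      TensorProduct.map_tmul, mkQ_one, TensorProduct.zero_tmul, map_zero, map_zero]
  · intro m n s t hs ht hs' ht'
    have hs := mkQ_mem_shift hs k
    have ht := mkQ_mem_shift ht k
    rw [kapAnti, LinearMap.comp_apply, LinearMap.comp_apply, kap_sh ‹_› ‹_› hs' ht', map_add,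
      map_smul, LinearMap.rTensor_tmul, LinearMap.rTensor_tmul, pw_apply _ hs, pw_apply _ ht,
      ← TensorProduct.smul_tmul', ← TensorProduct.smul_tmul', LinearMap.sub_apply,
      LinearMap.smul_apply]
    simp only [map_add, map_smul]
    rw [braid_tmul hs ht, braid_tmul ht hs, LinearMap.id_apply]
    match_scalars <;> simp only [mul_one, ← sg_add] <;> refine sub_eq_zero.2 (sg_congr ?_) <;>
      clear * - <;> simp only [Int.even_sub, Int.even_add, Int.even_mul] <;> grind

end Kappa

/-! ### Compatibility of the cobracket of packets with the differential and the bracket. -/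

section Shifted

universe u

variable {𝕜 : Type*} [Field 𝕜] {V : Type u} [AddCommGroup V] [Module 𝕜 V]
  {𝒱 : ℤ → Submodule 𝕜 V} [Internal 𝒱] {i j k m n p c : ℤ} {x y : Packets 𝒱}
  {δ : Packets 𝒱 →ₗ[𝕜] Packets 𝒱 ⊗[𝕜] Packets 𝒱}
  (hδ : ∀ s, δ ((shuffles 𝒱).mkQ s) = kapAnti 𝒱 k s)

include hδ

/-- The terms of `δ x` have total shifted degree `i - k`, because the shift now counts twice; its
parity is that of `i + k`. -/
theorem pw_packetCobracket (hx : x ∈ shift (packetGrading 𝒱) k i) (j : ℤ) :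
    TensorProduct.map (pw (shift (packetGrading 𝒱) k) j) (pw (shift (packetGrading 𝒱) k) j) (δ x) =
      sg 𝕜 (j * (i + k)) • δ x := by
  rw [shift, packetGrading_eq_map] at hx
  obtain ⟨s, hs, rfl⟩ := hx
  have h := pw_kap hs j
  rw [pw_shift k j, TensorProduct.map_smul_left, TensorProduct.map_smul_right, smul_smul,
    sg_mul_self, one_smul] at h
  have h' (z) : TensorProduct.map (pw (shift (packetGrading 𝒱) k) j)
      (pw (shift (packetGrading 𝒱) k) j) ((pw (shift (packetGrading 𝒱) k) k).rTensor _ z) =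
      (pw (shift (packetGrading 𝒱) k) k).rTensor _ (TensorProduct.map
        (pw (shift (packetGrading 𝒱) k) j) (pw (shift (packetGrading 𝒱) k) j) z) := by
    rw [← LinearMap.comp_apply, ← LinearMap.comp_apply, LinearMap.map_comp_rTensor,
      LinearMap.rTensor_comp_map]
    congr 2
    refine LinearMap.ext fun x => ?_
    rw [LinearMap.comp_apply, LinearMap.comp_apply, pw_pw, pw_pw, add_comm]
  rw [hδ, kapAnti, LinearMap.comp_apply, LinearMap.comp_apply, LinearMap.sub_apply,
    LinearMap.smul_apply, LinearMap.id_apply, map_sub, map_smul, ← braid_pw, h', h, map_smul,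
    map_smul]
  module

/-- The derivation by `D` commutes with the braiding and, up to the sign `(-1)^k`, with the twist,
so `kap_tensorD` passes to the antisymmetrized cut. -/
theorem der_packetCobracket {d : V →ₗ[𝕜] V} {μ : V →ₗ[𝕜] V →ₗ[𝕜] V}
    {D : Packets 𝒱 →ₗ[𝕜] Packets 𝒱}
    (hD : ∀ s, D ((shuffles 𝒱).mkQ s) = (shuffles 𝒱).mkQ (tensorD 𝒱 d μ s))
    (hD' : HasDegree (shift (packetGrading 𝒱) k) 1 D) (x : Packets 𝒱) :
    der (shift (packetGrading 𝒱) k) 1 D (δ x) = sg 𝕜 k • δ (D x) := by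
  obtain ⟨s, rfl⟩ := (shuffles 𝒱).mkQ_surjective x
  rw [hD, hδ, hδ, kapAnti, LinearMap.comp_apply, LinearMap.comp_apply, LinearMap.comp_apply,
    LinearMap.comp_apply, kap_tensorD hD, rTensor_pw_der k hD', LinearMap.sub_apply,
    LinearMap.sub_apply, LinearMap.smul_apply, LinearMap.smul_apply, LinearMap.id_apply,
    LinearMap.id_apply, map_sub, map_smul, map_smul, ← braid_der hD']
  simp only [smul_sub, smul_smul, mul_one, sg_mul_self, one_smul]

/-- Derivations by `L x` and `L y` commute with the braiding and, up to sign, with the twist, so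
`kap_shBr` passes to the antisymmetrized cut. The degree of `L x` is `(i + k) + (1 - k)`. -/
theorem packetCobracket_br {ℓ : V →ₗ[𝕜] V →ₗ[𝕜] V}
    {L : Packets 𝒱 →ₗ[𝕜] Packets 𝒱 →ₗ[𝕜] Packets 𝒱} (hL : ∀ s t,
      L ((shuffles 𝒱).mkQ s) ((shuffles 𝒱).mkQ t) = (shuffles 𝒱).mkQ (shBr 𝒱 (1 - k) ℓ s t))
    (hℓ : ∀ i j, ∀ v ∈ 𝒱 i, ∀ w ∈ 𝒱 j, ℓ v w ∈ 𝒱 (i + j + (1 - k)))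
    (hℓc : ∀ i j, ∀ v ∈ 𝒱 i, ∀ w ∈ 𝒱 j, ℓ v w = sg 𝕜 (i * j + (1 - k) + 1) • ℓ w v)
    (hx : x ∈ shift (packetGrading 𝒱) k i) (hy : y ∈ shift (packetGrading 𝒱) k j) :
    δ (L x y) = sg 𝕜 (k * (i + 1)) • der (shift (packetGrading 𝒱) k) (i + 1) (L x) (δ y) -
      sg 𝕜 ((i + k) * (j + k) + 1 - k + k * (j + 1)) •
        der (shift (packetGrading 𝒱) k) (j + 1) (L y) (δ x) := by
  have hdeg {i x} (hx : x ∈ shift (packetGrading 𝒱) k i) :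
      HasDegree (shift (packetGrading 𝒱) k) (i + 1) (L x) := by
    intro t z hz
    rw [shift] at hx hz ⊢
    rw [show t + (i + 1) + k = (i + k) + (t + k) + (1 - k) by ring]
    exact packetBr_mem hL hℓ hx hz
  have hx' := hdeg hx
  have hy' := hdeg hy
  rw [shift, packetGrading_eq_map] at hx hy
  obtain ⟨s, hs, rfl⟩ := hx
  obtain ⟨t, ht, rfl⟩ := hy
  rw [hL, hδ, hδ, hδ]
  simp only [kapAnti, LinearMap.comp_apply]
  rw [kap_shBr hL hℓc hs ht, show i + k + (1 - k) = i + 1 by ring,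
    show j + k + (1 - k) = j + 1 by ring]
  simp only [map_sub, map_smul, LinearMap.sub_apply, LinearMap.smul_apply, LinearMap.id_apply]
  rw [rTensor_pw_der k hx', rTensor_pw_der k hy']
  simp only [map_smul, braid_der hx', braid_der hy']
  match_scalars <;> simp only [mul_one, ← sg_add, neg_sg] <;> first | rfl | refine sg_congr ?_ <;>
    clear * - <;> grind

end Shifted

end ABAlg

namespace ABAlg

/-! ### The graded symmetric algebra with unit, and recursion on the first factor. -/

section SymHat

universe u

variable {𝕜 : Type*} [Field 𝕜] {W : Type u} [AddCommGroup W] [Module 𝕜 W]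
  {M : Type*} [AddCommGroup M] [Module 𝕜 M] (𝒲 : ℤ → Submodule 𝕜 W)

/-- The span of the graded commutators in the tensor algebra. -/
def symRel : Submodule 𝕜 (TensorAlgebra 𝕜 W) :=
  Submodule.span 𝕜 {t | ∃ (u v : List W) (i j : ℤ) (x y : W), x ∈ 𝒲 i ∧ y ∈ 𝒲 j ∧
    t = word 𝕜 (u ++ x :: y :: v) - (i * j).negOnePow • word 𝕜 (u ++ y :: x :: v)}

/-- The graded symmetric algebra, with its unit. -/
abbrev SymHat : Type _ := TensorAlgebra 𝕜 W ⧸ symRel 𝒲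

/-- The grading of the symmetric algebra. -/
def hatGrading (t : ℤ) : Submodule 𝕜 (SymHat 𝒲) := (tensorGrading 𝒲 t).map (symRel 𝒲).mkQ

/-- The unit of the symmetric algebra. -/
def hatOne : SymHat 𝒲 := (symRel 𝒲).mkQ 1

theorem cons_mem_symRel (x : W) {t : TensorAlgebra 𝕜 W} (ht : t ∈ symRel 𝒲) :
    cons x t ∈ symRel 𝒲 := by
  induction ht using Submodule.span_induction with
  | zero => simp
  | add x y _ _ hx hy => rw [map_add]; exact add_mem hx hy
  | smul c x _ hx => rw [map_smul]; exact Submodule.smul_mem _ _ hx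
  | mem t ht =>
    obtain ⟨u, v, i, j, y, z, hy, hz, rfl⟩ := ht
    refine Submodule.subset_span ⟨x :: u, v, i, j, y, z, hy, hz, ?_⟩
    simp only [List.cons_append, word_cons', negOnePow_smul 𝕜, map_sub, map_smul]

/-- Multiplication by an element of `W` on the left. -/
noncomputable def hatMul : W →ₗ[𝕜] SymHat 𝒲 →ₗ[𝕜] SymHat 𝒲 :=
  LinearMap.mk₂ 𝕜 (fun x => (symRel 𝒲).mapQ (symRel 𝒲) (cons x)
      fun _ ht => cons_mem_symRel 𝒲 x ht)
    (fun x y t => by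
      obtain ⟨t, rfl⟩ := (symRel 𝒲).mkQ_surjective t
      simp [Submodule.mapQ_apply])
    (fun c x t => by
      obtain ⟨t, rfl⟩ := (symRel 𝒲).mkQ_surjective t
      simp [Submodule.mapQ_apply])
    (fun x s t => map_add _ s t) (fun c x t => map_smul _ c t)

variable {𝒲} {i j k m n r : ℤ} {x y z : W} {s t : SymHat 𝒲}

theorem hatMul_mkQ (x : W) (t : TensorAlgebra 𝕜 W) :
    hatMul 𝒲 x ((symRel 𝒲).mkQ t) = (symRel 𝒲).mkQ (cons x t) := rfl

theorem hatOne_mem : hatOne 𝒲 ∈ hatGrading 𝒲 0 := ⟨1, one_mem_tensorGrading, rfl⟩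

theorem hatMul_mem (hx : x ∈ 𝒲 i) (ht : t ∈ hatGrading 𝒲 m) :
    hatMul 𝒲 x t ∈ hatGrading 𝒲 (i + m) := by
  obtain ⟨t, ht, rfl⟩ := ht
  exact ⟨_, cons_mem hx ht, rfl⟩

theorem hatGrading_induction {p : ℤ → SymHat 𝒲 → Prop} (zero : ∀ m, p m 0)
    (add : ∀ m s t, p m s → p m t → p m (s + t)) (smul : ∀ m (c : 𝕜) s, p m s → p m (c • s))
    (one : p 0 (hatOne 𝒲))
    (mul : ∀ i x m t, x ∈ 𝒲 i → t ∈ hatGrading 𝒲 m → p m t → p (i + m) (hatMul 𝒲 x t))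
    (ht : t ∈ hatGrading 𝒲 m) : p m t := by
  obtain ⟨t, ht, rfl⟩ := ht
  exact tensorGrading_cons_induction (p := fun m t => p m ((symRel 𝒲).mkQ t))
    (fun m => by rw [map_zero]; exact zero m)
    (fun m s t hs ht => by rw [map_add]; exact add m _ _ hs ht)
    (fun m c s hs => by rw [map_smul]; exact smul m c _ hs) one
    (fun i x m t hx ht h => mul i x m _ hx ⟨t, ht, rfl⟩ h) ht

theorem hatMul_comm (hx : x ∈ 𝒲 i) (hy : y ∈ 𝒲 j) (t : SymHat 𝒲) :
    hatMul 𝒲 x (hatMul 𝒲 y t) = sg 𝕜 (i * j) • hatMul 𝒲 y (hatMul 𝒲 x t) := by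
  obtain ⟨t, rfl⟩ := (symRel 𝒲).mkQ_surjective t
  have ht : t ∈ (⊤ : Submodule 𝕜 _) := trivial
  rw [← word_span (𝕜 := 𝕜) (Set.univ : Set W) (by simp)] at ht
  induction ht using Submodule.span_induction with
  | zero => simp
  | add x y _ _ hx hy => simp only [map_add, smul_add, hx, hy]
  | smul c x _ hx => simp only [map_smul, hx]; rw [smul_comm]
  | mem t ht =>
    obtain ⟨l, -, rfl⟩ := ht
    simp only [hatMul_mkQ, ← word_cons']
    rw [← map_smul, ← sub_eq_zero, ← map_sub, Submodule.mkQ_apply, Submodule.Quotient.mk_eq_zero,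
      ← negOnePow_smul]
    exact Submodule.subset_span ⟨[], l, i, j, x, y, hx, hy, rfl⟩

variable [Internal 𝒲]

/-- The words around a commutator need not be homogeneous; splitting them into components shows that
the homogeneous relations span all of them. -/
theorem symRel_homogeneous : ∃ G : Set (TensorAlgebra 𝕜 W),
    (∀ x ∈ G, ∃ i, x ∈ tensorGrading 𝒲 i) ∧ symRel 𝒲 = Submodule.span 𝕜 G := by
  refine ⟨{t | ∃ (i : ℤ), t ∈ tensorGrading 𝒲 i ∧ t ∈ symRel 𝒲}, fun x ⟨i, hi, _⟩ => ⟨i, hi⟩,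
    le_antisymm (Submodule.span_le.2 ?_) (Submodule.span_le.2 fun t ⟨i, _, h⟩ => h)⟩
  rintro _ ⟨u, v, i, j, x, y, hx, hy, rfl⟩
  simp only [negOnePow_smul 𝕜]
  induction u with
  | nil =>
    have hv : word 𝕜 v ∈ ⨆ m, tensorGrading 𝒲 m := by rw [iSup_tensorGrading]; trivial
    simp only [List.nil_append]
    rw [word_cons', word_cons', word_cons', word_cons']
    have hmem (t : TensorAlgebra 𝕜 W) :
        cons x (cons y t) - sg 𝕜 (i * j) • cons y (cons x t) ∈ symRel 𝒲 := by
      rw [← Submodule.Quotient.mk_eq_zero, ← Submodule.mkQ_apply, map_sub, map_smul, ← hatMul_mkQ,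
        ← hatMul_mkQ, ← hatMul_mkQ, ← hatMul_mkQ, hatMul_comm hx hy, sub_self]
    generalize word 𝕜 v = t at hv
    induction hv using Submodule.iSup_induction' with
    | zero => simp
    | add s t _ _ hs ht =>
      refine SetLike.mem_coe.2 ?_
      convert add_mem (SetLike.mem_coe.1 hs) (SetLike.mem_coe.1 ht) using 1
      simp only [map_add, smul_add]
      abel
    | mem m t ht =>
      refine Submodule.subset_span ⟨i + j + m, sub_mem ?_ (Submodule.smul_mem _ _ ?_), hmem t⟩
      · rw [add_assoc]; exact cons_mem hx (cons_mem hy ht)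
      · rw [add_comm i j, add_assoc]; exact cons_mem hy (cons_mem hx ht)
  | cons w u ih =>
    rw [List.cons_append, List.cons_append, word_cons', word_cons', ← map_smul, ← map_sub]
    generalize word 𝕜 (u ++ x :: y :: v) - sg 𝕜 (i * j) • word 𝕜 (u ++ y :: x :: v) = t at ih
    have hw : w ∈ ⨆ m, 𝒲 m := by rw [iSup_eq_top 𝒲]; trivial
    induction ih using Submodule.span_induction with
    | zero => simp
    | add s t _ _ hs ht => rw [map_add]; exact add_mem hs ht
    | smul c s _ hs => rw [map_smul]; exact Submodule.smul_mem _ _ hs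
    | mem t ht =>
      obtain ⟨m, hm, ht⟩ := ht
      induction hw using Submodule.iSup_induction' with
      | zero => simp
      | add x y _ _ hx hy => rw [map_add]; exact add_mem hx hy
      | mem l w hw => exact Submodule.subset_span ⟨l + m, cons_mem hw hm, cons_mem_symRel 𝒲 w ht⟩

instance : Internal (hatGrading 𝒲) := by
  obtain ⟨G, hG, h⟩ := symRel_homogeneous (𝒲 := 𝒲)
  have := Internal.mkQ G hG
  rw [← h] at this
  exact this

/-- `hA` and `hB` say that the recursion agrees on `x y t` and `± y x t`. A commutator deeper in the
word is killed because `A` is already defined on the quotient and `B` is applied to zero. -/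
theorem exists_symRec (A : W →ₗ[𝕜] SymHat 𝒲 →ₗ[𝕜] M) (B : W →ₗ[𝕜] M →ₗ[𝕜] M) (m₀ : M)
    (hA : ∀ i j, ∀ x ∈ 𝒲 i, ∀ y ∈ 𝒲 j, ∀ m, ∀ t ∈ hatGrading 𝒲 m, A x (hatMul 𝒲 y t) + B x (A y t) =
      sg 𝕜 (i * j) • (A y (hatMul 𝒲 x t) + B y (A x t)))
    (hB : ∀ i j, ∀ x ∈ 𝒲 i, ∀ y ∈ 𝒲 j, ∀ m, B x (B y m) = sg 𝕜 (i * j) • B y (B x m)) :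
    ∃ f : SymHat 𝒲 →ₗ[𝕜] M, f (hatOne 𝒲) = m₀ ∧
      ∀ x t, f (hatMul 𝒲 x t) = A x t + B x (f t) := by
  let F : TensorAlgebra 𝕜 W →ₗ[𝕜] M := tensorRec (A.compl₂ (symRel 𝒲).mkQ) B m₀
  have hF (x t) : F (cons x t) = A x ((symRel 𝒲).mkQ t) + B x (F t) := tensorRec_ι_mul _ _ _ x t
  have hA' {i j x y} (hx : x ∈ 𝒲 i) (hy : y ∈ 𝒲 j) (t) : A x (hatMul 𝒲 y t) + B x (A y t) =
      sg 𝕜 (i * j) • (A y (hatMul 𝒲 x t) + B y (A x t)) := by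
    have : A x ∘ₗ hatMul 𝒲 y + B x ∘ₗ A y =
        sg 𝕜 (i * j) • (A y ∘ₗ hatMul 𝒲 x + B y ∘ₗ A x) :=
      hom_ext (𝒢 := hatGrading 𝒲) fun m t ht => hA i j x hx y hy m t ht
    exact LinearMap.congr_fun this t
  have hker : symRel 𝒲 ≤ LinearMap.ker F := by
    refine Submodule.span_le.2 ?_
    rintro _ ⟨u, v, i, j, x, y, hx, hy, rfl⟩
    rw [SetLike.mem_coe, LinearMap.mem_ker, negOnePow_smul 𝕜]
    induction u with
    | nil =>
      simp only [List.nil_append, word_cons', map_sub, map_smul, hF, map_add, ← hatMul_mkQ,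
        hB i j x hx y hy]
      have := hA' hx hy ((symRel 𝒲).mkQ (word 𝕜 v))
      rw [← add_assoc, this]
      module
    | cons w u ih =>
      have hmem : (symRel 𝒲).mkQ (word 𝕜 (u ++ x :: y :: v) -
          sg 𝕜 (i * j) • word 𝕜 (u ++ y :: x :: v)) = 0 := by
        rw [Submodule.mkQ_apply, Submodule.Quotient.mk_eq_zero, ← negOnePow_smul]
        exact Submodule.subset_span ⟨u, v, i, j, x, y, hx, hy, rfl⟩
      rw [List.cons_append, List.cons_append, word_cons', word_cons', ← map_smul, ← map_sub, hF, ih,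
        hmem, map_zero, map_zero, add_zero]
  refine ⟨(symRel 𝒲).liftQ F hker, tensorRec_one _ _ _, fun x t => ?_⟩
  obtain ⟨t, rfl⟩ := (symRel 𝒲).mkQ_surjective t
  exact hF x t

end SymHat

end ABAlg

namespace ABAlg

/-! ### Extension of derivations, brackets, coproduct and cobracket to the symmetric algebra. -/

section SymOperators

universe u

variable {𝕜 : Type*} [Field 𝕜] {W : Type u} [AddCommGroup W] [Module 𝕜 W]
  {𝒲 : ℤ → Submodule 𝕜 W} [Internal 𝒲] {i j k m n r l : ℤ} {x y z : W} {s t : SymHat 𝒲}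

theorem symHat_hom_ext {M : Type*} [AddCommGroup M] [Module 𝕜 M] {f g : SymHat 𝒲 →ₗ[𝕜] M}
    (one : f (hatOne 𝒲) = g (hatOne 𝒲))
    (mul : ∀ i, ∀ x ∈ 𝒲 i, ∀ m, ∀ t ∈ hatGrading 𝒲 m, f t = g t →
      f (hatMul 𝒲 x t) = g (hatMul 𝒲 x t)) : f = g := by
  refine hom_ext (𝒢 := hatGrading 𝒲) fun m t ht => ?_
  exact hatGrading_induction (p := fun m t => f t = g t) (fun m => by simp)
    (fun m s t hs ht => by simp [hs, ht]) (fun m c t ht => by simp [ht]) one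
    (fun i x m t hx ht h => mul i x hx m t ht h) ht

/-- `F` is the derivation of degree `r` of the symmetric algebra that extends `f`. -/
structure IsSymDer (r : ℤ) (f : W →ₗ[𝕜] W) (F : SymHat 𝒲 →ₗ[𝕜] SymHat 𝒲) : Prop where
  one : F (hatOne 𝒲) = 0
  mul : ∀ i, ∀ x ∈ 𝒲 i, ∀ t, F (hatMul 𝒲 x t) = hatMul 𝒲 (f x) t + sg 𝕜 (r * i) • hatMul 𝒲 x (F t)

omit [Internal 𝒲] in
theorem IsSymDer.degree {f : W →ₗ[𝕜] W} (hf : HasDegree 𝒲 r f) {F : SymHat 𝒲 →ₗ[𝕜] SymHat 𝒲}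
    (hF : IsSymDer r f F) : HasDegree (hatGrading 𝒲) r F := by
  intro m t ht
  refine hatGrading_induction (p := fun m t => F t ∈ hatGrading 𝒲 (m + r)) (by simp)
    (fun m s t hs ht => by rw [map_add]; exact add_mem hs ht)
    (fun m c t ht => by rw [map_smul]; exact Submodule.smul_mem _ _ ht) (by simp [hF.one]) ?_ ht
  intro i x m t hx ht h
  rw [hF.mul i x hx]
  refine add_mem ?_ (Submodule.smul_mem _ _ ?_)
  · rw [show i + m + r = i + r + m by ring]; exact hatMul_mem (hf _ _ hx) ht
  · rw [add_assoc]; exact hatMul_mem hx h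

theorem exists_symDer {f : W →ₗ[𝕜] W} (hf : HasDegree 𝒲 r f) :
    ∃ F : SymHat 𝒲 →ₗ[𝕜] SymHat 𝒲, IsSymDer r f F := by
  obtain ⟨F, h₁, h₂⟩ := exists_symRec (hatMul 𝒲 ∘ₗ f) (hatMul 𝒲 ∘ₗ pw 𝒲 r) (0 : SymHat 𝒲)
    (fun i j x hx y hy m t ht => by
      simp only [LinearMap.comp_apply, pw_apply _ hx, pw_apply _ hy, map_smul, LinearMap.smul_apply]
      rw [hatMul_comm (hf _ _ hx) hy, hatMul_comm hx (hf _ _ hy)]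
      match_scalars <;> simp only [mul_one, ← sg_add] <;> refine sg_congr ?_ <;> clear * - <;> grind)
    (fun i j x hx y hy m => by
      simp only [LinearMap.comp_apply, pw_apply _ hx, pw_apply _ hy, map_smul, LinearMap.smul_apply]
      rw [hatMul_comm hx hy]
      module)
  refine ⟨F, h₁, fun i x hx t => ?_⟩
  rw [h₂, LinearMap.comp_apply, LinearMap.comp_apply, pw_apply _ hx, map_smul, LinearMap.smul_apply]

variable {β : W →ₗ[𝕜] W →ₗ[𝕜] W}

/-- The recursion runs over the symmetric algebra with values in `W →ₗ[𝕜] SymHat 𝒲`, that is, for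
all `x` at once, so linearity in `x` is built in. -/
theorem exists_symAd (hβ : ∀ i j, ∀ x ∈ 𝒲 i, ∀ y ∈ 𝒲 j, β x y ∈ 𝒲 (i + j + 1)) :
    ∃ ad : W →ₗ[𝕜] SymHat 𝒲 →ₗ[𝕜] SymHat 𝒲, ∀ i, ∀ x ∈ 𝒲 i, IsSymDer (i + 1) (β x) (ad x) := by
  let B : W →ₗ[𝕜] (W →ₗ[𝕜] SymHat 𝒲) →ₗ[𝕜] (W →ₗ[𝕜] SymHat 𝒲) := gradedLift 𝒲 fun j =>
    sg 𝕜 j • LinearMap.mk₂ 𝕜 (fun y F => hatMul 𝒲 y ∘ₗ F ∘ₗ pw 𝒲 j)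
      (fun _ _ _ => by ext; simp) (fun _ _ _ => by ext; simp)
      (fun _ _ _ => by ext; simp) (fun _ _ _ => by ext; simp)
  have hB {i j y z} (hy : y ∈ 𝒲 j) (hz : z ∈ 𝒲 i) (F) :
      B y F z = sg 𝕜 ((i + 1) * j) • hatMul 𝒲 y (F z) := by
    simp only [B, gradedLift_apply _ hy, LinearMap.smul_apply, LinearMap.mk₂_apply,
      LinearMap.comp_apply, pw_apply _ hz, map_smul, smul_smul, ← sg_add]
    congr 1
    exact sg_congr (by clear * -; grind)
  let A : W →ₗ[𝕜] SymHat 𝒲 →ₗ[𝕜] (W →ₗ[𝕜] SymHat 𝒲) :=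
    LinearMap.mk₂ 𝕜 (fun y t => (hatMul 𝒲).flip t ∘ₗ β.flip y)
      (fun _ _ _ => by ext; simp) (fun _ _ _ => by ext; simp)
      (fun _ _ _ => by ext; simp) (fun _ _ _ => by ext; simp)
  have hA (y t z) : A y t z = hatMul 𝒲 (β z y) t := rfl
  obtain ⟨F, h₁, h₂⟩ := exists_symRec A B 0
    (fun i j x hx y hy m t ht => hom_ext (𝒢 := 𝒲) fun l z hz => by
      simp only [LinearMap.add_apply, LinearMap.smul_apply, hA, hB hx hz, hB hy hz]
      rw [hatMul_comm (hβ _ _ _ hz _ hx) hy, hatMul_comm hx (hβ _ _ _ hz _ hy)]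
      match_scalars <;> simp only [mul_one, ← sg_add] <;> refine sg_congr ?_ <;> clear * - <;> grind)
    (fun i j x hx y hy F => hom_ext (𝒢 := 𝒲) fun l z hz => by
      simp only [LinearMap.smul_apply, hB hx hz, hB hy hz, map_smul]
      rw [hatMul_comm hx hy]
      module)
  refine ⟨F.flip, fun i x hx => ⟨by rw [LinearMap.flip_apply, h₁]; rfl, fun j y hy t => ?_⟩⟩
  rw [LinearMap.flip_apply, h₂, LinearMap.add_apply, hA, hB hy hx]
  rfl

/-- `F` is the extension of the bracket `β` to the symmetric algebra. -/
structure IsSymBr (ad : W →ₗ[𝕜] SymHat 𝒲 →ₗ[𝕜] SymHat 𝒲) (F : SymHat 𝒲 →ₗ[𝕜] SymHat 𝒲) :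
    Prop where
  one : F (hatOne 𝒲) = 0
  mul : ∀ i, ∀ x ∈ 𝒲 i, ∀ t, F (hatMul 𝒲 x t) = ad x t + sg 𝕜 i • hatMul 𝒲 x (F t)

variable {ad : W →ₗ[𝕜] SymHat 𝒲 →ₗ[𝕜] SymHat 𝒲}

/-- Either order of the first two factors produces the term `β(x, y) t` once, and the two agree
because `β` is graded symmetric. -/
theorem exists_symBr
    (hβc : ∀ i j, ∀ x ∈ 𝒲 i, ∀ y ∈ 𝒲 j, β x y = sg 𝕜 (i * j) • β y x)
    (had : ∀ i, ∀ x ∈ 𝒲 i, IsSymDer (i + 1) (β x) (ad x)) :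
    ∃ F : SymHat 𝒲 →ₗ[𝕜] SymHat 𝒲, IsSymBr ad F := by
  obtain ⟨F, h₁, h₂⟩ := exists_symRec ad (hatMul 𝒲 ∘ₗ pw 𝒲 1) (0 : SymHat 𝒲)
    (fun i j x hx y hy m t ht => by
      simp only [LinearMap.comp_apply, pw_apply _ hx, pw_apply _ hy, map_smul, LinearMap.smul_apply]
      rw [(had i x hx).mul j y hy, (had j y hy).mul i x hx, hβc i j x hx y hy]
      simp only [map_smul, LinearMap.smul_apply]
      match_scalars <;> simp only [mul_one, ← sg_add] <;> refine sg_congr ?_ <;> clear * - <;> grind)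
    (fun i j x hx y hy m => by
      simp only [LinearMap.comp_apply, pw_apply _ hx, pw_apply _ hy, map_smul, LinearMap.smul_apply]
      rw [hatMul_comm hx hy]
      module)
  refine ⟨F, h₁, fun i x hx t => ?_⟩
  rw [h₂, LinearMap.comp_apply, pw_apply _ hx, map_smul, LinearMap.smul_apply, one_mul]

omit [Internal 𝒲] in
theorem IsSymBr.degree (hβ : ∀ i j, ∀ x ∈ 𝒲 i, ∀ y ∈ 𝒲 j, β x y ∈ 𝒲 (i + j + 1))
    (had : ∀ i, ∀ x ∈ 𝒲 i, IsSymDer (i + 1) (β x) (ad x)) {F : SymHat 𝒲 →ₗ[𝕜] SymHat 𝒲}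
    (hF : IsSymBr ad F) : HasDegree (hatGrading 𝒲) 1 F := by
  intro m t ht
  refine hatGrading_induction (p := fun m t => F t ∈ hatGrading 𝒲 (m + 1)) (by simp)
    (fun m s t hs ht => by rw [map_add]; exact add_mem hs ht)
    (fun m c t ht => by rw [map_smul]; exact Submodule.smul_mem _ _ ht) (by simp [hF.one]) ?_ ht
  intro i x m t hx ht h
  rw [hF.mul i x hx]
  refine add_mem ?_ (Submodule.smul_mem _ _ ?_)
  · rw [show i + m + 1 = m + (i + 1) by ring]
    refine (had i x hx).degree (fun j y hy => ?_) _ _ ht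
    rw [show j + (i + 1) = i + j + 1 by ring]; exact hβ _ _ _ hx _ hy
  · rw [add_assoc]; exact hatMul_mem hx h

variable (𝒲) in
/-- Multiplication by `x ⊗ 1 + 1 ⊗ x` on the left. -/
noncomputable def phi : W →ₗ[𝕜] SymHat 𝒲 ⊗[𝕜] SymHat 𝒲 →ₗ[𝕜] SymHat 𝒲 ⊗[𝕜] SymHat 𝒲 :=
  gradedLift 𝒲 fun i => LinearMap.mk₂ 𝕜 (fun x z => der (hatGrading 𝒲) i (hatMul 𝒲 x) z)
    (fun _ _ _ => by simp [der, LinearMap.rTensor_add, TensorProduct.map_add_right]; abel)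
    (fun _ _ _ => by simp [der, LinearMap.rTensor_smul, TensorProduct.map_smul_right])
    (fun _ _ _ => by simp) (fun _ _ _ => by simp)

theorem phi_apply (hx : x ∈ 𝒲 i) (z : SymHat 𝒲 ⊗[𝕜] SymHat 𝒲) :
    phi 𝒲 x z = der (hatGrading 𝒲) i (hatMul 𝒲 x) z := by
  rw [phi, gradedLift_apply _ hx]; rfl

theorem phi_tmul (hx : x ∈ 𝒲 i) (hs : s ∈ hatGrading 𝒲 m) (t : SymHat 𝒲) :
    phi 𝒲 x (s ⊗ₜ t) = hatMul 𝒲 x s ⊗ₜ t + sg 𝕜 (i * m) • s ⊗ₜ hatMul 𝒲 x t := by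
  rw [phi_apply hx, der_tmul _ hs]

variable (𝒲) in
/-- Multiplication by an element of `W ⊗ W` on the left. -/
noncomputable def mulTwo :
    W ⊗[𝕜] W →ₗ[𝕜] SymHat 𝒲 ⊗[𝕜] SymHat 𝒲 →ₗ[𝕜] SymHat 𝒲 ⊗[𝕜] SymHat 𝒲 :=
  TensorProduct.lift (gradedLift 𝒲 fun j => LinearMap.mk₂ 𝕜
    (fun y x => TensorProduct.map (hatMul 𝒲 x ∘ₗ pw (hatGrading 𝒲) j) (hatMul 𝒲 y))
    (fun _ _ _ => by simp [TensorProduct.map_add_right])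
    (fun _ _ _ => by simp [TensorProduct.map_smul_right])
    (fun _ _ _ => by simp [LinearMap.add_comp, TensorProduct.map_add_left])
    (fun _ _ _ => by simp [LinearMap.smul_comp, TensorProduct.map_smul_left])).flip

theorem mulTwo_tmul (x : W) (hy : y ∈ 𝒲 j) (hs : s ∈ hatGrading 𝒲 m) (t : SymHat 𝒲) :
    mulTwo 𝒲 (x ⊗ₜ y) (s ⊗ₜ t) = sg 𝕜 (j * m) • hatMul 𝒲 x s ⊗ₜ hatMul 𝒲 y t := by
  rw [mulTwo, TensorProduct.lift.tmul, LinearMap.flip_apply, gradedLift_apply _ hy]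
  simp [pw_apply _ hs, TensorProduct.smul_tmul']

theorem phi_comm (hx : x ∈ 𝒲 i) (hy : y ∈ 𝒲 j) (z : SymHat 𝒲 ⊗[𝕜] SymHat 𝒲) :
    phi 𝒲 x (phi 𝒲 y z) = sg 𝕜 (i * j) • phi 𝒲 y (phi 𝒲 x z) := by
  induction z using tensor_induction (hatGrading 𝒲) (hatGrading 𝒲) with
  | zero => simp
  | add s t hs ht => simp only [map_add, smul_add, hs, ht]
  | tmul m s hs n t ht =>
    rw [phi_tmul hx hs, phi_tmul hy hs, map_add, map_add, map_smul, map_smul, phi_tmul hx hs,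
      phi_tmul hy hs, phi_tmul hx (hatMul_mem hy hs), phi_tmul hy (hatMul_mem hx hs),
      hatMul_comm hx hy s, hatMul_comm hx hy t]
    simp only [← TensorProduct.smul_tmul', TensorProduct.tmul_smul]
    match_scalars <;> simp only [mul_one, ← sg_add] <;> refine sg_congr ?_ <;> clear * - <;> grind

theorem phi_mulTwo (hx : x ∈ 𝒲 i) {τ : W ⊗[𝕜] W} (z : SymHat 𝒲 ⊗[𝕜] SymHat 𝒲) :
    phi 𝒲 x (mulTwo 𝒲 τ z) =
      mulTwo 𝒲 (TensorProduct.map (pw 𝒲 i) (pw 𝒲 i) τ) (phi 𝒲 x z) := by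
  induction z using tensor_induction (hatGrading 𝒲) (hatGrading 𝒲) with
  | zero => simp
  | add s t hs ht => simp only [map_add, hs, ht]
  | tmul m s hs n t ht =>
    induction τ using tensor_induction 𝒲 𝒲 with
    | zero => simp
    | add x y hx hy => simp only [map_add, LinearMap.add_apply, hx, hy]
    | tmul k u hu l v hv =>
      rw [mulTwo_tmul u hv hs, map_smul, phi_tmul hx (hatMul_mem hu hs), phi_tmul hx hs, map_add,
        map_smul, TensorProduct.map_tmul, pw_apply _ hu, pw_apply _ hv, ← TensorProduct.smul_tmul',
        TensorProduct.tmul_smul, map_smul, map_smul, LinearMap.smul_apply, LinearMap.smul_apply,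
        LinearMap.smul_apply, LinearMap.smul_apply, mulTwo_tmul _ hv hs,
        mulTwo_tmul _ hv (hatMul_mem hx hs), hatMul_comm hx hu, hatMul_comm hx hv]
      simp only [← TensorProduct.smul_tmul', TensorProduct.tmul_smul]
      match_scalars <;> simp only [mul_one, ← sg_add] <;> refine sg_congr ?_ <;> clear * - <;> grind

variable (𝒲) in
/-- `F` is the unital coproduct of the symmetric algebra. -/
structure IsSymCoprod (F : SymHat 𝒲 →ₗ[𝕜] SymHat 𝒲 ⊗[𝕜] SymHat 𝒲) : Prop where
  one : F (hatOne 𝒲) = hatOne 𝒲 ⊗ₜ hatOne 𝒲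
  mul : ∀ x t, F (hatMul 𝒲 x t) = phi 𝒲 x (F t)

variable (𝒲) in
theorem exists_symCoprod : ∃ F, IsSymCoprod 𝒲 F := by
  obtain ⟨F, h₁, h₂⟩ := exists_symRec (𝒲 := 𝒲) 0 (phi 𝒲) (hatOne 𝒲 ⊗ₜ hatOne 𝒲) (by simp)
    fun i j x hx y hy z => phi_comm hx hy z
  exact ⟨F, h₁, fun x t => by rw [h₂]; simp⟩

/-- `F` is the extension of the cobracket `δ` of degree `k` to the symmetric algebra with
coproduct `Δ`. -/
structure IsSymCobr (k : ℤ) (δ : W →ₗ[𝕜] W ⊗[𝕜] W)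
    (Δ F : SymHat 𝒲 →ₗ[𝕜] SymHat 𝒲 ⊗[𝕜] SymHat 𝒲) : Prop where
  one : F (hatOne 𝒲) = 0
  mul : ∀ i, ∀ x ∈ 𝒲 i, ∀ t, F (hatMul 𝒲 x t) =
    mulTwo 𝒲 (δ x) (Δ t) + sg 𝕜 (k * i) • phi 𝒲 x (F t)

/-- Exchanging two factors moves `x ⊗ 1 + 1 ⊗ x` across `δ y`, with the sign provided by the parity
condition `hδ`. -/
theorem exists_symCobr {δ : W →ₗ[𝕜] W ⊗[𝕜] W}
    (hδ : ∀ i, ∀ x ∈ 𝒲 i, ∀ j, TensorProduct.map (pw 𝒲 j) (pw 𝒲 j) (δ x) = sg 𝕜 (j * (i + k)) • δ x)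
    {Δ : SymHat 𝒲 →ₗ[𝕜] SymHat 𝒲 ⊗[𝕜] SymHat 𝒲} (hΔ : IsSymCoprod 𝒲 Δ) :
    ∃ F, IsSymCobr k δ Δ F := by
  obtain ⟨F, h₁, h₂⟩ := exists_symRec ((mulTwo 𝒲 ∘ₗ δ).compl₂ Δ) (phi 𝒲 ∘ₗ pw 𝒲 k) 0
    (fun i j x hx y hy m t ht => by
      simp only [LinearMap.comp_apply, LinearMap.compl₂_apply, pw_apply _ hx, pw_apply _ hy,
        map_smul, LinearMap.smul_apply, hΔ.mul]
      rw [phi_mulTwo hx, phi_mulTwo hy, hδ i x hx, hδ j y hy]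
      simp only [map_smul, LinearMap.smul_apply]
      match_scalars <;> simp only [mul_one, ← sg_add]
      · refine (sg_zero (𝕜 := 𝕜)).symm.trans (sg_congr ?_)
        exact ⟨-(i * j + k * j), by ring⟩
      · exact sg_congr ⟨k * i, by ring⟩)
    (fun i j x hx y hy m => by
      simp only [LinearMap.comp_apply, pw_apply _ hx, pw_apply _ hy, map_smul, LinearMap.smul_apply]
      rw [phi_comm hx hy]
      module)
  refine ⟨F, h₁, fun i x hx t => ?_⟩
  rw [h₂, LinearMap.comp_apply, pw_apply _ hx, map_smul, LinearMap.smul_apply]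
  rfl

end SymOperators

end ABAlg

namespace ABAlg

/-! ### The coderivation identities on the symmetric algebra with unit. -/

section SymIdentities

universe u

variable {𝕜 : Type*} [Field 𝕜] {W : Type u} [AddCommGroup W] [Module 𝕜 W]
  {𝒲 : ℤ → Submodule 𝕜 W} [Internal 𝒲] {i j k m n r l : ℤ} {x y z : W} {s t : SymHat 𝒲}
  {f : W →ₗ[𝕜] W} {F : SymHat 𝒲 →ₗ[𝕜] SymHat 𝒲} {β : W →ₗ[𝕜] W →ₗ[𝕜] W}
  {ad : W →ₗ[𝕜] SymHat 𝒲 →ₗ[𝕜] SymHat 𝒲} {Δ : SymHat 𝒲 →ₗ[𝕜] SymHat 𝒲 ⊗[𝕜] SymHat 𝒲}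

theorem IsSymDer.der_phi (hf : HasDegree 𝒲 r f) (hF : IsSymDer r f F) (hx : x ∈ 𝒲 i)
    (z : SymHat 𝒲 ⊗[𝕜] SymHat 𝒲) : der (hatGrading 𝒲) r F (phi 𝒲 x z) =
      phi 𝒲 (f x) z + sg 𝕜 (r * i) • phi 𝒲 x (der (hatGrading 𝒲) r F z) := by
  induction z using tensor_induction (hatGrading 𝒲) (hatGrading 𝒲) with
  | zero => simp
  | add s t hs ht => simp only [map_add, hs, ht]; module
  | tmul m s hs n t ht =>
    rw [phi_tmul hx hs, phi_tmul (hf _ _ hx) hs, map_add, map_smul, der_tmul F hs t,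
      der_tmul F hs (hatMul 𝒲 x t), der_tmul F (hatMul_mem hx hs), map_add, map_smul, phi_tmul hx (hF.degree hf _ _ hs),
      phi_tmul hx hs, hF.mul i x hx, hF.mul i x hx]
    simp only [TensorProduct.add_tmul, TensorProduct.tmul_add, ← TensorProduct.smul_tmul',
      TensorProduct.tmul_smul]
    match_scalars <;> simp only [mul_one, ← sg_add] <;> refine sg_congr ?_ <;> clear * - <;> grind

/-- The graded commutator of `F` with multiplication by `x` is `ad x`, and this passes to the tensor
square. -/
theorem IsSymBr.der_phi (hβ : ∀ i j, ∀ x ∈ 𝒲 i, ∀ y ∈ 𝒲 j, β x y ∈ 𝒲 (i + j + 1))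
    (had : ∀ i, ∀ x ∈ 𝒲 i, IsSymDer (i + 1) (β x) (ad x)) (hF : IsSymBr ad F) (hx : x ∈ 𝒲 i)
    (z : SymHat 𝒲 ⊗[𝕜] SymHat 𝒲) : der (hatGrading 𝒲) 1 F (phi 𝒲 x z) =
      der (hatGrading 𝒲) (i + 1) (ad x) z +
        sg 𝕜 i • phi 𝒲 x (der (hatGrading 𝒲) 1 F z) := by
  induction z using tensor_induction (hatGrading 𝒲) (hatGrading 𝒲) with
  | zero => simp
  | add s t hs ht => simp only [map_add, hs, ht]; module
  | tmul m s hs n t ht =>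
    rw [phi_tmul hx hs, der_tmul (ad x) hs, map_add, map_smul, der_tmul F hs t,
      der_tmul F hs (hatMul 𝒲 x t), der_tmul F (hatMul_mem hx hs), map_add, map_smul, phi_tmul hx (hF.degree hβ had _ _ hs),
      phi_tmul hx hs, hF.mul i x hx, hF.mul i x hx]
    simp only [TensorProduct.add_tmul, TensorProduct.tmul_add, ← TensorProduct.smul_tmul',
      TensorProduct.tmul_smul]
    match_scalars <;> simp only [mul_one, ← sg_add] <;> refine sg_congr ?_ <;> clear * - <;> grind

theorem IsSymDer.coprod (hf : HasDegree 𝒲 r f) (hF : IsSymDer r f F) (hΔ : IsSymCoprod 𝒲 Δ)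
    (t : SymHat 𝒲) : Δ (F t) = der (hatGrading 𝒲) r F (Δ t) := by
  refine LinearMap.congr_fun (f := Δ ∘ₗ F) (g := der (hatGrading 𝒲) r F ∘ₗ Δ)
    (symHat_hom_ext ?_ fun i x hx m t ht h => ?_) t
  · simp [hF.one, hΔ.one, der_tmul F hatOne_mem]
  · simp only [LinearMap.comp_apply] at h ⊢
    rw [hF.mul i x hx, map_add, map_smul, hΔ.mul, hΔ.mul, hΔ.mul, h, hF.der_phi hf hx]

/-- The induction leaves the contribution of `ad x`, a derivation, to which `IsSymDer.coprod`
applies. -/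
theorem IsSymBr.coprod (hβ : ∀ i j, ∀ x ∈ 𝒲 i, ∀ y ∈ 𝒲 j, β x y ∈ 𝒲 (i + j + 1))
    (had : ∀ i, ∀ x ∈ 𝒲 i, IsSymDer (i + 1) (β x) (ad x)) (hF : IsSymBr ad F)
    (hΔ : IsSymCoprod 𝒲 Δ) (t : SymHat 𝒲) : Δ (F t) = der (hatGrading 𝒲) 1 F (Δ t) := by
  refine LinearMap.congr_fun (f := Δ ∘ₗ F) (g := der (hatGrading 𝒲) 1 F ∘ₗ Δ)
    (symHat_hom_ext ?_ fun i x hx m t ht h => ?_) t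
  · simp [hF.one, hΔ.one, der_tmul F hatOne_mem]
  · simp only [LinearMap.comp_apply] at h ⊢
    have hd : HasDegree 𝒲 (i + 1) (β x) := fun j y hy => by
      rw [show j + (i + 1) = i + j + 1 by ring]; exact hβ _ _ _ hx _ hy
    rw [hF.mul i x hx, map_add, map_smul, hΔ.mul, hΔ.mul, h, hF.der_phi hβ had hx,
      (had i x hx).coprod hd hΔ]

theorem IsSymDer.der_mulTwo (hf : HasDegree 𝒲 r f) (hF : IsSymDer r f F) (τ : W ⊗[𝕜] W)
    (z : SymHat 𝒲 ⊗[𝕜] SymHat 𝒲) : der (hatGrading 𝒲) r F (mulTwo 𝒲 τ z) =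
      mulTwo 𝒲 (der 𝒲 r f τ) z +
        mulTwo 𝒲 (TensorProduct.map (pw 𝒲 r) (pw 𝒲 r) τ) (der (hatGrading 𝒲) r F z) := by
  induction z using tensor_induction (hatGrading 𝒲) (hatGrading 𝒲) with
  | zero => simp
  | add s t hs ht => simp only [map_add, hs, ht]; abel
  | tmul m s hs n t ht =>
    induction τ using tensor_induction 𝒲 𝒲 with
    | zero => simp
    | add x y hx hy => simp only [map_add, LinearMap.add_apply, hx, hy]; abel
    | tmul k u hu l v hv =>
      rw [mulTwo_tmul u hv hs, map_smul, der_tmul f hu, der_tmul F hs,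
        der_tmul F (hatMul_mem hu hs), hF.mul k u hu, hF.mul l v hv, TensorProduct.map_tmul,
        pw_apply _ hu, pw_apply _ hv]
      simp only [TensorProduct.add_tmul, TensorProduct.tmul_add, ← TensorProduct.smul_tmul',
        TensorProduct.tmul_smul, map_add, map_smul, LinearMap.add_apply, LinearMap.smul_apply]
      rw [mulTwo_tmul _ hv hs, mulTwo_tmul _ hv hs, mulTwo_tmul _ (hf _ _ hv) hs,
        mulTwo_tmul _ hv (hF.degree hf _ _ hs)]
      match_scalars <;> simp only [mul_one, ← sg_add] <;> refine sg_congr ?_ <;> clear * - <;> grind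

/-- Moving `F` across `x ⊗ y` brackets `x` with `s` or `y` with `t`, but never `x` with `y`, which
lie in different tensor factors. -/
theorem IsSymBr.der_mulTwo (hβ : ∀ i j, ∀ x ∈ 𝒲 i, ∀ y ∈ 𝒲 j, β x y ∈ 𝒲 (i + j + 1))
    (had : ∀ i, ∀ x ∈ 𝒲 i, IsSymDer (i + 1) (β x) (ad x)) (hF : IsSymBr ad F) (hx : x ∈ 𝒲 i)
    (hy : y ∈ 𝒲 j) (hs : s ∈ hatGrading 𝒲 m) (t : SymHat 𝒲) :
    der (hatGrading 𝒲) 1 F (mulTwo 𝒲 (x ⊗ₜ y) (s ⊗ₜ t)) =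
      sg 𝕜 (i + j) • mulTwo 𝒲 (x ⊗ₜ y) (der (hatGrading 𝒲) 1 F (s ⊗ₜ t)) +
      sg 𝕜 (j * m) • ad x s ⊗ₜ hatMul 𝒲 y t +
      sg 𝕜 (i + (j + 1) * m) • hatMul 𝒲 x s ⊗ₜ ad y t := by
  rw [mulTwo_tmul x hy hs, map_smul, der_tmul F hs, map_add, map_smul, mulTwo_tmul _ hy hs,
    mulTwo_tmul _ hy (hF.degree hβ had _ _ hs), der_tmul F (hatMul_mem hx hs), hF.mul i x hx,
    hF.mul j y hy]
  simp only [TensorProduct.add_tmul, TensorProduct.tmul_add, ← TensorProduct.smul_tmul',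
    TensorProduct.tmul_smul]
  match_scalars <;> simp only [mul_one, ← sg_add] <;> refine sg_congr ?_ <;> clear * - <;> grind

variable (F) in
/-- The failure of `F` to commute with the multiplication by an element of `W ⊗ W`. -/
noncomputable def brTwo :
    W ⊗[𝕜] W →ₗ[𝕜] SymHat 𝒲 ⊗[𝕜] SymHat 𝒲 →ₗ[𝕜] SymHat 𝒲 ⊗[𝕜] SymHat 𝒲 :=
  LinearMap.mk₂ 𝕜 (fun τ z => der (hatGrading 𝒲) 1 F (mulTwo 𝒲 τ z) -
      mulTwo 𝒲 (TensorProduct.map (pw 𝒲 1) (pw 𝒲 1) τ) (der (hatGrading 𝒲) 1 F z))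
    (fun _ _ _ => by simp only [map_add, LinearMap.add_apply]; abel)
    (fun _ _ _ => by simp only [map_smul, LinearMap.smul_apply, smul_sub])
    (fun _ _ _ => by simp only [map_add]; abel) (fun _ _ _ => by simp only [map_smul, smul_sub])

theorem brTwo_apply (τ : W ⊗[𝕜] W) (z : SymHat 𝒲 ⊗[𝕜] SymHat 𝒲) :
    brTwo F τ z = der (hatGrading 𝒲) 1 F (mulTwo 𝒲 τ z) -
      mulTwo 𝒲 (TensorProduct.map (pw 𝒲 1) (pw 𝒲 1) τ) (der (hatGrading 𝒲) 1 F z) := rfl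

theorem brTwo_tmul (hβ : ∀ i j, ∀ x ∈ 𝒲 i, ∀ y ∈ 𝒲 j, β x y ∈ 𝒲 (i + j + 1))
    (had : ∀ i, ∀ x ∈ 𝒲 i, IsSymDer (i + 1) (β x) (ad x)) (hF : IsSymBr ad F) (hx : x ∈ 𝒲 i)
    (hy : y ∈ 𝒲 j) (hs : s ∈ hatGrading 𝒲 m) (t : SymHat 𝒲) :
    brTwo F (x ⊗ₜ y) (s ⊗ₜ t) = sg 𝕜 (j * m) • ad x s ⊗ₜ hatMul 𝒲 y t +
      sg 𝕜 (i + (j + 1) * m) • hatMul 𝒲 x s ⊗ₜ ad y t := by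
  rw [brTwo_apply, hF.der_mulTwo hβ had hx hy hs, TensorProduct.map_tmul, pw_apply _ hx,
    pw_apply _ hy, TensorProduct.smul_tmul_smul, map_smul, LinearMap.smul_apply, one_mul, one_mul,
    ← sg_add]
  abel

/-- Acting on a product by `y`, `brTwo` also brackets the components of `τ` with `y`; by symmetry of
`β` this is the derivation by `y` applied to `τ`. -/
theorem brTwo_phi (hβ : ∀ i j, ∀ x ∈ 𝒲 i, ∀ y ∈ 𝒲 j, β x y ∈ 𝒲 (i + j + 1))
    (hβc : ∀ i j, ∀ x ∈ 𝒲 i, ∀ y ∈ 𝒲 j, β x y = sg 𝕜 (i * j) • β y x)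
    (had : ∀ i, ∀ x ∈ 𝒲 i, IsSymDer (i + 1) (β x) (ad x)) (hF : IsSymBr ad F) (hy : y ∈ 𝒲 j)
    (τ : W ⊗[𝕜] W) (z : SymHat 𝒲 ⊗[𝕜] SymHat 𝒲) :
    brTwo F (TensorProduct.map (pw 𝒲 j) (pw 𝒲 j) τ) (phi 𝒲 y z) =
      mulTwo 𝒲 (der 𝒲 (j + 1) (β y) τ) z + sg 𝕜 j • phi 𝒲 y (brTwo F τ z) := by
  have hd {i x} (hx : x ∈ 𝒲 i) : HasDegree 𝒲 (i + 1) (β x) := fun j y hy => by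
    rw [show j + (i + 1) = i + j + 1 by ring]; exact hβ _ _ _ hx _ hy
  induction z using tensor_induction (hatGrading 𝒲) (hatGrading 𝒲) with
  | zero => simp
  | add s t hs ht => simp only [map_add, hs, ht, smul_add]; abel
  | tmul m s hs n t ht =>
    induction τ using tensor_induction 𝒲 𝒲 with
    | zero => simp
    | add x y hx hy => simp only [map_add, LinearMap.add_apply, hx, hy, smul_add]; abel
    | tmul k u hu l v hv =>
      rw [TensorProduct.map_tmul, pw_apply _ hu, pw_apply _ hv, TensorProduct.smul_tmul_smul,
        map_smul, LinearMap.smul_apply, phi_tmul hy hs, map_add, map_smul,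
        brTwo_tmul hβ had hF hu hv hs, brTwo_tmul hβ had hF hu hv hs,
        brTwo_tmul hβ had hF hu hv (hatMul_mem hy hs), der_tmul _ hu, map_add, map_smul,
        LinearMap.add_apply, LinearMap.smul_apply, mulTwo_tmul _ hv hs,
        mulTwo_tmul _ (hd hy _ _ hv) hs, map_add, map_smul, map_smul,
        phi_tmul hy ((had k u hu).degree (hd hu) _ _ hs), phi_tmul hy (hatMul_mem hu hs),
        (had k u hu).mul j y hy, (had l v hv).mul j y hy, hβc k j u hu y hy, hβc l j v hv y hy,
        hatMul_comm hy hu, hatMul_comm hy hv]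
      simp only [TensorProduct.add_tmul, TensorProduct.tmul_add, ← TensorProduct.smul_tmul',
        TensorProduct.tmul_smul, map_smul, LinearMap.smul_apply]
      match_scalars <;> simp only [mul_one, ← sg_add] <;> refine sg_congr ?_ <;> clear * - <;> grind

variable {δ : W →ₗ[𝕜] W ⊗[𝕜] W} {C : SymHat 𝒲 →ₗ[𝕜] SymHat 𝒲 ⊗[𝕜] SymHat 𝒲}
  (hδ : ∀ i, ∀ x ∈ 𝒲 i, ∀ j, TensorProduct.map (pw 𝒲 j) (pw 𝒲 j) (δ x) = sg 𝕜 (j * (i + k)) • δ x)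
  (hΔ : IsSymCoprod 𝒲 Δ) (hC : IsSymCobr k δ Δ C)

include hδ hΔ hC

theorem IsSymDer.cobr (hf : HasDegree 𝒲 r f) (hF : IsSymDer r f F)
    (hfδ : ∀ x, der 𝒲 r f (δ x) = sg 𝕜 (r * k) • δ (f x)) (t : SymHat 𝒲) :
    der (hatGrading 𝒲) r F (C t) = sg 𝕜 (r * k) • C (F t) := by
  refine LinearMap.congr_fun (f := der (hatGrading 𝒲) r F ∘ₗ C) (g := sg 𝕜 (r * k) • (C ∘ₗ F))
    (symHat_hom_ext ?_ fun i x hx m t ht h => ?_) t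
  · simp [hF.one, hC.one]
  · simp only [LinearMap.comp_apply, LinearMap.smul_apply] at h ⊢
    rw [hF.mul i x hx, map_add, map_smul, hC.mul i x hx, hC.mul i x hx, hC.mul _ _ (hf _ _ hx),
      map_add, map_smul, hF.der_mulTwo hf, hF.der_phi hf hx, h, hδ i x hx, hfδ, hF.coprod hf hΔ]
    simp only [map_smul, LinearMap.smul_apply]
    match_scalars <;> simp only [mul_one, ← sg_add] <;> first | rfl | refine sg_congr ?_ <;>
      clear * - <;> grind

/-- The cocycle condition `hβδ`, extended from `W` to the symmetric algebra in the second argument.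
The derivation by the second argument, applied to `δ x`, becomes the action of `δ x` on `Δ t`
through `brTwo`. -/
theorem IsSymBr.ad_cobr (hβ : ∀ i j, ∀ x ∈ 𝒲 i, ∀ y ∈ 𝒲 j, β x y ∈ 𝒲 (i + j + 1))
    (hβc : ∀ i j, ∀ x ∈ 𝒲 i, ∀ y ∈ 𝒲 j, β x y = sg 𝕜 (i * j) • β y x)
    (had : ∀ i, ∀ x ∈ 𝒲 i, IsSymDer (i + 1) (β x) (ad x)) (hF : IsSymBr ad F)
    (hβδ : ∀ i j, ∀ x ∈ 𝒲 i, ∀ y ∈ 𝒲 j, δ (β x y) =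
      sg 𝕜 (k + (i + k) * j) • der 𝒲 (j + 1) (β y) (δ x) +
        sg 𝕜 (k + k * i) • der 𝒲 (i + 1) (β x) (δ y)) (hx : x ∈ 𝒲 i) (t : SymHat 𝒲) :
    C (ad x t) = sg 𝕜 k • brTwo F (δ x) (Δ t) +
      sg 𝕜 (k + k * i) • der (hatGrading 𝒲) (i + 1) (ad x) (C t) := by
  have hd {i x} (hx : x ∈ 𝒲 i) : HasDegree 𝒲 (i + 1) (β x) := fun j y hy => by
    rw [show j + (i + 1) = i + j + 1 by ring]; exact hβ _ _ _ hx _ hy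
  refine LinearMap.congr_fun (f := C ∘ₗ ad x) (g := sg 𝕜 k • (brTwo F (δ x) ∘ₗ Δ) +
    sg 𝕜 (k + k * i) • (der (hatGrading 𝒲) (i + 1) (ad x) ∘ₗ C))
    (symHat_hom_ext ?_ fun j y hy m t ht h => ?_) t
  · have : brTwo F (δ x) (hatOne 𝒲 ⊗ₜ hatOne 𝒲) = 0 := by
      generalize δ x = τ
      induction τ using tensor_induction 𝒲 𝒲 with
      | zero => simp
      | add x y hx hy => simp only [map_add, LinearMap.add_apply, hx, hy, add_zero]
      | tmul k u hu l v hv =>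
        rw [brTwo_tmul hβ had hF hu hv hatOne_mem, (had k u hu).one, (had l v hv).one]
        simp
    simp [(had i x hx).one, hC.one, hΔ.one, this]
  · simp only [LinearMap.comp_apply, LinearMap.smul_apply, LinearMap.add_apply] at h ⊢
    have e := brTwo_phi hβ hβc had hF hy (δ x) (Δ t)
    rw [hδ i x hx, map_smul, LinearMap.smul_apply] at e
    have e' : brTwo F (δ x) (phi 𝒲 y (Δ t)) = sg 𝕜 (j * (i + k)) •
        (mulTwo 𝒲 (der 𝒲 (j + 1) (β y) (δ x)) (Δ t) +
          sg 𝕜 j • phi 𝒲 y (brTwo F (δ x) (Δ t))) := by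
      rw [← e, smul_smul, sg_mul_self, one_smul]
    rw [(had i x hx).mul j y hy, map_add, map_smul, hC.mul j y hy, hC.mul j y hy,
      hC.mul _ _ (hβ _ _ _ hx _ hy), map_add, map_smul, (had i x hx).der_mulTwo (hd hx),
      (had i x hx).der_phi (hd hx) hy, h, hδ j y hy, hβδ i j x hx y hy, (had i x hx).coprod (hd hx) hΔ,
      hΔ.mul, e']
    simp only [map_smul, map_add, LinearMap.add_apply, LinearMap.smul_apply]
    match_scalars <;> simp only [mul_one, ← sg_add] <;> first | rfl | refine sg_congr ?_ <;>
      clear * - <;> simp only [Int.even_sub, Int.even_add, Int.even_mul] <;> grind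

/-- For `x t`, the term `brTwo F (δ x) (Δ t)` arises on one side when `F` crosses `δ x`, on the
other from `C (ad x t)` by `IsSymBr.ad_cobr`, which also matches the terms in `ad x`. The rest is
the induction hypothesis and compatibility with `Δ`. -/
theorem IsSymBr.cobr (hβ : ∀ i j, ∀ x ∈ 𝒲 i, ∀ y ∈ 𝒲 j, β x y ∈ 𝒲 (i + j + 1))
    (hβc : ∀ i j, ∀ x ∈ 𝒲 i, ∀ y ∈ 𝒲 j, β x y = sg 𝕜 (i * j) • β y x)
    (had : ∀ i, ∀ x ∈ 𝒲 i, IsSymDer (i + 1) (β x) (ad x)) (hF : IsSymBr ad F)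
    (hβδ : ∀ i j, ∀ x ∈ 𝒲 i, ∀ y ∈ 𝒲 j, δ (β x y) =
      sg 𝕜 (k + (i + k) * j) • der 𝒲 (j + 1) (β y) (δ x) +
        sg 𝕜 (k + k * i) • der 𝒲 (i + 1) (β x) (δ y)) (t : SymHat 𝒲) :
    der (hatGrading 𝒲) 1 F (C t) = sg 𝕜 k • C (F t) := by
  refine LinearMap.congr_fun (f := der (hatGrading 𝒲) 1 F ∘ₗ C) (g := sg 𝕜 k • (C ∘ₗ F))
    (symHat_hom_ext ?_ fun i x hx m t ht h => ?_) t
  · simp [hF.one, hC.one]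
  · simp only [LinearMap.comp_apply, LinearMap.smul_apply] at h ⊢
    have e := brTwo_apply (F := F) (δ x) (Δ t)
    rw [hδ i x hx, eq_sub_iff_add_eq] at e
    rw [hF.mul i x hx, map_add, map_smul, hF.ad_cobr hδ hΔ hC hβ hβc had hβδ hx, hC.mul i x hx,
      hC.mul i x hx, map_add, map_smul, ← e, hF.der_phi hβ had hx, h, hF.coprod hβ had hΔ]
    simp only [map_smul, LinearMap.smul_apply]
    match_scalars <;> simp only [mul_one, ← sg_add]
    · exact ((sg_congr (𝕜 := 𝕜) (by clear * -; grind)).trans sg_zero).symm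
    all_goals exact sg_congr (by clear * -; grind)

end SymIdentities

end ABAlg

namespace ABAlg

/-! ### Koszul signs and index sets when a first factor is added. -/

section KoszulSucc

variable {n : ℕ} (x : Fin (n + 1) → ℤ)

theorem koszul_map_succ (L : List (Fin n)) :
    koszul x (L.map Fin.succ) = koszul (fun i => x i.succ) L := by
  induction L with
  | nil => rfl
  | cons i L ih =>
    rw [List.map_cons, koszul, koszul, ih, List.filter_map, List.map_map]
    simp [Function.comp_def]

theorem koszul_zero_cons (L : List (Fin n)) :
    koszul x (0 :: L.map Fin.succ) = koszul (fun i => x i.succ) L := by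
  rw [koszul_cons_of_lt, koszul_map_succ]
  intro j hj
  obtain ⟨i, -, rfl⟩ := List.mem_map.1 hj
  exact i.succ_pos

/-- Every index of the first list is larger than `0`, so `0` crosses all of them and nothing else.
-/
theorem koszul_append_zero_cons (L L' : List (Fin n)) :
    koszul x (L.map Fin.succ ++ 0 :: L'.map Fin.succ) =
      (x 0 * (L.map fun i => x i.succ).sum).negOnePow * koszul (fun i => x i.succ) (L ++ L') := by
  induction L with
  | nil => simp [koszul_zero_cons]
  | cons i L ih =>
    rw [List.map_cons, List.cons_append, koszul, ih, List.cons_append, koszul, List.map_cons,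
      List.sum_cons, mul_add, Int.negOnePow_add, List.filter_append, List.filter_cons_of_pos (by simp),
      List.filter_append, List.filter_map, List.filter_map]
    simp only [List.map_append, List.sum_append, List.map_cons, List.sum_cons, List.map_map,
      Int.negOnePow_add, Function.comp_def, Fin.succ_lt_succ_iff, mul_comm (x 0) (x i.succ)]
    simp only [mul_assoc, mul_left_comm, mul_comm]

theorem increasing_map_succ (J : Finset (Fin n)) :
    increasing (J.map (Fin.succEmb n)) = (increasing J).map Fin.succ := by
  rw [increasing, List.finRange_succ, List.filter_cons_of_neg (by simp [Fin.succ_ne_zero]),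
    List.filter_map, increasing]
  congr 1
  refine List.filter_congr fun i _ => ?_
  simp

theorem increasing_insert_zero (J : Finset (Fin n)) :
    increasing (insert 0 (J.map (Fin.succEmb n))) = 0 :: (increasing J).map Fin.succ := by
  rw [increasing, List.finRange_succ, List.filter_cons_of_pos (by simp), List.filter_map, increasing]
  congr 2
  refine List.filter_congr fun i _ => ?_
  simp [Fin.succ_ne_zero]

theorem compl_map_succ (J : Finset (Fin n)) :
    (J.map (Fin.succEmb n))ᶜ = insert 0 (Jᶜ.map (Fin.succEmb n)) := by
  ext i
  refine Fin.cases ?_ (fun i => ?_) i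
  · simp [Fin.succ_ne_zero]
  · simp [Fin.succ_ne_zero]

theorem compl_insert_zero (J : Finset (Fin n)) :
    (insert 0 (J.map (Fin.succEmb n)))ᶜ = Jᶜ.map (Fin.succEmb n) := by
  rw [← compl_compl J, ← compl_map_succ, compl_compl, compl_compl]

theorem sum_finset_succ {M : Type*} [AddCommMonoid M] (g : Finset (Fin (n + 1)) → M) :
    ∑ I, g I = (∑ J : Finset (Fin n), g (insert 0 (J.map (Fin.succEmb n)))) +
      ∑ J : Finset (Fin n), g (J.map (Fin.succEmb n)) := by
  have h : (Finset.univ : Finset (Fin (n + 1))) =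
      insert 0 ((Finset.univ : Finset (Fin n)).map (Fin.succEmb n)) := by
    rw [Fin.univ_succ, Finset.cons_eq_insert]; rfl
  rw [← Finset.powerset_univ, h, Finset.sum_powerset_insert (by simp [Fin.succ_ne_zero]), add_comm,
    show (Finset.univ.map (Fin.succEmb n)).powerset =
      Finset.univ.map (Finset.mapEmbedding (Fin.succEmb n)).toEmbedding from ?_, Finset.sum_map,
    Finset.sum_map]
  · rfl
  · ext I
    simp only [Finset.mem_powerset, Finset.mem_map, Finset.mem_univ, true_and,
      RelEmbedding.coe_toEmbedding, Finset.mapEmbedding_apply, Finset.subset_map_iff,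
      Finset.subset_univ]
    exact ⟨fun ⟨u, hu⟩ => ⟨u, hu.symm⟩, fun ⟨u, hu⟩ => ⟨u, hu.symm⟩⟩

theorem sum_increasing {M : Type*} [AddCommMonoid M] {n : ℕ} (I : Finset (Fin n)) (g : Fin n → M) :
    ((increasing I).map g).sum = ∑ i ∈ I, g i := by
  rw [increasing, ← List.sum_toFinset g ((List.nodup_finRange n).filter _)]
  congr 1
  ext i
  simp

theorem sum_pair_succ {M : Type*} [AddCommMonoid M] (g : Fin (n + 1) × Fin (n + 1) → M) :
    ∑ ij : Fin (n + 1) × Fin (n + 1) with ij.1 < ij.2, g ij = (∑ j : Fin n, g (0, j.succ)) +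
      ∑ ij : Fin n × Fin n with ij.1 < ij.2, g (ij.1.succ, ij.2.succ) := by
  simp only [Finset.sum_filter, Fintype.sum_prod_type]
  rw [Fin.sum_univ_succ, Fin.sum_univ_succ]
  congr 1
  · simp
  · refine Finset.sum_congr rfl fun k _ => ?_
    rw [Fin.sum_univ_succ]
    simp

end KoszulSucc

end ABAlg

namespace ABAlg

/-! ### Closed formulas for the operators, deduced from the recursions. -/

section SymFormulas

universe u

variable {𝕜 : Type*} [Field 𝕜] {W : Type u} [AddCommGroup W] [Module 𝕜 W]
  (𝒲 : ℤ → Submodule 𝕜 W)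

/-- The product of a list of elements in the symmetric algebra. -/
noncomputable def hatWord (l : List W) : SymHat 𝒲 := (symRel 𝒲).mkQ (word 𝕜 l)

/-- The product of a list of elements and of a last element in the symmetric algebra. -/
noncomputable def hatSnoc (l : List W) : W →ₗ[𝕜] SymHat 𝒲 :=
  (symRel 𝒲).mkQ ∘ₗ LinearMap.mulLeft 𝕜 (word 𝕜 l) ∘ₗ TensorAlgebra.ι 𝕜

variable {𝒲}

theorem hatWord_nil : hatWord 𝒲 [] = hatOne 𝒲 := rfl

theorem hatWord_cons (x : W) (l : List W) : hatWord 𝒲 (x :: l) = hatMul 𝒲 x (hatWord 𝒲 l) := by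
  rw [hatWord, word_cons', ← hatMul_mkQ]; rfl

theorem hatSnoc_apply (l : List W) (x : W) : hatSnoc 𝒲 l x = hatWord 𝒲 (l ++ [x]) := by
  simp [hatSnoc, hatWord, word]

theorem hatSnoc_cons (y : W) (l : List W) (x : W) :
    hatSnoc 𝒲 (y :: l) x = hatMul 𝒲 y (hatSnoc 𝒲 l x) := by
  rw [hatSnoc_apply, hatSnoc_apply, List.cons_append, hatWord_cons]

theorem hatWord_mem {ι : Type*} {e : ι → ℤ} {X : ι → W} (hX : ∀ i, X i ∈ 𝒲 (e i)) (L : List ι) :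
    hatWord 𝒲 (L.map X) ∈ hatGrading 𝒲 (L.map e).sum :=
  ⟨_, word_map_mem hX L, rfl⟩

theorem hatSnoc_mem {ι : Type*} {e : ι → ℤ} {X : ι → W} (hX : ∀ i, X i ∈ 𝒲 (e i)) (L : List ι)
    {i : ℤ} {x : W} (hx : x ∈ 𝒲 i) :
    hatSnoc 𝒲 (L.map X) x ∈ hatGrading 𝒲 ((L.map e).sum + i) := by
  induction L with
  | nil =>
    simp only [List.map_nil, hatSnoc_apply, List.nil_append, hatWord_cons, List.sum_nil,
      zero_add]
    exact add_zero i ▸ hatMul_mem hx hatOne_mem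
  | cons y L ih =>
    simp only [List.map_cons, hatSnoc_cons, List.sum_cons, add_assoc]
    exact hatMul_mem (hX y) ih

theorem hatSnoc_comm {ι : Type*} {e : ι → ℤ} {X : ι → W} (hX : ∀ i, X i ∈ 𝒲 (e i)) (L : List ι)
    {i : ℤ} {x : W} (hx : x ∈ 𝒲 i) :
    hatMul 𝒲 x (hatWord 𝒲 (L.map X)) = sg 𝕜 (i * (L.map e).sum) • hatSnoc 𝒲 (L.map X) x := by
  induction L with
  | nil => simp [hatSnoc_apply, hatWord_cons, sg_zero]
  | cons y L ih =>
    rw [List.map_cons, hatWord_cons, hatMul_comm hx (hX y), ih, map_smul, hatSnoc_cons, smul_smul,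
      ← sg_add, List.map_cons, List.sum_cons, mul_add]

theorem map_units_smul {M N : Type*} [AddCommGroup M] [Module 𝕜 M] [AddCommGroup N] [Module 𝕜 N]
    (f : M →ₗ[𝕜] N) (u : ℤˣ) (x : M) : f (u • x) = u • f x := by
  rw [Units.smul_def, map_zsmul, ← Units.smul_def]

theorem negOnePow_congr {m n : ℤ} (h : Even (m - n)) : m.negOnePow = n.negOnePow :=
  (Int.negOnePow_eq_iff _ _).2 h

variable [Internal 𝒲] {i j k r : ℤ}
  {f : W →ₗ[𝕜] W} {F : SymHat 𝒲 →ₗ[𝕜] SymHat 𝒲} {β : W →ₗ[𝕜] W →ₗ[𝕜] W}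
  {ad : W →ₗ[𝕜] SymHat 𝒲 →ₗ[𝕜] SymHat 𝒲} {Δ : SymHat 𝒲 →ₗ[𝕜] SymHat 𝒲 ⊗[𝕜] SymHat 𝒲}
  {n : ℕ} {x : Fin n → ℤ} {X : Fin n → W}

omit [Internal 𝒲] in
-- The term `i = 0` is the first one of `IsSymDer.mul`; in the others `f (X i)` is brought to the
-- front across `X 0`.
theorem IsSymDer.apply_hatWord (hf : HasDegree 𝒲 r f) (hF : IsSymDer r f F)
    (hX : ∀ i, X i ∈ 𝒲 (x i)) : F (hatWord 𝒲 (List.ofFn X)) =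
      ∑ i : Fin n, koszul x (i :: increasing {i}ᶜ) •
        hatWord 𝒲 (f (X i) :: (increasing {i}ᶜ).map X) := by
  induction n with
  | zero => simp [hatWord_nil, hF.one]
  | succ n ih =>
    have h0 : ({0} : Finset (Fin (n + 1)))ᶜ = (Finset.univ).map (Fin.succEmb n) := by
      have := compl_insert_zero (∅ : Finset (Fin n))
      simpa using this
    have hs (i : Fin n) : ({i.succ} : Finset (Fin (n + 1)))ᶜ =
        insert 0 (({i} : Finset (Fin n))ᶜ.map (Fin.succEmb n)) := by
      rw [← compl_map_succ]; simp
    have hu : increasing (Finset.univ : Finset (Fin n)) = List.finRange n := by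
      simp [increasing]
    rw [List.ofFn_succ, hatWord_cons, hF.mul _ _ (hX 0), ih fun i => hX i.succ, Fin.sum_univ_succ,
      h0, increasing_map_succ, koszul_zero_cons, hu, koszul_of_pairwise (List.pairwise_lt_finRange n),
      one_smul, hatWord_cons, List.map_map, ← List.ofFn_eq_map]
    congr 1
    rw [map_sum, Finset.smul_sum]
    refine Finset.sum_congr rfl fun i _ => ?_
    rw [hs, increasing_insert_zero,
      show i.succ :: 0 :: (increasing {i}ᶜ).map Fin.succ =
        [i].map Fin.succ ++ 0 :: (increasing {i}ᶜ).map Fin.succ from rfl,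
      koszul_append_zero_cons, hatWord_cons, hatWord_cons, List.map_cons (f := X), List.map_map,
      hatWord_cons, hatMul_comm (hf _ _ (hX i.succ)) (hX 0)]
    simp only [map_units_smul, ← negOnePow_smul 𝕜, List.map_singleton, List.sum_singleton,
      List.singleton_append, smul_smul, Function.comp_def]
    congr 1
    generalize koszul _ _ = K
    rw [mul_right_comm, ← Int.negOnePow_add]
    exact congrArg (· * K) (negOnePow_congr (by grind))

/-- Subsets that contain `0` and subsets that avoid it correspond to the two terms of multiplication
by `x ⊗ 1 + 1 ⊗ x`. -/
theorem IsSymCoprod.apply_hatWord (hΔ : IsSymCoprod 𝒲 Δ) (hX : ∀ i, X i ∈ 𝒲 (x i)) :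
    Δ (hatWord 𝒲 (List.ofFn X)) = ∑ I : Finset (Fin n),
      koszul x (increasing I ++ increasing Iᶜ) •
        (hatWord 𝒲 ((increasing I).map X) ⊗ₜ[𝕜] hatWord 𝒲 ((increasing Iᶜ).map X)) := by
  induction n with
  | zero => simp [hatWord_nil, hΔ.one, increasing, koszul]
  | succ n ih =>
    rw [List.ofFn_succ, hatWord_cons, hΔ.mul, ih fun i => hX i.succ, map_sum, sum_finset_succ,
      ← Finset.sum_add_distrib]
    refine Finset.sum_congr rfl fun J _ => ?_
    rw [compl_insert_zero, compl_map_succ, increasing_insert_zero, increasing_insert_zero,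
      increasing_map_succ, increasing_map_succ, List.cons_append, ← List.map_append,
      koszul_zero_cons, koszul_append_zero_cons]
    simp only [List.map_cons, List.map_map, hatWord_cons, Function.comp_def]
    rw [map_units_smul, phi_tmul (hX 0) (hatWord_mem (e := fun i : Fin n => x i.succ)
      (X := fun i : Fin n => X i.succ) (fun i => hX i.succ) _), smul_add, mul_smul,
      negOnePow_smul 𝕜]
    simp only [Units.smul_def, ← Int.cast_smul_eq_zsmul 𝕜]
    rw [smul_comm]

omit [Internal 𝒲] in
-- The pairs `(0, j)` come from the derivation `ad (X 0)`, the other pairs from the recursive term.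
theorem IsSymBr.apply_hatWord (hβ : ∀ i j, ∀ x ∈ 𝒲 i, ∀ y ∈ 𝒲 j, β x y ∈ 𝒲 (i + j + 1))
    (had : ∀ i, ∀ x ∈ 𝒲 i, IsSymDer (i + 1) (β x) (ad x)) (hF : IsSymBr ad F)
    (hX : ∀ i, X i ∈ 𝒲 (x i)) : F (hatWord 𝒲 (List.ofFn X)) =
      ∑ ij : Fin n × Fin n with ij.1 < ij.2, koszul x (ij.1 :: ij.2 :: increasing {ij.1, ij.2}ᶜ) •
        hatWord 𝒲 (β (X ij.1) (X ij.2) :: (increasing {ij.1, ij.2}ᶜ).map X) := by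
  induction n with
  | zero => simp [hatWord_nil, hF.one]
  | succ n ih =>
    have hd {i x} (hx : x ∈ 𝒲 i) : HasDegree 𝒲 (i + 1) (β x) := fun j y hy => by
      rw [show j + (i + 1) = i + j + 1 by ring]; exact hβ _ _ _ hx _ hy
    have h0 (j : Fin n) : ({0, j.succ} : Finset (Fin (n + 1)))ᶜ =
        ({j} : Finset (Fin n))ᶜ.map (Fin.succEmb n) := by
      rw [← compl_insert_zero]; simp
    have hs (i j : Fin n) : ({i.succ, j.succ} : Finset (Fin (n + 1)))ᶜ =
        insert 0 (({i, j} : Finset (Fin n))ᶜ.map (Fin.succEmb n)) := by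
      rw [← compl_map_succ]; simp [Finset.map_insert]
    rw [List.ofFn_succ, hatWord_cons, hF.mul _ _ (hX 0), ih fun i => hX i.succ, sum_pair_succ,
      (had _ _ (hX 0)).apply_hatWord (hd (hX 0)) fun i => hX i.succ]
    congr 1
    · refine Finset.sum_congr rfl fun j _ => ?_
      simp only [h0, increasing_map_succ, List.map_map, Function.comp_def]
      rw [← List.map_cons, koszul_zero_cons]
    rw [map_sum, Finset.smul_sum]
    refine Finset.sum_congr rfl fun ij _ => ?_
    obtain ⟨i, j⟩ := ij
    simp only
    rw [hs, increasing_insert_zero,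
      show i.succ :: j.succ :: 0 :: (increasing {i, j}ᶜ).map Fin.succ =
        [i, j].map Fin.succ ++ 0 :: (increasing {i, j}ᶜ).map Fin.succ from rfl,
      koszul_append_zero_cons, hatWord_cons, hatWord_cons, List.map_cons (f := X), List.map_map,
      hatWord_cons, hatMul_comm (hβ _ _ _ (hX i.succ) _ (hX j.succ)) (hX 0)]
    simp only [map_units_smul, ← negOnePow_smul 𝕜, List.map_cons, List.map_nil, List.sum_cons,
      List.sum_nil, List.cons_append, List.nil_append, smul_smul, Function.comp_def]
    congr 1
    generalize koszul _ _ = K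
    rw [mul_right_comm, ← Int.negOnePow_add]
    exact congrArg (· * K) (negOnePow_congr (by grind))

/-- The left component of `τ` is carried to the end of its word and the right component crosses that
same word, so both receive the same twist. -/
theorem mulTwo_hatWord {ι : Type*} {e : ι → ℤ} {X : ι → W} (hX : ∀ i, X i ∈ 𝒲 (e i)) (L L' : List ι)
    (τ : W ⊗[𝕜] W) :
    mulTwo 𝒲 τ (hatWord 𝒲 (L.map X) ⊗ₜ hatWord 𝒲 (L'.map X)) =
      TensorProduct.map (hatSnoc 𝒲 (L.map X)) ((hatMul 𝒲).flip (hatWord 𝒲 (L'.map X)))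
        (TensorProduct.map (pw 𝒲 (L.map e).sum) (pw 𝒲 (L.map e).sum) τ) := by
  induction τ using tensor_induction 𝒲 𝒲 with
  | zero => simp
  | add u v hu hv => simp only [map_add, LinearMap.add_apply, hu, hv]
  | tmul i u hu j v hv =>
    rw [mulTwo_tmul u hv (hatWord_mem hX L), hatSnoc_comm hX L hu, TensorProduct.map_tmul,
      TensorProduct.map_tmul, LinearMap.flip_apply, pw_apply _ hu, pw_apply _ hv, map_smul,
      map_smul, LinearMap.smul_apply]
    simp only [← TensorProduct.smul_tmul', TensorProduct.tmul_smul]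
    match_scalars <;> simp only [mul_one, ← sg_add] <;> refine sg_congr ?_ <;> clear * - <;> grind

theorem phi_hatSnoc {ι : Type*} {e : ι → ℤ} {X : ι → W} (hX : ∀ i, X i ∈ 𝒲 (e i)) (L : List ι)
    (l : List W) {y : W} (hy : y ∈ 𝒲 j) (τ : W ⊗[𝕜] W) :
    phi 𝒲 y (TensorProduct.map (hatSnoc 𝒲 (L.map X)) ((hatMul 𝒲).flip (hatWord 𝒲 l)) τ) =
      TensorProduct.map (hatSnoc 𝒲 (y :: L.map X)) ((hatMul 𝒲).flip (hatWord 𝒲 l)) τ +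
      sg 𝕜 (j * (L.map e).sum) •
        TensorProduct.map (hatSnoc 𝒲 (L.map X)) ((hatMul 𝒲).flip (hatWord 𝒲 (y :: l)))
          (TensorProduct.map (pw 𝒲 j) (pw 𝒲 j) τ) := by
  induction τ using tensor_induction 𝒲 𝒲 with
  | zero => simp
  | add u v hu hv => simp only [map_add, hu, hv]; module
  | tmul i u hu m v hv =>
    rw [TensorProduct.map_tmul, TensorProduct.map_tmul, TensorProduct.map_tmul,
      TensorProduct.map_tmul, phi_tmul hy (hatSnoc_mem hX L hu), hatSnoc_cons,
      LinearMap.flip_apply, LinearMap.flip_apply, hatWord_cons, pw_apply _ hu, pw_apply _ hv,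
      hatMul_comm hy hv, map_smul, map_smul, LinearMap.smul_apply]
    simp only [← TensorProduct.smul_tmul', TensorProduct.tmul_smul]
    match_scalars <;> simp only [mul_one, ← sg_add] <;> refine sg_congr ?_ <;> clear * - <;> grind

theorem sum_pointed_succ {M : Type*} [AddCommMonoid M] (g : Fin (n + 1) → Finset (Fin (n + 1)) → M) :
    ∑ s, ∑ I : Finset (Fin (n + 1)) with s ∉ I, g s I = (∑ J : Finset (Fin n), g 0 (J.map (Fin.succEmb n))) +
      ∑ s : Fin n, ∑ J : Finset (Fin n) with s ∉ J, (g s.succ (insert 0 (J.map (Fin.succEmb n))) +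
        g s.succ (J.map (Fin.succEmb n))) := by
  simp only [Finset.sum_filter]
  rw [Fin.sum_univ_succ, sum_finset_succ]
  congr 1
  · simp [Fin.succ_ne_zero]
  · refine Finset.sum_congr rfl fun s _ => ?_
    rw [sum_finset_succ, ← Finset.sum_add_distrib]
    refine Finset.sum_congr rfl fun J _ => ?_
    by_cases h : s ∈ J <;> simp [h, Fin.succ_ne_zero]

/-- The index `s = 0` corresponds to `δ (X 0)` acting on the coproduct of the other factors. For the
other `s`, `X 0` joins `I` or `J`: the two terms of `phi_hatSnoc`. -/
theorem IsSymCobr.apply_hatWord {δ : W →ₗ[𝕜] W ⊗[𝕜] W} {C : SymHat 𝒲 →ₗ[𝕜] SymHat 𝒲 ⊗[𝕜] SymHat 𝒲}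
    (hδ : ∀ i, ∀ x ∈ 𝒲 i, ∀ j, TensorProduct.map (pw 𝒲 j) (pw 𝒲 j) (δ x) = sg 𝕜 (j * (i + k)) • δ x)
    (hΔ : IsSymCoprod 𝒲 Δ) (hC : IsSymCobr k δ Δ C) (hX : ∀ i, X i ∈ 𝒲 (x i)) :
    C (hatWord 𝒲 (List.ofFn X)) = ∑ s : Fin n, ∑ I : Finset (Fin n) with s ∉ I,
      (koszul x (increasing I ++ s :: increasing (insert s I)ᶜ) *
        (k * ∑ i ∈ I, x i).negOnePow) •
      TensorProduct.map (hatSnoc 𝒲 ((increasing I).map X))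
        ((hatMul 𝒲).flip (hatWord 𝒲 ((increasing (insert s I)ᶜ).map X))) (δ (X s)) := by
  induction n with
  | zero => simp [hatWord_nil, hC.one]
  | succ n ih =>
    have hX' : ∀ i : Fin n, X i.succ ∈ 𝒲 (x i.succ) := fun i => hX i.succ
    rw [List.ofFn_succ, hatWord_cons, hC.mul _ _ (hX 0), ih hX', hΔ.apply_hatWord hX',
      sum_pointed_succ]
    congr 1
    · rw [map_sum]
      refine Finset.sum_congr rfl fun J _ => ?_
      rw [map_units_smul, mulTwo_hatWord (X := fun i : Fin n => X i.succ) hX', hδ _ _ (hX 0),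
        map_smul, compl_insert_zero, increasing_map_succ, increasing_map_succ,
        koszul_append_zero_cons, Finset.sum_map]
      simp only [List.map_map, Function.comp_def, Fin.coe_succEmb, sum_increasing]
      generalize koszul _ _ = K
      simp only [Units.smul_def, Units.val_mul, Int.cast_mul, ← Int.cast_smul_eq_zsmul 𝕜]
      simp only [← show ∀ n : ℤ, sg 𝕜 n = ((n.negOnePow : ℤ) : 𝕜) from fun _ => rfl]
      generalize ((K : ℤ) : 𝕜) = K
      match_scalars
      simp only [mul_one]
      rw [mul_right_comm _ K, ← sg_add, mul_comm K]
      refine congrArg (· * K) (sg_congr ?_)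
      clear * -
      grind
    · rw [map_sum, Finset.smul_sum]
      refine Finset.sum_congr rfl fun s _ => ?_
      rw [map_sum, Finset.smul_sum]
      refine Finset.sum_congr rfl fun J hJ => ?_
      have h0 : (insert s.succ (insert 0 (J.map (Fin.succEmb n))))ᶜ =
          (insert s J)ᶜ.map (Fin.succEmb n) := by
        rw [← compl_insert_zero, Finset.map_insert, Finset.insert_comm]; rfl
      have h1 : (insert s.succ (J.map (Fin.succEmb n)))ᶜ =
          insert 0 ((insert s J)ᶜ.map (Fin.succEmb n)) := by
        rw [← compl_map_succ, Finset.map_insert]; rfl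
      have h2 : (increasing J).map Fin.succ ++ s.succ :: 0 ::
          (increasing (insert s J)ᶜ).map Fin.succ = (increasing J ++ [s]).map Fin.succ ++ 0 ::
          (increasing (insert s J)ᶜ).map Fin.succ := by simp
      have h3 : 0 ∉ J.map (Fin.succEmb n) := by simp [Fin.succ_ne_zero]
      rw [map_units_smul, phi_hatSnoc (X := fun i : Fin n => X i.succ) hX' _ _ (hX 0),
        hδ _ _ (hX' s), h0, h1, increasing_insert_zero, increasing_insert_zero, increasing_map_succ,
        increasing_map_succ, h2, koszul_append_zero_cons, List.cons_append, ← List.map_cons,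
        ← List.map_append, koszul_zero_cons, Finset.sum_insert h3, Finset.sum_map]
      simp only [List.map_map, Function.comp_def, List.map_cons, Fin.coe_succEmb, sum_increasing,
        List.map_append, List.sum_append, List.map_nil, List.sum_cons, List.sum_nil,
        List.append_assoc, List.cons_append, List.nil_append, map_smul]
      generalize koszul _ _ = K
      simp only [Units.smul_def, Units.val_mul, Int.cast_mul, ← Int.cast_smul_eq_zsmul 𝕜]
      simp only [← show ∀ n : ℤ, sg 𝕜 n = ((n.negOnePow : ℤ) : 𝕜) from fun _ => rfl]
      generalize ((K : ℤ) : 𝕜) = K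
      match_scalars
      · rw [mul_add, sg_add]; ring
      · simp only [mul_one]
        rw [mul_right_comm _ K, ← sg_add, mul_left_comm, ← sg_add, ← sg_add, mul_assoc, ← sg_add, mul_comm K]
        refine congrArg (· * K) (sg_congr ?_)
        clear * -
        grind

end SymFormulas

end ABAlg

namespace ABAlg

/-! ### Passage to the symmetric algebra without scalars. -/

section Descent

universe u

variable {𝕜 : Type*} [Field 𝕜] {W : Type u} [AddCommGroup W] [Module 𝕜 W]
  {M : Type*} [AddCommGroup M] [Module 𝕜 M] (𝒲 : ℤ → Submodule 𝕜 W)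

theorem symRel_le_commutators : symRel 𝒲 ≤ commutators 𝒲 :=
  Submodule.span_mono Set.subset_union_right

/-- The quotient of the symmetric algebra by the scalars. -/
noncomputable def symQ : SymHat 𝒲 →ₗ[𝕜] SymPlus 𝒲 :=
  (symRel 𝒲).liftQ (commutators 𝒲).mkQ (by
    rw [Submodule.ker_mkQ]; exact symRel_le_commutators 𝒲)

variable {𝒲}

theorem symQ_mkQ (t : TensorAlgebra 𝕜 W) : symQ 𝒲 ((symRel 𝒲).mkQ t) = (commutators 𝒲).mkQ t := rfl

theorem symQ_hatWord (l : List W) : symQ 𝒲 (hatWord 𝒲 l) = symProd 𝒲 l := rfl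

theorem symQ_hatOne : symQ 𝒲 (hatOne 𝒲) = 0 := by
  rw [hatOne, symQ_mkQ, Submodule.mkQ_apply, Submodule.Quotient.mk_eq_zero]
  exact Submodule.subset_span (Or.inl rfl)

theorem symProd_nil : symProd 𝒲 [] = 0 := symQ_hatOne

theorem symQ_surjective : Function.Surjective (symQ 𝒲) := fun x => by
  obtain ⟨t, rfl⟩ := (commutators 𝒲).mkQ_surjective x
  exact ⟨_, symQ_mkQ t⟩

theorem exists_descent {F : SymHat 𝒲 →ₗ[𝕜] M} (hF : F (hatOne 𝒲) = 0) :
    ∃ f : SymPlus 𝒲 →ₗ[𝕜] M, ∀ t, f (symQ 𝒲 t) = F t := by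
  refine ⟨(commutators 𝒲).liftQ (F ∘ₗ (symRel 𝒲).mkQ) (Submodule.span_le.2 ?_), fun t => ?_⟩
  · rintro t (rfl | ht)
    · exact hF
    · have h : (symRel 𝒲).mkQ t = 0 :=
        (Submodule.Quotient.mk_eq_zero _).2 (Submodule.subset_span ht)
      rw [SetLike.mem_coe, LinearMap.mem_ker, LinearMap.comp_apply, h, map_zero]
  · obtain ⟨t, rfl⟩ := (symRel 𝒲).mkQ_surjective t
    rfl

theorem symGrading_eq_map (m : ℤ) : symGrading 𝒲 m = (hatGrading 𝒲 m).map (symQ 𝒲) := by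
  rw [hatGrading, ← Submodule.map_comp, symGrading, tensorGrading, Submodule.map_span]
  congr 1
  ext X
  constructor
  · rintro ⟨n, x, α, h, rfl, rfl⟩
    exact ⟨_, ⟨n, x, α, h, rfl, rfl⟩, rfl⟩
  · rintro ⟨_, ⟨n, x, α, h, rfl, rfl⟩, rfl⟩
    exact ⟨n, x, α, h, rfl, rfl⟩

theorem hasDegree_descent {r : ℤ} {F : SymHat 𝒲 →ₗ[𝕜] SymHat 𝒲} {f : SymPlus 𝒲 →ₗ[𝕜] SymPlus 𝒲}
    (hf : ∀ t, f (symQ 𝒲 t) = symQ 𝒲 (F t)) (hF : HasDegree (hatGrading 𝒲) r F) :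
    HasDegree (symGrading 𝒲) r f := by
  intro m x hx
  rw [symGrading_eq_map] at hx ⊢
  obtain ⟨t, ht, rfl⟩ := hx
  exact ⟨_, hF m t ht, (hf t).symm⟩

/-- The projection intertwines the operators `f ⊗ id + id ⊗ f` on the two tensor squares, and it is
surjective. -/
theorem isCoderivation_descent [Internal 𝒲] (P : Parity (symGrading 𝒲)) {k : ℤ}
    {F : SymHat 𝒲 →ₗ[𝕜] SymHat 𝒲} {f : SymPlus 𝒲 →ₗ[𝕜] SymPlus 𝒲}
    {C : SymHat 𝒲 →ₗ[𝕜] SymHat 𝒲 ⊗[𝕜] SymHat 𝒲} {κ : SymPlus 𝒲 →ₗ[𝕜] SymPlus 𝒲 ⊗[𝕜] SymPlus 𝒲}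
    (hf : ∀ t, f (symQ 𝒲 t) = symQ 𝒲 (F t))
    (hκ : ∀ t, κ (symQ 𝒲 t) = TensorProduct.map (symQ 𝒲) (symQ 𝒲) (C t))
    (h : ∀ t, der (hatGrading 𝒲) 1 F (C t) = sg 𝕜 k • C (F t)) : IsCoderivation P k κ f := by
  have key (z : SymHat 𝒲 ⊗[𝕜] SymHat 𝒲) :
      tensorAction P f (TensorProduct.map (symQ 𝒲) (symQ 𝒲) z) =
        TensorProduct.map (symQ 𝒲) (symQ 𝒲) (der (hatGrading 𝒲) 1 F z) := by
    induction z using tensor_induction (hatGrading 𝒲) (hatGrading 𝒲) with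
    | zero => simp
    | add s t hs ht => simp only [map_add, hs, ht]
    | tmul m s hs n t ht =>
      have hs' : symQ 𝒲 s ∈ symGrading 𝒲 m := by
        rw [symGrading_eq_map]; exact ⟨s, hs, rfl⟩
      rw [TensorProduct.map_tmul, der_tmul F hs t, tensorAction, LinearMap.add_apply,
        TensorProduct.map_tmul, TensorProduct.map_tmul, P.op_apply m _ hs', negOnePow_smul 𝕜,
        map_add, map_smul, TensorProduct.map_tmul, TensorProduct.map_tmul, hf, hf, one_mul,
        ← TensorProduct.smul_tmul']
      rfl
  refine LinearMap.ext fun x => ?_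
  obtain ⟨t, rfl⟩ := symQ_surjective x
  rw [LinearMap.comp_apply, hκ, key, h, map_smul, LinearMap.smul_apply, LinearMap.comp_apply, hf,
    hκ, negOnePow_smul 𝕜]

theorem symPlus_hom_ext {f g : SymPlus 𝒲 →ₗ[𝕜] M} {G : Set W} (hG : Submodule.span 𝕜 G = ⊤)
    (h : ∀ l : List W, (∀ x ∈ l, x ∈ G) → f (symProd 𝒲 l) = g (symProd 𝒲 l)) : f = g := by
  refine Submodule.linearMap_qext _ (LinearMap.ext_on (word_span G hG) ?_)
  rintro _ ⟨l, hl, rfl⟩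
  exact h l hl

theorem packets_hom_ext {f g : Packets 𝒲 →ₗ[𝕜] M} {G : Set W} (hG : Submodule.span 𝕜 G = ⊤)
    (h : ∀ l : List W, (∀ x ∈ l, x ∈ G) → f (packet 𝒲 l) = g (packet 𝒲 l)) : f = g := by
  refine Submodule.linearMap_qext _ (LinearMap.ext_on (word_span G hG) ?_)
  rintro _ ⟨l, hl, rfl⟩
  exact h l hl

theorem span_homogeneous [Internal 𝒲] : Submodule.span 𝕜 {x | ∃ i, x ∈ 𝒲 i} = ⊤ := by
  rw [← iSup_eq_top 𝒲, Submodule.iSup_eq_span]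
  congr 1
  ext x
  simp

theorem exists_eq_ofFn {l : List W} (h : ∀ x ∈ l, x ∈ {x | ∃ i, x ∈ 𝒲 i}) :
    ∃ (n : ℕ) (e : Fin n → ℤ) (X : Fin n → W), (∀ i, X i ∈ 𝒲 (e i)) ∧ l = List.ofFn X := by
  choose e he using fun i : Fin l.length => h _ (l.get_mem i)
  exact ⟨_, e, l.get, he, (List.ofFn_get l).symm⟩

variable [Internal 𝒲] {k r : ℤ} {n : ℕ} {x : Fin n → ℤ} {X : Fin n → W}
  {F : SymHat 𝒲 →ₗ[𝕜] SymHat 𝒲}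

/-- The terms with `I` or its complement empty contain the unit, which is zero here; this is why the
sum is over nonempty parts. -/
theorem IsSymCoprod.apply_symProd {Δ : SymHat 𝒲 →ₗ[𝕜] SymHat 𝒲 ⊗[𝕜] SymHat 𝒲}
    {κ : SymPlus 𝒲 →ₗ[𝕜] SymPlus 𝒲 ⊗[𝕜] SymPlus 𝒲} (hΔ : IsSymCoprod 𝒲 Δ)
    (hκ : ∀ t, κ (symQ 𝒲 t) = TensorProduct.map (symQ 𝒲) (symQ 𝒲) (Δ t))
    (hX : ∀ i, X i ∈ 𝒲 (x i)) : κ (symProd 𝒲 (List.ofFn X)) =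
      ∑ I : Finset (Fin n) with I.Nonempty ∧ Iᶜ.Nonempty,
        koszul x (increasing I ++ increasing Iᶜ) •
          (symProd 𝒲 ((increasing I).map X) ⊗ₜ[𝕜] symProd 𝒲 ((increasing Iᶜ).map X)) := by
  rw [← symQ_hatWord, hκ, hΔ.apply_hatWord hX, map_sum, Finset.sum_filter]
  refine Finset.sum_congr rfl fun I _ => ?_
  rw [map_units_smul, TensorProduct.map_tmul, symQ_hatWord, symQ_hatWord]
  have h0 : increasing (∅ : Finset (Fin n)) = [] := by simp [increasing]
  split_ifs with h
  · rfl
  · rw [not_and_or, Finset.not_nonempty_iff_eq_empty, Finset.not_nonempty_iff_eq_empty] at h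
    obtain h | h := h
    · rw [h, h0, List.map_nil, symProd_nil, TensorProduct.zero_tmul, smul_zero]
    · rw [h, h0, List.map_nil, symProd_nil, TensorProduct.tmul_zero, smul_zero]

omit [Internal 𝒲] in
theorem IsSymDer.apply_symProd {f : W →ₗ[𝕜] W} {F' : SymPlus 𝒲 →ₗ[𝕜] SymPlus 𝒲}
    (hf : HasDegree 𝒲 r f) (hF : IsSymDer r f F) (hF' : ∀ t, F' (symQ 𝒲 t) = symQ 𝒲 (F t))
    (hX : ∀ i, X i ∈ 𝒲 (x i)) : F' (symProd 𝒲 (List.ofFn X)) =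
      ∑ i : Fin n, koszul x (i :: increasing {i}ᶜ) •
        symProd 𝒲 (f (X i) :: (increasing {i}ᶜ).map X) := by
  rw [← symQ_hatWord, hF', hF.apply_hatWord hf hX, map_sum]
  simp only [map_units_smul, symQ_hatWord]

omit [Internal 𝒲] in
theorem IsSymBr.apply_symProd {β : W →ₗ[𝕜] W →ₗ[𝕜] W} {ad : W →ₗ[𝕜] SymHat 𝒲 →ₗ[𝕜] SymHat 𝒲}
    {F' : SymPlus 𝒲 →ₗ[𝕜] SymPlus 𝒲} (hβ : ∀ i j, ∀ x ∈ 𝒲 i, ∀ y ∈ 𝒲 j, β x y ∈ 𝒲 (i + j + 1))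
    (had : ∀ i, ∀ x ∈ 𝒲 i, IsSymDer (i + 1) (β x) (ad x)) (hF : IsSymBr ad F)
    (hF' : ∀ t, F' (symQ 𝒲 t) = symQ 𝒲 (F t)) (hX : ∀ i, X i ∈ 𝒲 (x i)) :
    F' (symProd 𝒲 (List.ofFn X)) =
      ∑ ij : Fin n × Fin n with ij.1 < ij.2, koszul x (ij.1 :: ij.2 :: increasing {ij.1, ij.2}ᶜ) •
        symProd 𝒲 (β (X ij.1) (X ij.2) :: (increasing {ij.1, ij.2}ᶜ).map X) := by
  rw [← symQ_hatWord, hF', hF.apply_hatWord hβ had hX, map_sum]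
  simp only [map_units_smul, symQ_hatWord]

variable (𝒲) in
/-- The map `x ⊗ y ↦ X_I x ⊗ y X_J` to the tensor square of the reduced symmetric algebra. -/
noncomputable def symInsert (l l' : List W) : W ⊗[𝕜] W →ₗ[𝕜] SymPlus 𝒲 ⊗[𝕜] SymPlus 𝒲 :=
  TensorProduct.map (symQ 𝒲) (symQ 𝒲) ∘ₗ
    TensorProduct.map (hatSnoc 𝒲 l) ((hatMul 𝒲).flip (hatWord 𝒲 l'))

omit [Internal 𝒲] in
theorem symInsert_tmul (l l' : List W) (x y : W) :
    symInsert 𝒲 l l' (x ⊗ₜ y) = symProd 𝒲 (l ++ [x]) ⊗ₜ symProd 𝒲 (y :: l') := by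
  rw [symInsert, LinearMap.comp_apply, TensorProduct.map_tmul, TensorProduct.map_tmul,
    hatSnoc_apply, LinearMap.flip_apply, ← hatWord_cons, symQ_hatWord, symQ_hatWord]

theorem IsSymCobr.apply_symProd {δ : W →ₗ[𝕜] W ⊗[𝕜] W}
    {Δ C : SymHat 𝒲 →ₗ[𝕜] SymHat 𝒲 ⊗[𝕜] SymHat 𝒲} {κ : SymPlus 𝒲 →ₗ[𝕜] SymPlus 𝒲 ⊗[𝕜] SymPlus 𝒲}
    (hδ : ∀ i, ∀ x ∈ 𝒲 i, ∀ j, TensorProduct.map (pw 𝒲 j) (pw 𝒲 j) (δ x) = sg 𝕜 (j * (i + k)) • δ x)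
    (hΔ : IsSymCoprod 𝒲 Δ) (hC : IsSymCobr k δ Δ C)
    (hκ : ∀ t, κ (symQ 𝒲 t) = TensorProduct.map (symQ 𝒲) (symQ 𝒲) (C t))
    (hX : ∀ i, X i ∈ 𝒲 (x i)) : κ (symProd 𝒲 (List.ofFn X)) =
      ∑ s : Fin n, ∑ I : Finset (Fin n) with s ∉ I,
      (koszul x (increasing I ++ s :: increasing (insert s I)ᶜ) *
        (k * ∑ i ∈ I, x i).negOnePow) •
      symInsert 𝒲 ((increasing I).map X) ((increasing (insert s I)ᶜ).map X) (δ (X s)) := by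
  rw [← symQ_hatWord, hκ, hC.apply_hatWord hδ hΔ hX, map_sum]
  simp only [map_sum, map_units_smul]
  rfl

end Descent

end ABAlg

namespace ABAlg

/-! ### Closed formulas on words and packets. -/

section WordFormulas

universe u

variable {𝕜 : Type*} [Field 𝕜] {V : Type u} [AddCommGroup V] [Module 𝕜 V]
  {𝒱 : ℤ → Submodule 𝕜 V} {k c : ℤ} {n p q : ℕ}

theorem cut_word (l : List V) : cut (word 𝕜 l) =
    ∑ j ∈ Finset.range (l.length + 1), word 𝕜 (l.take j) ⊗ₜ[𝕜] word 𝕜 (l.drop j) := by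
  induction l with
  | nil => simp [word_nil]
  | cons v l ih =>
    rw [word_cons', cut_cons, List.length_cons, Finset.sum_range_succ', add_comm, ih, map_sum]
    simp [word_nil, word_cons']

theorem packet_nil : packet 𝒱 [] = 0 := mkQ_one

/-- The two extreme cuts vanish because the packet of the empty word is zero. -/
theorem kap_word (l : List V) : kap 𝒱 (word 𝕜 l) =
    ∑ j ∈ Finset.Ioo 0 l.length, packet 𝒱 (l.take j) ⊗ₜ[𝕜] packet 𝒱 (l.drop j) := by
  rw [kap, LinearMap.comp_apply, cut_word, map_sum]
  have h (l l' : List V) : mkQ₂ 𝒱 (word 𝕜 l ⊗ₜ word 𝕜 l') = packet 𝒱 l ⊗ₜ[𝕜] packet 𝒱 l' := rfl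
  simp only [h]
  refine (Finset.sum_subset (fun j hj => ?_) fun j hj hj' => ?_).symm
  · rw [Finset.mem_Ioo] at hj; exact Finset.mem_range.2 (by omega)
  · rw [Finset.mem_range] at hj
    rw [Finset.mem_Ioo] at hj'
    obtain rfl | rfl : j = 0 ∨ j = l.length := by omega
    · rw [List.take_zero, packet_nil, TensorProduct.zero_tmul]
    · rw [List.drop_length, packet_nil, TensorProduct.tmul_zero]

theorem packet_ofFn_mem_shift {e : Fin n → ℤ} {α : Fin n → V} (hα : ∀ i, α i ∈ 𝒱 (e i)) (k : ℤ) :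
    packet 𝒱 (List.ofFn α) ∈ shift (packetGrading 𝒱) k ((List.ofFn e).sum - k) := by
  rw [List.ofFn_eq_map, List.ofFn_eq_map]
  exact mkQ_mem_shift (word_map_mem hα _) k

theorem packet_take_mem_shift {e : Fin n → ℤ} {α : Fin n → V} (hα : ∀ i, α i ∈ 𝒱 (e i)) (k : ℤ)
    (j : ℕ) : packet 𝒱 ((List.ofFn α).take j) ∈
      shift (packetGrading 𝒱) k (((List.ofFn e).take j).sum - k) := by
  rw [List.ofFn_eq_map, List.ofFn_eq_map, ← List.map_take, ← List.map_take]
  exact mkQ_mem_shift (word_map_mem hα _) k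

theorem packet_drop_mem_shift {e : Fin n → ℤ} {α : Fin n → V} (hα : ∀ i, α i ∈ 𝒱 (e i)) (k : ℤ)
    (j : ℕ) : packet 𝒱 ((List.ofFn α).drop j) ∈
      shift (packetGrading 𝒱) k (((List.ofFn e).drop j).sum - k) := by
  rw [List.ofFn_eq_map, List.ofFn_eq_map, ← List.map_drop, ← List.map_drop]
  exact mkQ_mem_shift (word_map_mem hα _) k

variable [Internal 𝒱]

theorem kapAnti_word {e : Fin n → ℤ} {α : Fin n → V} (hα : ∀ i, α i ∈ 𝒱 (e i)) :
    kapAnti 𝒱 k (word 𝕜 (List.ofFn α)) = ∑ j ∈ Finset.Ioo 0 n,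
      sg 𝕜 (k * (((List.ofFn e).take j).sum - k)) •
      (packet 𝒱 ((List.ofFn α).take j) ⊗ₜ[𝕜] packet 𝒱 ((List.ofFn α).drop j) +
        sg 𝕜 ((((List.ofFn e).take j).sum - k) * (((List.ofFn e).drop j).sum - k) + k + 1) •
          packet 𝒱 ((List.ofFn α).drop j) ⊗ₜ[𝕜] packet 𝒱 ((List.ofFn α).take j)) := by
  rw [kapAnti, LinearMap.comp_apply, LinearMap.comp_apply, kap_word, List.length_ofFn, map_sum,
    map_sum]
  refine Finset.sum_congr rfl fun j _ => ?_
  rw [LinearMap.rTensor_tmul, pw_apply k (packet_take_mem_shift hα k j), ← TensorProduct.smul_tmul',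
    map_smul, LinearMap.sub_apply, LinearMap.smul_apply, LinearMap.id_apply,
    braid_tmul (packet_take_mem_shift hα k j) (packet_drop_mem_shift hα k j)]
  match_scalars <;> simp only [mul_one]
  -- The exponent `k + 1` comes from the minus sign and the factor `(-1)^k` in front of the
  -- braiding.
  rw [← neg_sg, sg_add]
  ring

theorem tensorD_word (d : V →ₗ[𝕜] V) (μ : V →ₗ[𝕜] V →ₗ[𝕜] V) {e : Fin n → ℤ} {α : Fin n → V}
    (hα : ∀ i, α i ∈ 𝒱 (e i)) : tensorD 𝒱 d μ (word 𝕜 (List.ofFn α)) =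
      (∑ k : Fin n, (∑ i with i < k, e i).negOnePow •
        word 𝕜 ((List.ofFn α).take k ++ d (α k) :: (List.ofFn α).drop (k + 1))) +
      ∑ kk : Fin n × Fin n with kk.1.val + 1 = kk.2.val, (∑ i with i < kk.1, e i).negOnePow •
        word 𝕜 ((List.ofFn α).take kk.1 ++ μ (α kk.1) (α kk.2) ::
          (List.ofFn α).drop (kk.1 + 2)) := by
  simp only [negOnePow_smul 𝕜]
  induction n with
  | zero => simp [word_nil]
  | succ n ih =>
    rw [List.ofFn_succ, word_cons', tensorD_cons d μ (hα 0), ih fun i => hα i.succ,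
      Fin.sum_univ_succ, map_add, smul_add, map_sum, map_sum, Finset.smul_sum, Finset.smul_sum]
    have h1 : ∑ i : Fin (n + 1) with i < 0, e i = 0 := by simp
    have h2 (k : Fin n) (v : V) : sg 𝕜 (e 0) • cons (α 0) (sg 𝕜 (∑ i with i < k, e i.succ) •
        word 𝕜 ((List.ofFn fun i => α i.succ).take k ++ v ::
          (List.ofFn fun i => α i.succ).drop (k + 1))) =
        sg 𝕜 (∑ i with i < k.succ, e i) • word 𝕜 ((α 0 :: List.ofFn fun i => α i.succ).take k.succ ++
          v :: (α 0 :: List.ofFn fun i => α i.succ).drop (k.succ + 1)) := by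
      rw [sum_lt_succ, Fin.val_succ, List.take_succ_cons, List.drop_succ_cons, List.cons_append,
        word_cons', map_smul, smul_smul, sg_add]
    have h3 (k : Fin n) (v : V) : sg 𝕜 (e 0) • cons (α 0) (sg 𝕜 (∑ i with i < k, e i.succ) •
        word 𝕜 ((List.ofFn fun i => α i.succ).take k ++ v ::
          (List.ofFn fun i => α i.succ).drop (k + 2))) =
        sg 𝕜 (∑ i with i < k.succ, e i) • word 𝕜 ((α 0 :: List.ofFn fun i => α i.succ).take k.succ ++
          v :: (α 0 :: List.ofFn fun i => α i.succ).drop (k.succ + 2)) := by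
      rw [sum_lt_succ, Fin.val_succ, List.take_succ_cons, add_right_comm _ 1 2, List.drop_succ_cons,
        List.cons_append, word_cons', map_smul, smul_smul, sg_add]
    simp only [h2, h3]
    rw [h1, sg_zero, one_smul, add_add_add_comm, add_assoc, add_assoc]
    congr 1
    -- `headMul` provides the product at the first two places, which is absent from a word of one
    -- letter.
    cases n with
    | zero =>
      simp [word_nil, Finset.sum_filter]
    | succ n =>
      rw [sum_consecutive, List.ofFn_succ (f := fun i : Fin (n + 1) => α i.succ), word_cons',
        headMul_cons]
      simp [word_cons', sg_zero]

theorem packetBr_word {L : Packets 𝒱 →ₗ[𝕜] Packets 𝒱 →ₗ[𝕜] Packets 𝒱} {ℓ : V →ₗ[𝕜] V →ₗ[𝕜] V}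
    (hL : ∀ s t, L ((shuffles 𝒱).mkQ s) ((shuffles 𝒱).mkQ t) = (shuffles 𝒱).mkQ (shBr 𝒱 c ℓ s t))
    {e : Fin (p + q) → ℤ} {α : Fin (p + q) → V} (hα : ∀ i, α i ∈ 𝒱 (e i)) :
    L (packet 𝒱 (List.ofFn fun i : Fin p => α (Fin.castAdd q i)))
      (packet 𝒱 (List.ofFn fun j : Fin q => α (Fin.natAdd p j))) =
    ∑ σ ∈ Bat p q, ∑ kk : Fin (p + q) × Fin (p + q) with
        kk.1.val + 1 = kk.2.val ∧ (σ⁻¹ kk.1).val < p ∧ p ≤ (σ⁻¹ kk.2).val,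
      (koszul e (List.ofFn fun i => σ⁻¹ i) *
        (c * ∑ s with s < kk.1, e (σ⁻¹ s)).negOnePow) •
      packet 𝒱 ((List.ofFn fun i => α (σ⁻¹ i)).take kk.1 ++
        ℓ (α (σ⁻¹ kk.1)) (α (σ⁻¹ kk.2)) :: (List.ofFn fun i => α (σ⁻¹ i)).drop (kk.1 + 2)) := by
  have h := sum_shuf_brWord hα (fun i : Fin (p + q) => i.val < p) c ℓ
    (pairwise_firstIdx (p := p) (q := q)) pairwise_lastIdx
    (fun x hx y hy => by
      have := mem_firstIdx.1 hx; have := mem_lastIdx.1 hy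
      exact Fin.lt_def.2 (by omega))
    (fun x hx => mem_firstIdx.1 hx) (fun y hy => by have := mem_lastIdx.1 hy; omega)
  rw [← sum_Bat (p := p) (q := q) fun L => koszul e L •
    brWord 𝕜 e α (fun i : Fin (p + q) => i.val < p) c ℓ L] at h
  simp only [firstIdx, lastIdx, ← List.ofFn_eq_map, List.map_ofFn, Function.comp_def] at h
  rw [packet, packet, hL, ← h, map_sum]
  refine Finset.sum_congr rfl fun σ _ => ?_
  rw [map_units_smul, brWord_ofFn, map_sum, Finset.smul_sum]
  simp only [not_lt, map_units_smul, smul_smul, packet]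

end WordFormulas

end ABAlg

namespace ABAlg

/-! ### The operations of the `(a,b)`-algebra: existence, uniqueness and signs. -/

section CoderivationSum

variable {𝕜 : Type*} [Field 𝕜] {C : Type*} [AddCommGroup C] [Module 𝕜 C]

theorem IsCoderivation.add {𝒢 : ℤ → Submodule 𝕜 C} {P : Parity 𝒢} {k : ℤ}
    {κ : C →ₗ[𝕜] C ⊗[𝕜] C} {f g : C →ₗ[𝕜] C} (hf : IsCoderivation P k κ f)
    (hg : IsCoderivation P k κ g) : IsCoderivation P k κ (f + g) := by
  have h : tensorAction P (f + g) = tensorAction P f + tensorAction P g := by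
    simp only [tensorAction, TensorProduct.map_add_left, TensorProduct.map_add_right]
    abel
  rw [IsCoderivation, h, LinearMap.add_comp, hf, hg, LinearMap.comp_add, smul_add]

theorem der_smul {𝒢 : ℤ → Submodule 𝕜 C} [Internal 𝒢] (j : ℤ) (c : 𝕜) (f : C →ₗ[𝕜] C) :
    der 𝒢 j (c • f) = c • der 𝒢 j f := by
  simp [der, LinearMap.rTensor_smul, TensorProduct.map_smul_right]

end CoderivationSum

section Algebra

universe u

variable {𝕜 : Type*} [Field 𝕜] {A : Type u} [AddCommGroup A] [Module 𝕜 A]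
  {𝒜 : ℤ → Submodule 𝕜 A} {a b : ℤ} {mul br : A →ₗ[𝕜] A →ₗ[𝕜] A} {d : A →ₗ[𝕜] A}

section Uniqueness

variable [Internal 𝒜]

theorem IsD.unique {D D' : H 𝒜 a →ₗ[𝕜] H 𝒜 a} (h : IsD 𝒜 a mul d D) (h' : IsD 𝒜 a mul d D') :
    D = D' := by
  refine packets_hom_ext (span_homogeneous (𝒲 := gradA 𝒜 a)) fun l hl => ?_
  obtain ⟨n, e, α, hα, rfl⟩ := exists_eq_ofFn hl
  exact (h n e α hα).trans (h' n e α hα).symm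

theorem IsEllTwo.unique {L L' : H 𝒜 a →ₗ[𝕜] H 𝒜 a →ₗ[𝕜] H 𝒜 a} (h : IsEllTwo 𝒜 a b br L)
    (h' : IsEllTwo 𝒜 a b br L') : L = L' := by
  refine packets_hom_ext (span_homogeneous (𝒲 := gradA 𝒜 a)) fun l hl =>
    packets_hom_ext (span_homogeneous (𝒲 := gradA 𝒜 a)) fun l' hl' => ?_
  obtain ⟨p, e, α, hα, rfl⟩ := exists_eq_ofFn hl
  obtain ⟨q, e', α', hα', rfl⟩ := exists_eq_ofFn hl'
  have hα'' (i) : Fin.append α α' i ∈ gradA 𝒜 a (Fin.append e e' i) := by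
    refine Fin.addCases (fun i => ?_) (fun i => ?_) i
    · simpa using hα i
    · simpa using hα' i
  have := (h p q _ _ hα'').trans (h' p q _ _ hα'').symm
  simpa only [Fin.append_left, Fin.append_right] using this

theorem IsDelta.unique {Δ Δ' : S 𝒜 a b →ₗ[𝕜] S 𝒜 a b ⊗[𝕜] S 𝒜 a b} (h : IsDelta 𝒜 a b Δ)
    (h' : IsDelta 𝒜 a b Δ') : Δ = Δ' := by
  refine symPlus_hom_ext (span_homogeneous (𝒲 := gradH 𝒜 a b)) fun l hl => ?_
  obtain ⟨n, x, X, hX, rfl⟩ := exists_eq_ofFn hl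
  exact (h n x X hX).trans (h' n x X hX).symm

theorem IsM.unique {D : H 𝒜 a →ₗ[𝕜] H 𝒜 a} {m m' : S 𝒜 a b →ₗ[𝕜] S 𝒜 a b} (h : IsM 𝒜 a b D m)
    (h' : IsM 𝒜 a b D m') : m = m' := by
  refine symPlus_hom_ext (span_homogeneous (𝒲 := gradH 𝒜 a b)) fun l hl => ?_
  obtain ⟨n, x, X, hX, rfl⟩ := exists_eq_ofFn hl
  exact (h n x X hX).trans (h' n x X hX).symm

theorem IsEll''.unique {L : H 𝒜 a →ₗ[𝕜] H 𝒜 a →ₗ[𝕜] H 𝒜 a} {l l' : S 𝒜 a b →ₗ[𝕜] S 𝒜 a b}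
    (h : IsEll'' 𝒜 a b L l) (h' : IsEll'' 𝒜 a b L l') : l = l' := by
  refine symPlus_hom_ext (span_homogeneous (𝒲 := gradH 𝒜 a b)) fun l hl => ?_
  obtain ⟨n, x, X, hX, rfl⟩ := exists_eq_ofFn hl
  exact (h n x X hX).trans (h' n x X hX).symm

/-- The formula for `δ''` is prescribed only on products of packets of homogeneous letters, so its
uniqueness needs these packets to span. -/
theorem span_packets : Submodule.span 𝕜 {X : H 𝒜 a | ∃ (n : ℕ) (e : Fin n → ℤ) (α : Fin n → A),
    (∀ i, α i ∈ gradA 𝒜 a (e i)) ∧ X = pk 𝒜 a (List.ofFn α)} = ⊤ := by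
  have h := congrArg (Submodule.map (shuffles (gradA 𝒜 a)).mkQ)
    (span_homogeneous_words (𝒱 := gradA 𝒜 a))
  rw [Submodule.map_top, Submodule.range_mkQ, Submodule.map_span] at h
  rw [eq_top_iff, ← h]
  refine Submodule.span_mono ?_
  rintro _ ⟨_, ⟨n, e, α, hα, rfl⟩, rfl⟩
  exact ⟨n, e, α, hα, rfl⟩

theorem IsCobracket''.unique {δ δ' : S 𝒜 a b →ₗ[𝕜] S 𝒜 a b ⊗[𝕜] S 𝒜 a b}
    (h : IsCobracket'' 𝒜 a b δ) (h' : IsCobracket'' 𝒜 a b δ') : δ = δ' := by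
  refine symPlus_hom_ext span_packets fun l hl => ?_
  choose N e α hα hX using fun i : Fin l.length => hl _ (l.get_mem i)
  have hl' : l = List.ofFn fun s => pk 𝒜 a (List.ofFn (α s)) := by
    rw [← funext hX]; exact (List.ofFn_get l).symm
  rw [hl']
  exact (h _ N e α hα).trans (h' _ N e α hα).symm

end Uniqueness

variable [DirectSum.Decomposition 𝒜]

variable (𝒜 a) in
/-- The bilinear map `μ` on `A[-a+1]`. -/
noncomputable def muMap (mul : A →ₗ[𝕜] A →ₗ[𝕜] A) : A →ₗ[𝕜] A →ₗ[𝕜] A := mul ∘ₗ pw (gradA 𝒜 a) 1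

variable (𝒜 a b) in
/-- The bilinear map `ℓ` on `A[-a+1]`. -/
noncomputable def ellMap (br : A →ₗ[𝕜] A →ₗ[𝕜] A) : A →ₗ[𝕜] A →ₗ[𝕜] A :=
  br ∘ₗ pw (gradA 𝒜 a) (1 - (a - b))

variable {i j : ℤ} {x y : A}

theorem muMap_apply (hx : x ∈ gradA 𝒜 a i) (y : A) : muMap 𝒜 a mul x y = mu mul i x y := by
  rw [muMap, LinearMap.comp_apply, pw_apply _ hx, one_mul, map_smul, LinearMap.smul_apply, mu,
    negOnePow_smul 𝕜]

theorem ellMap_apply (hx : x ∈ gradA 𝒜 a i) (y : A) :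
    ellMap 𝒜 a b br x y = ell a b br i x y := by
  rw [ellMap, LinearMap.comp_apply, pw_apply _ hx, map_smul, LinearMap.smul_apply, ell,
    negOnePow_smul 𝕜, show b - a + 1 = 1 - (a - b) by ring]

namespace IsDGABAlgebra

variable (hA : IsDGABAlgebra 𝒜 a b mul br d)

include hA

omit [DirectSum.Decomposition 𝒜] in
theorem d_mem' : ∀ i, ∀ v ∈ gradA 𝒜 a i, d v ∈ gradA 𝒜 a (i + 1) := fun i v hv => by
  rw [gradA, shift, add_right_comm]; exact hA.d_mem _ _ hv

theorem muMap_mem : ∀ i j, ∀ v ∈ gradA 𝒜 a i, ∀ w ∈ gradA 𝒜 a j,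
    muMap 𝒜 a mul v w ∈ gradA 𝒜 a (i + j + 1) := fun i j v hv w hw => by
  rw [muMap_apply hv, mu, negOnePow_smul 𝕜]
  refine Submodule.smul_mem _ _ ?_
  rw [gradA, shift, show i + j + 1 + (-a + 1) = i + (-a + 1) + (j + (-a + 1)) + a by ring]
  exact hA.mul_mem _ _ _ _ hv hw

/-- In degree `i` of `A[-a+1]` one has `|v| + a = i + 1`. The exponent `(i + 1)(j + 1)`, with the
factors `(-1)^i` and `(-1)^j` of `μ`, reduces to `i j + 1`. -/
theorem muMap_comm : ∀ i j, ∀ v ∈ gradA 𝒜 a i, ∀ w ∈ gradA 𝒜 a j,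
    muMap 𝒜 a mul v w = sg 𝕜 (i * j + 1) • muMap 𝒜 a mul w v := fun i j v hv w hw => by
  rw [muMap_apply hv, muMap_apply hw, mu, mu, hA.mul_comm _ _ _ _ hv hw]
  simp only [negOnePow_smul 𝕜, smul_smul, ← sg_add]
  congr 1
  exact sg_congr (by clear * -; grind)

theorem ellMap_mem : ∀ i j, ∀ v ∈ gradA 𝒜 a i, ∀ w ∈ gradA 𝒜 a j,
    ellMap 𝒜 a b br v w ∈ gradA 𝒜 a (i + j + (1 - (a - b))) := fun i j v hv w hw => by
  rw [ellMap_apply hv, ell, negOnePow_smul 𝕜]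
  refine Submodule.smul_mem _ _ ?_
  rw [gradA, shift, show i + j + (1 - (a - b)) + (-a + 1) =
    i + (-a + 1) + (j + (-a + 1)) + b by ring]
  exact hA.br_mem _ _ _ _ hv hw

/-- With `c = 1 - (a - b)` the degree of `ℓ`, one has `|v| + b = i + c`. The exponent `(i + c)(j +
c) + 1`, with the factors `(-1)^(c i)` and `(-1)^(c j)`, reduces to `i j + c + 1`. -/
theorem ellMap_comm : ∀ i j, ∀ v ∈ gradA 𝒜 a i, ∀ w ∈ gradA 𝒜 a j,
    ellMap 𝒜 a b br v w = sg 𝕜 (i * j + (1 - (a - b)) + 1) • ellMap 𝒜 a b br w v :=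
  fun i j v hv w hw => by
  rw [ellMap_apply hv, ellMap_apply hw, ell, ell, hA.br_antisymm _ _ _ _ hv hw]
  simp only [negOnePow_smul 𝕜, smul_smul, ← neg_smul, neg_sg, ← sg_add]
  congr 1
  refine sg_congr ?_
  simp only [Int.even_sub, Int.even_add, Int.even_mul]
  clear * -
  grind

theorem exists_isD : ∃ D, IsD 𝒜 a mul d D ∧ ∀ s, D ((shuffles (gradA 𝒜 a)).mkQ s) =
    (shuffles (gradA 𝒜 a)).mkQ (tensorD (gradA 𝒜 a) d (muMap 𝒜 a mul) s) := by
  obtain ⟨D, hD⟩ := exists_packetD hA.d_mem' hA.muMap_mem hA.muMap_comm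
  refine ⟨D, fun n e α hα => ?_, hD⟩
  rw [pk, packet, hD, tensorD_word d _ hα, map_add, map_sum, map_sum]
  simp only [map_units_smul, muMap_apply (hα _), ← packet.eq_1]

theorem exists_isEllTwo : ∃ L, IsEllTwo 𝒜 a b br L ∧ ∀ s t,
    L ((shuffles (gradA 𝒜 a)).mkQ s) ((shuffles (gradA 𝒜 a)).mkQ t) =
      (shuffles (gradA 𝒜 a)).mkQ (shBr (gradA 𝒜 a) (1 - (a - b)) (ellMap 𝒜 a b br) s t) := by
  obtain ⟨L, hL⟩ := exists_packetBr hA.ellMap_mem hA.ellMap_comm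
  refine ⟨L, fun p q e α hα => ?_, hL⟩
  rw [pk, pk, packetBr_word hL hα]
  simp only [ellMap_apply (hα _), show b - a + 1 = 1 - (a - b) by ring]

end IsDGABAlgebra

variable (𝒜 a b) in
theorem exists_isDelta : ∃ Δ Δ', IsDelta 𝒜 a b Δ ∧ IsSymCoprod (gradH 𝒜 a b) Δ' ∧
    ∀ t, Δ (symQ _ t) = TensorProduct.map (symQ _) (symQ _) (Δ' t) := by
  obtain ⟨Δ', h'⟩ := exists_symCoprod (gradH 𝒜 a b)
  obtain ⟨Δ, h⟩ := exists_descent (F := TensorProduct.map (symQ (gradH 𝒜 a b)) (symQ _) ∘ₗ Δ')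
    (by rw [LinearMap.comp_apply, h'.one, TensorProduct.map_tmul, symQ_hatOne,
      TensorProduct.zero_tmul])
  exact ⟨Δ, Δ', fun n x X hX => h'.apply_symProd h hX, h', h⟩

theorem exists_isCobracket'' {Δ' : SymHat (gradH 𝒜 a b) →ₗ[𝕜] _}
    (hΔ : IsSymCoprod (gradH 𝒜 a b) Δ') : ∃ (δ : _) (δ₀ : H 𝒜 a →ₗ[𝕜] H 𝒜 a ⊗[𝕜] H 𝒜 a) (C : _),
    IsCobracket'' 𝒜 a b δ ∧
    (∀ s, δ₀ ((shuffles (gradA 𝒜 a)).mkQ s) = kapAnti (gradA 𝒜 a) (a - b) s) ∧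
    IsSymCobr (a - b) δ₀ Δ' C ∧
    ∀ t, δ (symQ _ t) = TensorProduct.map (symQ _) (symQ _) (C t) := by
  obtain ⟨δ₀, hδ₀⟩ := exists_packetCobracket (gradA 𝒜 a) (a - b)
  have hpw := fun i x (hx : x ∈ gradH 𝒜 a b i) => pw_packetCobracket hδ₀ hx
  obtain ⟨C, hC⟩ := exists_symCobr hpw hΔ
  obtain ⟨δ, h⟩ := exists_descent (F := TensorProduct.map (symQ (gradH 𝒜 a b)) (symQ _) ∘ₗ C)
    (by rw [LinearMap.comp_apply, hC.one, map_zero])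
  refine ⟨δ, δ₀, C, fun n N e α hα => ?_, hδ₀, hC, h⟩
  intro X x
  rw [sp, hC.apply_symProd hpw hΔ h (x := x) fun s => packet_ofFn_mem_shift (hα s) (a - b)]
  refine Finset.sum_congr rfl fun s _ => Finset.sum_congr rfl fun I _ => ?_
  have hX : δ₀ (X s) = _ := (hδ₀ _).trans (kapAnti_word (hα s))
  rw [hX, map_sum, Finset.smul_sum]
  refine Finset.sum_congr rfl fun j _ => ?_
  dsimp only
  rw [map_smul, map_add, map_smul, symInsert_tmul, symInsert_tmul, mul_add, Int.negOnePow_add,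
    ← mul_assoc, mul_smul (_ * _), negOnePow_smul 𝕜, negOnePow_smul 𝕜]
  rfl

/-- The bracket `ℓ''₂` as a bilinear map. -/
noncomputable def betaMap (b : ℤ) (L : H 𝒜 a →ₗ[𝕜] H 𝒜 a →ₗ[𝕜] H 𝒜 a) :
    H 𝒜 a →ₗ[𝕜] H 𝒜 a →ₗ[𝕜] H 𝒜 a :=
  sg 𝕜 (a - b - 1) • (L ∘ₗ pw (gradH 𝒜 a b) (a - b))

theorem betaMap_apply {L : H 𝒜 a →ₗ[𝕜] H 𝒜 a →ₗ[𝕜] H 𝒜 a} {X : H 𝒜 a}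
    (hX : X ∈ gradH 𝒜 a b i) : betaMap b L X = sg 𝕜 (a - b - 1 + (a - b) * i) • L X := by
  rw [betaMap, LinearMap.smul_apply, LinearMap.comp_apply, pw_apply _ hX, map_smul, smul_smul,
    sg_add]

omit [DirectSum.Decomposition 𝒜] in
theorem ellTwo''_eq (L : H 𝒜 a →ₗ[𝕜] H 𝒜 a →ₗ[𝕜] H 𝒜 a) (X Y : H 𝒜 a) :
    ellTwo'' b L i X Y = sg 𝕜 (a - b - 1 + (a - b) * i) • L X Y := by
  rw [ellTwo'', negOnePow_smul 𝕜, negOnePow_smul 𝕜, smul_smul, ← sg_add]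
  congr 1
  exact sg_congr (by clear * -; grind)

section Beta

variable (hA : IsDGABAlgebra 𝒜 a b mul br d) {L : H 𝒜 a →ₗ[𝕜] H 𝒜 a →ₗ[𝕜] H 𝒜 a}
  (hL : ∀ s t, L ((shuffles (gradA 𝒜 a)).mkQ s) ((shuffles (gradA 𝒜 a)).mkQ t) =
    (shuffles (gradA 𝒜 a)).mkQ (shBr (gradA 𝒜 a) (1 - (a - b)) (ellMap 𝒜 a b br) s t))

include hA hL

theorem betaMap_mem : ∀ i j, ∀ X ∈ gradH 𝒜 a b i, ∀ Y ∈ gradH 𝒜 a b j,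
    betaMap b L X Y ∈ gradH 𝒜 a b (i + j + 1) := fun i j X hX Y hY => by
  rw [betaMap_apply hX, LinearMap.smul_apply]
  refine Submodule.smul_mem _ _ ?_
  rw [gradH, shift, show i + j + 1 + (a - b) = i + (a - b) + (j + (a - b)) + (1 - (a - b)) by ring]
  exact packetBr_mem hL hA.ellMap_mem hX hY

/-- With `k = a - b`, the exponent in the symmetry of the packet bracket is `(i + k)(j + k) - k`
modulo `2`. The factors `(-1)^(k i)` and `(-1)^(k j)` of `ℓ''₂` reduce it to `i j`, as symmetric
powers require. -/
theorem betaMap_comm : ∀ i j, ∀ X ∈ gradH 𝒜 a b i, ∀ Y ∈ gradH 𝒜 a b j,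
    betaMap b L X Y = sg 𝕜 (i * j) • betaMap b L Y X := fun i j X hX Y hY => by
  rw [betaMap_apply hX, betaMap_apply hY, LinearMap.smul_apply, LinearMap.smul_apply,
    packetBr_symm hL hA.ellMap_comm hX hY, smul_smul, smul_smul, ← sg_add, ← sg_add]
  congr 1
  refine sg_congr ?_
  generalize a - b = k
  simp only [Int.even_sub, Int.even_add, Int.even_mul]
  clear * -
  grind

/-- The cocycle condition `packetCobracket_br` with the signs of `ℓ''₂`, in the form required by
`IsSymBr.ad_cobr`. -/
theorem cobracket_betaMap {δ : H 𝒜 a →ₗ[𝕜] H 𝒜 a ⊗[𝕜] H 𝒜 a}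
    (hδ : ∀ s, δ ((shuffles (gradA 𝒜 a)).mkQ s) = kapAnti (gradA 𝒜 a) (a - b) s) :
    ∀ i j, ∀ X ∈ gradH 𝒜 a b i, ∀ Y ∈ gradH 𝒜 a b j, δ (betaMap b L X Y) =
      sg 𝕜 (a - b + (i + (a - b)) * j) • der (gradH 𝒜 a b) (j + 1) (betaMap b L Y) (δ X) +
        sg 𝕜 (a - b + (a - b) * i) • der (gradH 𝒜 a b) (i + 1) (betaMap b L X) (δ Y) :=
  fun i j X hX Y hY => by
  rw [betaMap_apply hX, betaMap_apply hY, der_smul, der_smul, LinearMap.smul_apply,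
    LinearMap.smul_apply, LinearMap.smul_apply, map_smul,
    packetCobracket_br hδ hL hA.ellMap_mem hA.ellMap_comm hX hY]
  match_scalars <;> simp only [mul_one, neg_sg, ← sg_add] <;> generalize a - b = k <;> refine sg_congr ?_ <;>
    simp only [Int.even_sub, Int.even_add, Int.even_mul] <;> clear * - <;> grind

end Beta

theorem exists_isM {D : H 𝒜 a →ₗ[𝕜] H 𝒜 a} (hD : HasDegree (gradH 𝒜 a b) 1 D) :
    ∃ m F, IsM 𝒜 a b D m ∧ IsSymDer 1 D F ∧ ∀ t, m (symQ _ t) = symQ (gradH 𝒜 a b) (F t) := by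
  obtain ⟨F, hF⟩ := exists_symDer hD
  obtain ⟨m, h⟩ := exists_descent (F := symQ (gradH 𝒜 a b) ∘ₗ F)
    (by rw [LinearMap.comp_apply, hF.one, map_zero])
  exact ⟨m, F, fun n x X hX => hF.apply_symProd hD h hX, hF, h⟩

theorem exists_isEll'' {L : H 𝒜 a →ₗ[𝕜] H 𝒜 a →ₗ[𝕜] H 𝒜 a}
    (hβ : ∀ i j, ∀ X ∈ gradH 𝒜 a b i, ∀ Y ∈ gradH 𝒜 a b j,
      betaMap b L X Y ∈ gradH 𝒜 a b (i + j + 1))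
    (hβc : ∀ i j, ∀ X ∈ gradH 𝒜 a b i, ∀ Y ∈ gradH 𝒜 a b j,
      betaMap b L X Y = sg 𝕜 (i * j) • betaMap b L Y X) :
    ∃ l ad F, IsEll'' 𝒜 a b L l ∧
      (∀ i, ∀ X ∈ gradH 𝒜 a b i, IsSymDer (i + 1) (betaMap b L X) (ad X)) ∧ IsSymBr ad F ∧
      ∀ t, l (symQ _ t) = symQ (gradH 𝒜 a b) (F t) := by
  obtain ⟨ad, had⟩ := exists_symAd hβ
  obtain ⟨F, hF⟩ := exists_symBr hβc had
  obtain ⟨l, h⟩ := exists_descent (F := symQ (gradH 𝒜 a b) ∘ₗ F)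
    (by rw [LinearMap.comp_apply, hF.one, map_zero])
  refine ⟨l, ad, F, fun n x X hX => ?_, had, hF, h⟩
  rw [sp, hF.apply_symProd hβ had h hX]
  simp only [betaMap_apply (hX _), ellTwo''_eq, LinearMap.smul_apply]

omit [DirectSum.Decomposition 𝒜] in
theorem hasDegree_packetD [Internal 𝒜] (hA : IsDGABAlgebra 𝒜 a b mul br d) {μ : A →ₗ[𝕜] A →ₗ[𝕜] A}
    (hμ : ∀ i j, ∀ v ∈ gradA 𝒜 a i, ∀ w ∈ gradA 𝒜 a j, μ v w ∈ gradA 𝒜 a (i + j + 1))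
    {D : H 𝒜 a →ₗ[𝕜] H 𝒜 a} (hD : ∀ s, D ((shuffles (gradA 𝒜 a)).mkQ s) =
      (shuffles (gradA 𝒜 a)).mkQ (tensorD (gradA 𝒜 a) d μ s)) : HasDegree (gradH 𝒜 a b) 1 D := by
  intro i X hX
  rw [gradH, shift, packetGrading_eq_map] at hX
  obtain ⟨s, hs, rfl⟩ := hX
  rw [hD, gradH, shift, add_right_comm]
  exact mkQ_mem (tensorD_mem hA.d_mem' hμ hs)

end Algebra

end ABAlg
-- The proposition.
open ABAlg in
theorem proposition4p5 {𝕜 : Type*} [Field 𝕜] {A : Type*} [AddCommGroup A] [Module 𝕜 A]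
    (𝒜 : ℤ → Submodule 𝕜 A) [DirectSum.Decomposition 𝒜] (a b : ℤ)
    (mul br : A →ₗ[𝕜] A →ₗ[𝕜] A) (d : A →ₗ[𝕜] A) (hA : IsDGABAlgebra 𝒜 a b mul br d) :
    (∃! D, IsD 𝒜 a mul d D) ∧ (∃! L, IsEllTwo 𝒜 a b br L) ∧
    (∃! Δ, IsDelta 𝒜 a b Δ) ∧ (∃! δ, IsCobracket'' 𝒜 a b δ) ∧
    ∀ D L Δ δ, IsD 𝒜 a mul d D → IsEllTwo 𝒜 a b br L → IsDelta 𝒜 a b Δ → IsCobracket'' 𝒜 a b δ →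
      (∃! m, IsM 𝒜 a b D m) ∧ (∃! l, IsEll'' 𝒜 a b L l) ∧
      ∀ m l, IsM 𝒜 a b D m → IsEll'' 𝒜 a b L l →
        (HasDegree (gradS 𝒜 a b) 1 m ∧ HasDegree (gradS 𝒜 a b) 1 l) ∧
        (IsCoderivation (parityS 𝒜 a b) 0 Δ m ∧ IsCoderivation (parityS 𝒜 a b) 0 Δ l) ∧
        (IsCoderivation (parityS 𝒜 a b) (a - b) δ m ∧
          IsCoderivation (parityS 𝒜 a b) (a - b) δ l) ∧
        IsCoderivation (parityS 𝒜 a b) 0 Δ (m + l) ∧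
        IsCoderivation (parityS 𝒜 a b) (a - b) δ (m + l) := by
  obtain ⟨D₀, hD₀, hDt⟩ := hA.exists_isD
  obtain ⟨L₀, hL₀, hLt⟩ := hA.exists_isEllTwo
  obtain ⟨Δ₀, Δ', hΔ₀, hΔ', hΔq⟩ := exists_isDelta 𝒜 a b
  obtain ⟨δ₀, δ', C, hδ₀, hδ', hC, hδq⟩ := exists_isCobracket'' hΔ'
  refine ⟨⟨D₀, hD₀, fun D h => h.unique hD₀⟩, ⟨L₀, hL₀, fun L h => h.unique hL₀⟩,
    ⟨Δ₀, hΔ₀, fun Δ h => h.unique hΔ₀⟩, ⟨δ₀, hδ₀, fun δ h => h.unique hδ₀⟩, ?_⟩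
  intro D L Δ δ hD hL hΔ hδ
  -- By uniqueness the given maps are the constructed ones, for which the recursions are available.
  obtain rfl := hD.unique hD₀
  obtain rfl := hL.unique hL₀
  obtain rfl := hΔ.unique hΔ₀
  obtain rfl := hδ.unique hδ₀
  have hDdeg : HasDegree (gradH 𝒜 a b) 1 D := hasDegree_packetD hA hA.muMap_mem hDt
  have hβ := betaMap_mem hA hLt
  have hβc := betaMap_comm hA hLt
  have hpw := fun i X (hX : X ∈ gradH 𝒜 a b i) => pw_packetCobracket hδ' hX
  obtain ⟨m₀, F, hm₀, hF, hmq⟩ := exists_isM hDdeg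
  obtain ⟨l₀, ad, G, hl₀, had, hG, hlq⟩ := exists_isEll'' hβ hβc
  refine ⟨⟨m₀, hm₀, fun m h => h.unique hm₀⟩, ⟨l₀, hl₀, fun l h => h.unique hl₀⟩, ?_⟩
  intro m l hm hl
  obtain rfl := hm.unique hm₀
  obtain rfl := hl.unique hl₀
  -- Each identity is proved on the symmetric algebra with unit and then passed to the quotient by
  -- the scalars.
  have hmΔ : IsCoderivation (parityS 𝒜 a b) 0 Δ m := isCoderivation_descent _ hmq hΔq fun t => by
    rw [hF.coprod hDdeg hΔ', sg_zero, one_smul]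
  have hlΔ : IsCoderivation (parityS 𝒜 a b) 0 Δ l := isCoderivation_descent _ hlq hΔq fun t => by
    rw [hG.coprod hβ had hΔ', sg_zero, one_smul]
  have hmδ : IsCoderivation (parityS 𝒜 a b) (a - b) δ m :=
    isCoderivation_descent _ hmq hδq fun t => by
      have := IsSymDer.cobr hpw hΔ' hC hDdeg hF (fun X => by
        rw [one_mul]; exact der_packetCobracket hδ' hDt hDdeg X) t
      rwa [one_mul] at this
  have hlδ : IsCoderivation (parityS 𝒜 a b) (a - b) δ l :=
    isCoderivation_descent _ hlq hδq fun t =>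
      IsSymBr.cobr hpw hΔ' hC hβ hβc had hG (cobracket_betaMap hA hLt hδ') t
  exact ⟨⟨hasDegree_descent hmq (hF.degree hDdeg), hasDegree_descent hlq (hG.degree hβ had)⟩,
    ⟨hmΔ, hlΔ⟩, ⟨hmδ, hlδ⟩, hmΔ.add hlΔ, hmδ.add hlδ⟩
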